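/- **Setting.** Let $(H,\cdot,1,\Delta,\varepsilon,S)$ be a finite-dimensional Hopf algebra over $\mathbb{C}$ with a universal $R$-matrix $R=a_i\otimes b_i$ (invertible, $\Delta^{\mathrm{op}}(x)R=R\Delta(x)$, $(\Delta\otimes\mathrm{id})(R)=R_{13}R_{23}$, $(\mathrm{id}\otimes\Delta)(R)=R_{13}R_{12}$), and put $R'=b_i\otimes a_i$. Assume that $H$ is factorizable, i.e. $\Psi:H^*\to H$, $\Psi(\beta)=(\beta\otimes\mathrm{id})(RR')$, is bijective, and let $v$ be a ribbon element: $v$ is central and invertible, $\Delta(v)=(R'R)^{-1}(v\otimes v)$, $S(v)=v$, $\varepsilon(v)=1$ and $v^2=uS(u)$ where $u=S(b_i)a_i$. For a finite-dimensional representation $I$ of $H$ let $\overset{I}{T}$ be its matrix of matrix coefficients in $H^*$. * $\mathcal{L}_{0,1}(H)$ is the quotient of the tensor algebra $T(H^*)$ by the relations $\overset{I\otimes J}{M}_{12}=\overset{I}{M}_1(R')_{12}\overset{J}{M}_2(R')^{-1}_{12}$ for all finite-dimensional $I,J$, and $M=1$ for the trivial representation; here $\overset{I}{M}$ is the image of $\overset{I}{T}$.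 It is identified with $H$ by $\overset{I}{M}\mapsto(\overset{I}{T}\otimes\mathrm{id})(RR')$. * $\mathcal{L}_{1,0}(H)$ is the quotient of the free product of two copies of $\mathcal{L}_{0,1}(H)$, with generating matrices $\overset{I}{B}$ and $\overset{I}{A}$, by $R_{12}\overset{I}{B}_1R'_{12}\overset{J}{A}_2=\overset{J}{A}_2R_{12}\overset{I}{B}_1R_{12}^{-1}$. For $x\in H=\mathcal{L}_{0,1}(H)$, let $x_A,x_B\in\mathcal{L}_{1,0}(H)$ be its images under $\overset{I}{M}\mapsto\overset{I}{A}$ and $\overset{I}{M}\mapsto\overset{I}{B}$. * $H$ acts on the right on $\mathcal{L}_{1,0}(H)$ by $\overset{I}{U}\cdot h=\overset{I}{h'}\,\overset{I}{U}\,\overset{I}{S(h'')}$ for $U=A,B$, $(xy)\cdot h=(x\cdot h')(y\cdot h'')$ and $1\cdot h=\varepsilon(h)1$. Let $\mathcal{L}^{\mathrm{inv}}_{1,0}(H)=\{x\mid x\cdot h=\varepsilon(h)x\ \ \forall h\in H\}$. * $\mathcal{L}_{1,0}(H)$ is represented on $H^*$ by $\overset{I}{A}\mapsto\overset{I}{L}{}^{(+)}\overset{I}{L}{}^{(-)-1}$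 and $\overset{I}{B}\mapsto\overset{I}{L}{}^{(+)}\overset{I}{T}\overset{I}{L}{}^{(-)-1}$, where $\overset{I}{L}{}^{(+)}=(\overset{I}{T}\otimes\mathrm{id})(R)$, $\overset{I}{L}{}^{(-)-1}=(\overset{I}{T}\otimes\mathrm{id})(R')$, $h\in H$ acts by $\psi\mapsto\psi(?\,h)$ and $\varphi\in H^*$ acts by $\psi\mapsto\varphi\psi$, $(\varphi\psi)(x)=\varphi(x')\psi(x'')$. The subalgebra $\mathcal{L}^{\mathrm{inv}}_{1,0}(H)$ preserves $\mathrm{SLF}(H)=\{\psi\in H^*\mid\psi(xy)=\psi(yx)\ \ \forall x,y\}$; let $\rho_{\mathrm{SLF}}:\mathcal{L}^{\mathrm{inv}}_{1,0}(H)\to\mathrm{End}_{\mathbb{C}}(\mathrm{SLF}(H))$ be the representation so obtained. The elements $v_A^{-1}=(v^{-1})_A$ and $v_B^{-1}=(v^{-1})_B$ are invariant. * $\mathrm{MCG}(\text{torus})=\mathrm{SL}_2(\mathbb{Z})$ is generated by the Dehn twists $\tau_a=\begin{pmatrix}1&0\\-1&1\end{pmatrix}$ and $\tau_b=\begin{pmatrix}1&1\\0&1\end{pmatrix}$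 about the two canonical curves. A projective representation of a group $G$ on $V$ is a group morphism $G\to\mathrm{PGL}(V)=\mathrm{GL}(V)/\mathbb{C}^\times$. **Theorem.** The operators $\rho_{\mathrm{SLF}}(v_A^{-1})$ and $\rho_{\mathrm{SLF}}(v_B^{-1})$ on $\mathrm{SLF}(H)$ are invertible, and there is one and only one group morphism $\theta:\mathrm{SL}_2(\mathbb{Z})\to\mathrm{PGL}(\mathrm{SLF}(H))$ with $$\theta(\tau_a)=[\rho_{\mathrm{SLF}}(v_A^{-1})],\qquad\theta(\tau_b)=[\rho_{\mathrm{SLF}}(v_B^{-1})].$$ If moreover $S(\psi)=\psi\circ S=\psi$ for all $\psi\in\mathrm{SLF}(H)$, then there is one and only one group morphism $\mathrm{PSL}_2(\mathbb{Z})=\mathrm{SL}_2(\mathbb{Z})/\{\pm1\}\to\mathrm{PGL}(\mathrm{SLF}(H))$ which takes these values on the classes of $\tau_a$ and $\tau_b$. -/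

import Mathlib

namespace TorusModular

open scoped TensorProduct Kronecker
open Coalgebra HopfAlgebra

noncomputable section

section Products

variable {H : Type*} [Ring H] [HopfAlgebra ℂ H] {Q : Type*} [Ring Q] [Algebra ℂ Q]

/-- For linear maps `p, q : H → Q` into an algebra, the linear map
`H ⊗ H → Q`, `x ⊗ y ↦ p(x) q(y)`. -/
def legs (p q : H →ₗ[ℂ] Q) : H ⊗[ℂ] H →ₗ[ℂ] Q :=
  LinearMap.mul' ℂ Q ∘ₗ TensorProduct.map p q

/-- The convolution product `h ↦ p(h') q(h'')` of two linear maps `H → Q`. -/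
def conv (p q : H →ₗ[ℂ] Q) : H →ₗ[ℂ] Q := legs p q ∘ₗ comul

@[simp] lemma legs_tmul (p q : H →ₗ[ℂ] Q) (x y : H) : legs p q (x ⊗ₜ y) = p x * q y := rfl

end Products

section RMatrix

variable (H : Type*) [Ring H] [HopfAlgebra ℂ H]

/-- The embedding `x ↦ x ⊗ 1 ⊗ 1` of `H` in `H ⊗ H ⊗ H`. -/
def in₁ : H →ₗ[ℂ] (H ⊗[ℂ] H) ⊗[ℂ] H where
  toFun x := (x ⊗ₜ 1) ⊗ₜ 1
  map_add' x y := by simp [TensorProduct.add_tmul]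
  map_smul' c x := by simp [TensorProduct.smul_tmul']

/-- The embedding `x ↦ 1 ⊗ x ⊗ 1` of `H` in `H ⊗ H ⊗ H`. -/
def in₂ : H →ₗ[ℂ] (H ⊗[ℂ] H) ⊗[ℂ] H where
  toFun x := (1 ⊗ₜ x) ⊗ₜ 1
  map_add' x y := by simp [TensorProduct.tmul_add, TensorProduct.add_tmul]
  map_smul' c x := by simp [TensorProduct.smul_tmul']

/-- The embedding `x ↦ 1 ⊗ 1 ⊗ x` of `H` in `H ⊗ H ⊗ H`. -/
def in₃ : H →ₗ[ℂ] (H ⊗[ℂ] H) ⊗[ℂ] H where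
  toFun x := (1 ⊗ₜ 1) ⊗ₜ x
  map_add' x y := by simp [TensorProduct.tmul_add]
  map_smul' c x := by simp

variable {H} in
@[simp] lemma in₁_apply (x : H) : in₁ H x = (x ⊗ₜ 1) ⊗ₜ 1 := rfl

variable {H} in
@[simp] lemma in₂_apply (x : H) : in₂ H x = (1 ⊗ₜ x) ⊗ₜ 1 := rfl

variable {H} in
@[simp] lemma in₃_apply (x : H) : in₃ H x = (1 ⊗ₜ 1) ⊗ₜ x := rfl

/-- A universal `R`-matrix on `H`: an invertible `R ∈ H ⊗ H` with `Δᵒᵖ(x) R = R Δ(x)`,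
`(Δ ⊗ id)(R) = R₁₃ R₂₃` and `(id ⊗ Δ)(R) = R₁₃ R₁₂`. A braided Hopf algebra is a
Hopf algebra together with such an element. -/
structure UniversalRMatrix where
  /-- the element `R` -/
  R : (H ⊗[ℂ] H)ˣ
  comul_op : ∀ x : H, TensorProduct.comm ℂ H H (comul x) * (R : H ⊗[ℂ] H) = (R : H ⊗[ℂ] H) * comul x
  comul_left : TensorProduct.map comul LinearMap.id (R : H ⊗[ℂ] H) =
    legs (in₁ H) (in₃ H) R * legs (in₂ H) (in₃ H) R
  comul_right : (TensorProduct.assoc ℂ H H H).symm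
      (TensorProduct.map LinearMap.id comul (R : H ⊗[ℂ] H)) =
    legs (in₁ H) (in₃ H) R * legs (in₁ H) (in₂ H) R

variable {H}

namespace UniversalRMatrix

/-- The flipped `R`-matrix `R' = b_i ⊗ a_i`. -/
def R' (R : UniversalRMatrix H) : (H ⊗[ℂ] H)ˣ :=
  Units.map (Algebra.TensorProduct.comm ℂ H H).toAlgHom.toMonoidHom R.R

/-- The Drinfeld element `u = S(b_i) a_i`. -/
def drinfeldElement (R : UniversalRMatrix H) : H :=
  legs (antipode ℂ) LinearMap.id (R.R' : H ⊗[ℂ] H)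

end UniversalRMatrix

/-- `φ ⊗ id : H ⊗ A → A` for a linear form `φ` on `H`. -/
def contract {A : Type*} [AddCommGroup A] [Module ℂ A] (φ : Module.Dual ℂ H) :
    H ⊗[ℂ] A →ₗ[ℂ] A :=
  (TensorProduct.lid ℂ A).toLinearMap ∘ₗ LinearMap.rTensor A φ

@[simp] lemma contract_tmul {A : Type*} [AddCommGroup A] [Module ℂ A] (φ : Module.Dual ℂ H)
    (x : H) (a : A) : contract φ (x ⊗ₜ[ℂ] a) = φ x • a := by
  simp [contract]

/-- For `X ∈ H ⊗ A`, the linear map `H* → A`, `φ ↦ (φ ⊗ id)(X)`. -/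
def contractWith {A : Type*} [AddCommGroup A] [Module ℂ A] (X : H ⊗[ℂ] A) :
    Module.Dual ℂ H →ₗ[ℂ] A :=
  (TensorProduct.lid ℂ A).toLinearMap ∘ₗ LinearMap.applyₗ X ∘ₗ LinearMap.rTensorHom A

@[simp] lemma contractWith_apply {A : Type*} [AddCommGroup A] [Module ℂ A] (X : H ⊗[ℂ] A)
    (φ : Module.Dual ℂ H) : contractWith X φ = contract φ X := rfl

namespace UniversalRMatrix

/-- The Reshetikhin--Semenov-Tian-Shansky (Drinfeld) map
`Ψ : H* → H`, `β ↦ (β ⊗ id)(R R')`. -/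
def drinfeldMap (R : UniversalRMatrix H) : Module.Dual ℂ H →ₗ[ℂ] H :=
  contractWith ((R.R : H ⊗[ℂ] H) * R.R')

/-- `H` is factorizable if `Ψ` is an isomorphism of vector spaces. -/
def IsFactorizable (R : UniversalRMatrix H) : Prop := Function.Bijective R.drinfeldMap

end UniversalRMatrix

/-- A ribbon element of the braided Hopf algebra `(H, R)`. -/
structure RibbonElement (R : UniversalRMatrix H) where
  /-- the (invertible) element `v` -/
  v : Hˣ
  central : ∀ x : H, (v : H) * x = x * v
  comul_eq : comul (R := ℂ) (v : H) =
    (↑(R.R' * R.R)⁻¹ : H ⊗[ℂ] H) * ((v : H) ⊗ₜ[ℂ] (v : H))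
  antipode_eq : antipode ℂ (v : H) = v
  counit_eq : counit (R := ℂ) (v : H) = 1
  sq_eq : (v : H) ^ 2 = R.drinfeldElement * antipode ℂ R.drinfeldElement

end RMatrix

/-! ### Matrices of representations -/

section Matrices

variable {H : Type*} [Ring H] [HopfAlgebra ℂ H] {A : Type*} [Ring A] [Algebra ℂ A]
  {ι κ : Type} [Fintype ι] [DecidableEq ι] [Fintype κ] [DecidableEq κ]

/-- The matrix coefficient `T^a_b ∈ H*` of a (matrix) representation of `H`. -/
def coeff (I : H →ₐ[ℂ] Matrix ι ι ℂ) (a b : ι) : Module.Dual ℂ H :=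
  Matrix.entryLinearMap ℂ ℂ a b ∘ₗ I.toLinearMap

@[simp] lemma coeff_apply (I : H →ₐ[ℂ] Matrix ι ι ℂ) (a b : ι) (x : H) :
    coeff I a b x = I x a b := rfl

/-- The matrix with coefficients in `A` obtained by applying a linear map `f : H* → A`
to the matrix `T` of matrix coefficients of a representation. -/
def coeffMatrix (f : Module.Dual ℂ H →ₗ[ℂ] A) (I : H →ₐ[ℂ] Matrix ι ι ℂ) : Matrix ι ι A :=
  Matrix.of fun a b => f (coeff I a b)

/-- `X ↦ X^{IJ}`, the representation of `X ∈ H ⊗ H` on `I ⊗ J`, as a matrix indexed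
by pairs. -/
def evalRep (I : H →ₐ[ℂ] Matrix ι ι ℂ) (J : H →ₐ[ℂ] Matrix κ κ ℂ) :
    H ⊗[ℂ] H →ₐ[ℂ] Matrix (ι × κ) (ι × κ) ℂ :=
  (Matrix.kroneckerAlgEquiv ι κ ℂ).toAlgHom.comp (Algebra.TensorProduct.map I J)

/-- The tensor product `I ⊗ J` of two representations of `H`. -/
def tensorRep (I : H →ₐ[ℂ] Matrix ι ι ℂ) (J : H →ₐ[ℂ] Matrix κ κ ℂ) :
    H →ₐ[ℂ] Matrix (ι × κ) (ι × κ) ℂ :=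
  (evalRep I J).comp (Bialgebra.comulAlgHom ℂ H)

/-- A complex matrix viewed as a matrix with coefficients in the algebra `A`. -/
def scal (A : Type*) [Ring A] [Algebra ℂ A] (n : Type*) [Fintype n] [DecidableEq n] :
    Matrix n n ℂ →ₐ[ℂ] Matrix n n A :=
  (Algebra.ofId ℂ A).mapMatrix

/-- `M₁ = M ⊗ 𝕀`. -/
def leg₁ (κ : Type) [Fintype κ] [DecidableEq κ] (M : Matrix ι ι A) :
    Matrix (ι × κ) (ι × κ) A := M ⊗ₖ (1 : Matrix κ κ A)

/-- `N₂ = 𝕀 ⊗ N`. -/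
def leg₂ (ι : Type) [Fintype ι] [DecidableEq ι] (N : Matrix κ κ A) :
    Matrix (ι × κ) (ι × κ) A := (1 : Matrix ι ι A) ⊗ₖ N

/-- The matrix `M₁ R'₁₂ M₂ R'₁₂⁻¹`, where `M` is the image of `T` by a linear map
`f : H* → A`. -/
def fusionRHS (R : UniversalRMatrix H) (f : Module.Dual ℂ H →ₗ[ℂ] A)
    (I : H →ₐ[ℂ] Matrix ι ι ℂ) (J : H →ₐ[ℂ] Matrix κ κ ℂ) : Matrix (ι × κ) (ι × κ) A :=
  leg₁ κ (coeffMatrix f I) * scal A _ (evalRep I J R.R') *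
    leg₂ ι (coeffMatrix f J) * scal A _ (evalRep I J ↑R.R'⁻¹)

/-- The matrix `R₁₂ B₁ R'₁₂ A₂`. -/
def exchangeLHS (R : UniversalRMatrix H) (fB fA : Module.Dual ℂ H →ₗ[ℂ] A)
    (I : H →ₐ[ℂ] Matrix ι ι ℂ) (J : H →ₐ[ℂ] Matrix κ κ ℂ) : Matrix (ι × κ) (ι × κ) A :=
  scal A _ (evalRep I J R.R) * leg₁ κ (coeffMatrix fB I) *
    scal A _ (evalRep I J R.R') * leg₂ ι (coeffMatrix fA J)

/-- The matrix `A₂ R₁₂ B₁ R₁₂⁻¹`. -/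
def exchangeRHS (R : UniversalRMatrix H) (fB fA : Module.Dual ℂ H →ₗ[ℂ] A)
    (I : H →ₐ[ℂ] Matrix ι ι ℂ) (J : H →ₐ[ℂ] Matrix κ κ ℂ) : Matrix (ι × κ) (ι × κ) A :=
  leg₂ ι (coeffMatrix fA J) * scal A _ (evalRep I J R.R) *
    leg₁ κ (coeffMatrix fB I) * scal A _ (evalRep I J ↑R.R⁻¹)

end Matrices

/-! ### The loop algebra and the handle algebra -/

section Algebras

variable {H : Type*} [Ring H] [HopfAlgebra ℂ H] (R : UniversalRMatrix H)

/-- The defining relations of the loop algebra `𝓛₀₁(H)`: the fusion relation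
`M^{I⊗J}₁₂ = M^I₁ R'₁₂ M^J₂ R'₁₂⁻¹` for all finite-dimensional `I, J`, and `M = 1` for the
trivial representation. -/
inductive LoopRel : TensorAlgebra ℂ (Module.Dual ℂ H) → TensorAlgebra ℂ (Module.Dual ℂ H) → Prop
  | unit : LoopRel (TensorAlgebra.ι ℂ (counit : H →ₗ[ℂ] ℂ)) 1
  | fusion {ι κ : Type} [Fintype ι] [DecidableEq ι] [Fintype κ] [DecidableEq κ]
      (I : H →ₐ[ℂ] Matrix ι ι ℂ) (J : H →ₐ[ℂ] Matrix κ κ ℂ) (s t : ι × κ) :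
      LoopRel (coeffMatrix (TensorAlgebra.ι ℂ) (tensorRep I J) s t)
        (fusionRHS R (TensorAlgebra.ι ℂ) I J s t)

/-- The loop algebra `𝓛₀₁(H)`. -/
abbrev LoopAlgebra : Type _ := RingQuot (LoopRel R)

/-- The canonical linear map `H* → 𝓛₀₁(H)`, which sends `T` to `M`. -/
def loopM : Module.Dual ℂ H →ₗ[ℂ] LoopAlgebra R :=
  (RingQuot.mkAlgHom ℂ (LoopRel R)).toLinearMap ∘ₗ TensorAlgebra.ι ℂ

/-- Generators of the first (`B`) copy of `H*` in `T(H* ⊕ H*)`. -/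
def preB : Module.Dual ℂ H →ₗ[ℂ] TensorAlgebra ℂ (Module.Dual ℂ H × Module.Dual ℂ H) :=
  TensorAlgebra.ι ℂ ∘ₗ LinearMap.inl ℂ _ _

/-- Generators of the second (`A`) copy of `H*` in `T(H* ⊕ H*)`. -/
def preA : Module.Dual ℂ H →ₗ[ℂ] TensorAlgebra ℂ (Module.Dual ℂ H × Module.Dual ℂ H) :=
  TensorAlgebra.ι ℂ ∘ₗ LinearMap.inr ℂ _ _

/-- The defining relations of the handle algebra `𝓛₁₀(H)`: those of two copies of `𝓛₀₁(H)`
(with generating matrices `B` and `A`), and the exchange relation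
`R₁₂ B₁ R'₁₂ A₂ = A₂ R₁₂ B₁ R₁₂⁻¹` for all finite-dimensional `I, J`. -/
inductive HandleRel : TensorAlgebra ℂ (Module.Dual ℂ H × Module.Dual ℂ H) →
    TensorAlgebra ℂ (Module.Dual ℂ H × Module.Dual ℂ H) → Prop
  | unitB : HandleRel (preB (counit : H →ₗ[ℂ] ℂ)) 1
  | unitA : HandleRel (preA (counit : H →ₗ[ℂ] ℂ)) 1
  | fusionB {ι κ : Type} [Fintype ι] [DecidableEq ι] [Fintype κ] [DecidableEq κ]
      (I : H →ₐ[ℂ] Matrix ι ι ℂ) (J : H →ₐ[ℂ] Matrix κ κ ℂ) (s t : ι × κ) :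
      HandleRel (coeffMatrix preB (tensorRep I J) s t) (fusionRHS R preB I J s t)
  | fusionA {ι κ : Type} [Fintype ι] [DecidableEq ι] [Fintype κ] [DecidableEq κ]
      (I : H →ₐ[ℂ] Matrix ι ι ℂ) (J : H →ₐ[ℂ] Matrix κ κ ℂ) (s t : ι × κ) :
      HandleRel (coeffMatrix preA (tensorRep I J) s t) (fusionRHS R preA I J s t)
  | exchange {ι κ : Type} [Fintype ι] [DecidableEq ι] [Fintype κ] [DecidableEq κ]
      (I : H →ₐ[ℂ] Matrix ι ι ℂ) (J : H →ₐ[ℂ] Matrix κ κ ℂ) (s t : ι × κ) :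
      HandleRel (exchangeLHS R preB preA I J s t) (exchangeRHS R preB preA I J s t)

/-- The handle algebra `𝓛₁₀(H)`, i.e. the quotient of the free product of two copies of
`𝓛₀₁(H)` by the exchange relation. -/
abbrev HandleAlgebra : Type _ := RingQuot (HandleRel R)

/-- The canonical linear map `H* → 𝓛₁₀(H)`, which sends `T` to `B`. -/
def handleB : Module.Dual ℂ H →ₗ[ℂ] HandleAlgebra R :=
  (RingQuot.mkAlgHom ℂ (HandleRel R)).toLinearMap ∘ₗ preB

/-- The canonical linear map `H* → 𝓛₁₀(H)`, which sends `T` to `A`. -/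
def handleA : Module.Dual ℂ H →ₗ[ℂ] HandleAlgebra R :=
  (RingQuot.mkAlgHom ℂ (HandleRel R)).toLinearMap ∘ₗ preA

section lift

variable {R} {A A' : Type*} [Ring A] [Algebra ℂ A] [Ring A'] [Algebra ℂ A']
  {ι κ : Type} [Fintype ι] [DecidableEq ι] [Fintype κ] [DecidableEq κ]

lemma map_coeffMatrix (g : A →ₐ[ℂ] A') (f : Module.Dual ℂ H →ₗ[ℂ] A)
    (I : H →ₐ[ℂ] Matrix ι ι ℂ) :
    g.mapMatrix (coeffMatrix f I) = coeffMatrix (g.toLinearMap ∘ₗ f) I := rfl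

lemma map_scal (g : A →ₐ[ℂ] A') (M : Matrix ι ι ℂ) :
    g.mapMatrix (scal A ι M) = scal A' ι M := by
  ext i j
  simp [scal, Algebra.ofId_apply]

lemma map_leg₁ (g : A →ₐ[ℂ] A') (M : Matrix ι ι A) :
    g.mapMatrix (leg₁ κ M) = leg₁ κ (g.mapMatrix M) := by
  ext ⟨a, c⟩ ⟨b, d⟩
  simp [leg₁, Matrix.one_apply, apply_ite g]

lemma map_leg₂ (g : A →ₐ[ℂ] A') (M : Matrix κ κ A) :
    g.mapMatrix (leg₂ ι M) = leg₂ ι (g.mapMatrix M) := by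
  ext ⟨a, c⟩ ⟨b, d⟩
  simp [leg₂, Matrix.one_apply, apply_ite g]

lemma map_fusionRHS (g : A →ₐ[ℂ] A') (f : Module.Dual ℂ H →ₗ[ℂ] A)
    (I : H →ₐ[ℂ] Matrix ι ι ℂ) (J : H →ₐ[ℂ] Matrix κ κ ℂ) :
    g.mapMatrix (fusionRHS R f I J) = fusionRHS R (g.toLinearMap ∘ₗ f) I J := by
  simp only [fusionRHS, map_mul, map_scal, map_leg₁, map_leg₂, map_coeffMatrix]

lemma map_exchangeLHS (g : A →ₐ[ℂ] A') (f f' : Module.Dual ℂ H →ₗ[ℂ] A)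
    (I : H →ₐ[ℂ] Matrix ι ι ℂ) (J : H →ₐ[ℂ] Matrix κ κ ℂ) :
    g.mapMatrix (exchangeLHS R f f' I J) =
      exchangeLHS R (g.toLinearMap ∘ₗ f) (g.toLinearMap ∘ₗ f') I J := by
  simp only [exchangeLHS, map_mul, map_scal, map_leg₁, map_leg₂, map_coeffMatrix]

lemma map_exchangeRHS (g : A →ₐ[ℂ] A') (f f' : Module.Dual ℂ H →ₗ[ℂ] A)
    (I : H →ₐ[ℂ] Matrix ι ι ℂ) (J : H →ₐ[ℂ] Matrix κ κ ℂ) :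
    g.mapMatrix (exchangeRHS R f f' I J) =
      exchangeRHS R (g.toLinearMap ∘ₗ f) (g.toLinearMap ∘ₗ f') I J := by
  simp only [exchangeRHS, map_mul, map_scal, map_leg₁, map_leg₂, map_coeffMatrix]

/-- A linear map `f : H* → A` into an algebra satisfies the relations of the loop algebra. -/
structure IsLoop (R : UniversalRMatrix H) (f : Module.Dual ℂ H →ₗ[ℂ] A) : Prop where
  unit : f (counit : H →ₗ[ℂ] ℂ) = 1
  fusion : ∀ {ι κ : Type} [Fintype ι] [DecidableEq ι] [Fintype κ] [DecidableEq κ]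
    (I : H →ₐ[ℂ] Matrix ι ι ℂ) (J : H →ₐ[ℂ] Matrix κ κ ℂ),
    coeffMatrix f (tensorRep I J) = fusionRHS R f I J

/-- Linear maps `fB, fA : H* → A` into an algebra satisfy the relations of the handle algebra. -/
structure IsHandle (R : UniversalRMatrix H) (fB fA : Module.Dual ℂ H →ₗ[ℂ] A) : Prop where
  isLoopB : IsLoop R fB
  isLoopA : IsLoop R fA
  exchange : ∀ {ι κ : Type} [Fintype ι] [DecidableEq ι] [Fintype κ] [DecidableEq κ]
    (I : H →ₐ[ℂ] Matrix ι ι ℂ) (J : H →ₐ[ℂ] Matrix κ κ ℂ),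
    exchangeLHS R fB fA I J = exchangeRHS R fB fA I J

lemma isHandle (R : UniversalRMatrix H) : IsHandle R (handleB R) (handleA R) := by
  have key : ∀ {x y}, HandleRel R x y → RingQuot.mkAlgHom ℂ (HandleRel R) x =
    RingQuot.mkAlgHom ℂ (HandleRel R) y := fun h => RingQuot.mkAlgHom_rel ℂ h
  refine ⟨⟨?_, ?_⟩, ⟨?_, ?_⟩, ?_⟩
  · simpa [handleB] using key .unitB
  · intro ι κ _ _ _ _ I J
    rw [handleB, ← map_coeffMatrix, ← map_fusionRHS]
    ext s t
    exact key (.fusionB I J s t)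
  · simpa [handleA] using key .unitA
  · intro ι κ _ _ _ _ I J
    rw [handleA, ← map_coeffMatrix, ← map_fusionRHS]
    ext s t
    exact key (.fusionA I J s t)
  · intro ι κ _ _ _ _ I J
    rw [handleA, handleB, ← map_exchangeLHS, ← map_exchangeRHS]
    ext s t
    exact key (.exchange I J s t)

/-- The universal property of the loop algebra. -/
def loopLift (f : Module.Dual ℂ H →ₗ[ℂ] A) (hf : IsLoop R f) : LoopAlgebra R →ₐ[ℂ] A :=
  RingQuot.liftAlgHom ℂ ⟨TensorAlgebra.lift ℂ f, by
    have hc : (TensorAlgebra.lift ℂ f).toLinearMap ∘ₗ TensorAlgebra.ι ℂ = f := by ext; simp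
    intro x y h
    cases h with
    | unit => simpa using hf.unit
    | fusion I J s t =>
      have := congr_fun (congr_fun (hf.fusion I J) s) t
      rw [← hc, ← map_coeffMatrix, ← map_fusionRHS] at this
      exact this⟩

@[simp] lemma loopLift_loopM (f : Module.Dual ℂ H →ₗ[ℂ] A) (hf : IsLoop R f)
    (φ : Module.Dual ℂ H) : loopLift f hf (loopM R φ) = f φ := by
  simp [loopLift, loopM]

lemma IsHandle.rel {fB fA : Module.Dual ℂ H →ₗ[ℂ] A} (hf : IsHandle R fB fA)
    (g : TensorAlgebra ℂ (Module.Dual ℂ H × Module.Dual ℂ H) →ₐ[ℂ] A)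
    (hB : g.toLinearMap ∘ₗ preB = fB) (hA : g.toLinearMap ∘ₗ preA = fA)
    {x y : TensorAlgebra ℂ (Module.Dual ℂ H × Module.Dual ℂ H)} (h : HandleRel R x y) :
    g x = g y := by
  subst hB hA
  cases h with
  | unitB => simpa using hf.isLoopB.unit
  | unitA => simpa using hf.isLoopA.unit
  | fusionB I J s t =>
    have := congr_fun (congr_fun (hf.isLoopB.fusion I J) s) t
    rwa [← map_coeffMatrix, ← map_fusionRHS] at this
  | fusionA I J s t =>
    have := congr_fun (congr_fun (hf.isLoopA.fusion I J) s) t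
    rwa [← map_coeffMatrix, ← map_fusionRHS] at this
  | exchange I J s t =>
    have := congr_fun (congr_fun (hf.exchange I J) s) t
    rwa [← map_exchangeLHS, ← map_exchangeRHS] at this

/-- The universal property of the handle algebra. -/
def handleLift (fB fA : Module.Dual ℂ H →ₗ[ℂ] A) (hf : IsHandle R fB fA) :
    HandleAlgebra R →ₐ[ℂ] A :=
  RingQuot.liftAlgHom ℂ ⟨TensorAlgebra.lift ℂ (LinearMap.coprod fB fA), fun _ _ h =>
    hf.rel _ (by ext; simp [preB]) (by ext; simp [preA]) h⟩

@[simp] lemma handleLift_handleB (fB fA : Module.Dual ℂ H →ₗ[ℂ] A) (hf : IsHandle R fB fA)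
    (φ : Module.Dual ℂ H) : handleLift fB fA hf (handleB R φ) = fB φ := by
  simp [handleLift, handleB, preB]

@[simp] lemma handleLift_handleA (fB fA : Module.Dual ℂ H →ₗ[ℂ] A) (hf : IsHandle R fB fA)
    (φ : Module.Dual ℂ H) : handleLift fB fA hf (handleA R φ) = fA φ := by
  simp [handleLift, handleA, preA]

end lift

/-- The morphism `j_B : 𝓛₀₁(H) → 𝓛₁₀(H)`, `M ↦ B`. -/
def jB : LoopAlgebra R →ₐ[ℂ] HandleAlgebra R := loopLift (handleB R) (isHandle R).isLoopB

/-- The morphism `j_A : 𝓛₀₁(H) → 𝓛₁₀(H)`, `M ↦ A`. -/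
def jA : LoopAlgebra R →ₐ[ℂ] HandleAlgebra R := loopLift (handleA R) (isHandle R).isLoopA

end Algebras


/-! ### The representation of the handle algebra on `H*` -/

section Abstract

variable {H : Type*} [Ring H] [HopfAlgebra ℂ H] {Q : Type*} [Ring Q] [Algebra ℂ Q]

lemma legs_eq_lift (p q : H →ₐ[ℂ] Q) (hpq : ∀ x y, Commute (p x) (q y)) (X : H ⊗[ℂ] H) :
    legs p.toLinearMap q.toLinearMap X = Algebra.TensorProduct.lift p q hpq X := by
  induction X with
  | zero => simp
  | tmul x y => simp
  | add x y hx hy => rw [map_add, map_add, hx, hy]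

lemma legs_mul (p q : H →ₐ[ℂ] Q) (hpq : ∀ x y, Commute (p x) (q y)) (X Y : H ⊗[ℂ] H) :
    legs p.toLinearMap q.toLinearMap (X * Y) =
      legs p.toLinearMap q.toLinearMap X * legs p.toLinearMap q.toLinearMap Y := by
  simp only [legs_eq_lift p q hpq, map_mul]

lemma legs_one (p q : H →ₐ[ℂ] Q) : legs p.toLinearMap q.toLinearMap 1 = 1 := by
  simp [Algebra.TensorProduct.one_def]

lemma legs_comm (p q : H →ₗ[ℂ] Q) (hpq : ∀ x y, Commute (p x) (q y)) (X : H ⊗[ℂ] H) :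
    legs p q (TensorProduct.comm ℂ H H X) = legs q p X := by
  induction X with
  | zero => simp
  | tmul x y => exact hpq y x
  | add x y hx hy => rw [map_add, map_add, map_add, hx, hy]

lemma commute_legs (p q : H →ₗ[ℂ] Q) (z : Q) (hp : ∀ x, Commute z (p x))
    (hq : ∀ x, Commute z (q x)) (X : H ⊗[ℂ] H) : Commute z (legs p q X) := by
  induction X with
  | zero => simp
  | tmul x y => exact (hp x).mul_right (hq y)
  | add x y hx hy => rw [map_add]; exact hx.add_right hy

/-- The convolution of two algebra morphisms with commuting images. -/
def convHom (p q : H →ₐ[ℂ] Q) (hpq : ∀ x y, Commute (p x) (q y)) : H →ₐ[ℂ] Q :=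
  (Algebra.TensorProduct.lift p q hpq).comp (Bialgebra.comulAlgHom ℂ H)

lemma convHom_toLinearMap (p q : H →ₐ[ℂ] Q) (hpq : ∀ x y, Commute (p x) (q y)) :
    (convHom p q hpq).toLinearMap = conv p.toLinearMap q.toLinearMap := by
  ext x
  simp [convHom, conv, legs_eq_lift p q hpq]

variable (R : UniversalRMatrix H) (p q r : H →ₐ[ℂ] Q)

lemma legs_comul_op (h : H) (hpq : ∀ x y, Commute (p x) (q y)) :
    conv q.toLinearMap p.toLinearMap h * legs p.toLinearMap q.toLinearMap R.R =
      legs p.toLinearMap q.toLinearMap R.R * conv p.toLinearMap q.toLinearMap h := by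
  have := congrArg (legs p.toLinearMap q.toLinearMap) (R.comul_op h)
  rw [legs_mul p q hpq, legs_mul p q hpq, legs_comm _ _ hpq] at this
  exact this

lemma legs_R' (hpq : ∀ x y, Commute (p x) (q y)) :
    legs p.toLinearMap q.toLinearMap R.R' = legs q.toLinearMap p.toLinearMap R.R :=
  legs_comm _ _ hpq _

lemma legs_conv_left (hpq : ∀ x y, Commute (p x) (q y)) (hpr : ∀ x y, Commute (p x) (r y))
    (hqr : ∀ x y, Commute (q x) (r y)) :
    legs (conv p.toLinearMap q.toLinearMap) r.toLinearMap R.R =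
      legs p.toLinearMap r.toLinearMap R.R * legs q.toLinearMap r.toLinearMap R.R := by
  have hc : ∀ (x : H ⊗[ℂ] H) (y : H), Commute (Algebra.TensorProduct.lift p q hpq x) (r y) := by
    intro x y
    rw [← legs_eq_lift]
    exact (commute_legs _ _ _ (fun x => (hpr x y).symm) (fun x => (hqr x y).symm) _).symm
  set F := Algebra.TensorProduct.lift (Algebra.TensorProduct.lift p q hpq) r hc with hF
  have h1 : ∀ X : H ⊗[ℂ] H, F (TensorProduct.map comul LinearMap.id X) =
      legs (conv p.toLinearMap q.toLinearMap) r.toLinearMap X := by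
    intro X
    induction X with
    | zero => simp
    | tmul x y => simp [hF, conv, legs_eq_lift p q hpq]
    | add x y hx hy => rw [map_add, map_add, map_add, hx, hy]
  have h2 : ∀ X : H ⊗[ℂ] H, F (legs (in₁ H) (in₃ H) X) =
      legs p.toLinearMap r.toLinearMap X := by
    intro X
    induction X with
    | zero => simp
    | tmul x y => simp [hF]
    | add x y hx hy => rw [map_add, map_add, map_add, hx, hy]
  have h3 : ∀ X : H ⊗[ℂ] H, F (legs (in₂ H) (in₃ H) X) =
      legs q.toLinearMap r.toLinearMap X := by
    intro X
    induction X with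
    | zero => simp
    | tmul x y => simp [hF]
    | add x y hx hy => rw [map_add, map_add, map_add, hx, hy]
  rw [← h1, R.comul_left, map_mul, h2, h3]

lemma legs_conv_right (hpq : ∀ x y, Commute (p x) (q y)) (hpr : ∀ x y, Commute (p x) (r y))
    (hqr : ∀ x y, Commute (q x) (r y)) :
    legs p.toLinearMap (conv q.toLinearMap r.toLinearMap) R.R =
      legs p.toLinearMap r.toLinearMap R.R * legs p.toLinearMap q.toLinearMap R.R := by
  have hc : ∀ (x : H ⊗[ℂ] H) (y : H), Commute (Algebra.TensorProduct.lift p q hpq x) (r y) := by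
    intro x y
    rw [← legs_eq_lift]
    exact (commute_legs _ _ _ (fun x => (hpr x y).symm) (fun x => (hqr x y).symm) _).symm
  set F := Algebra.TensorProduct.lift (Algebra.TensorProduct.lift p q hpq) r hc with hF
  have h0 : ∀ (x : H) (Y : H ⊗[ℂ] H), F ((TensorProduct.assoc ℂ H H H).symm (x ⊗ₜ Y)) =
      p x * legs q.toLinearMap r.toLinearMap Y := by
    intro x Y
    induction Y with
    | zero => simp
    | tmul y z => simp [hF, mul_assoc]
    | add y z hy hz => rw [TensorProduct.tmul_add, map_add, map_add, map_add, hy, hz, mul_add]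
  have h1 : ∀ X : H ⊗[ℂ] H, F ((TensorProduct.assoc ℂ H H H).symm
      (TensorProduct.map LinearMap.id comul X)) =
      legs p.toLinearMap (conv q.toLinearMap r.toLinearMap) X := by
    intro X
    induction X with
    | zero => simp
    | tmul x y => rw [TensorProduct.map_tmul, h0]; rfl
    | add x y hx hy => rw [map_add, map_add, map_add, map_add, hx, hy]
  have h2 : ∀ X : H ⊗[ℂ] H, F (legs (in₁ H) (in₃ H) X) =
      legs p.toLinearMap r.toLinearMap X := by
    intro X
    induction X with
    | zero => simp
    | tmul x y => simp [hF]
    | add x y hx hy => rw [map_add, map_add, map_add, hx, hy]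
  have h3 : ∀ X : H ⊗[ℂ] H, F (legs (in₁ H) (in₂ H) X) =
      legs p.toLinearMap q.toLinearMap X := by
    intro X
    induction X with
    | zero => simp
    | tmul x y => simp [hF]
    | add x y hx hy => rw [map_add, map_add, map_add, hx, hy]
  rw [← h1, R.comul_right, map_mul, h2, h3]

/-- The Yang--Baxter equation. -/
lemma yangBaxter (hpq : ∀ x y, Commute (p x) (q y)) (hpr : ∀ x y, Commute (p x) (r y))
    (hqr : ∀ x y, Commute (q x) (r y)) :
    legs p.toLinearMap q.toLinearMap R.R * legs p.toLinearMap r.toLinearMap R.R *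
        legs q.toLinearMap r.toLinearMap R.R =
      legs q.toLinearMap r.toLinearMap R.R * legs p.toLinearMap r.toLinearMap R.R *
        legs p.toLinearMap q.toLinearMap R.R := by
  rw [mul_assoc, ← legs_conv_left R p q r hpq hpr hqr,
    ← legs_conv_left R q p r (fun x y => (hpq y x).symm) hqr hpr]
  set P := legs p.toLinearMap q.toLinearMap (R.R : H ⊗[ℂ] H) with hP
  have h : ∀ X : H ⊗[ℂ] H, P * legs (conv p.toLinearMap q.toLinearMap) r.toLinearMap X =
      legs (conv q.toLinearMap p.toLinearMap) r.toLinearMap X * P := by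
    intro X
    induction X with
    | zero => simp
    | tmul x y =>
      have hr : Commute (r y) P :=
        commute_legs _ _ _ (fun x => (hpr x y).symm) (fun x => (hqr x y).symm) _
      simp only [legs_tmul, AlgHom.toLinearMap_apply]
      rw [← mul_assoc, ← legs_comul_op R p q x hpq, mul_assoc, ← hP, hr.eq.symm, mul_assoc]
    | add x y hx hy => rw [map_add, map_add, mul_add, add_mul, hx, hy]
  exact h _

end Abstract

section Abstract2

variable {Q : Type*} [Ring Q]

lemma fusionA_aux {R12i R13 R31 R23 R32 R21 : Q} (hinv : R21 * R12i = 1)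
    (yb1 : R31 * R21 * R23 = R23 * R21 * R31) (yb2 : R32 * R31 * R21 = R21 * R31 * R32) :
    R13 * R23 * (R32 * R31) = R13 * R31 * R21 * (R23 * R32) * R12i := by
  calc R13 * R23 * (R32 * R31) = R13 * R23 * (R32 * R31 * R21) * R12i := by
        rw [mul_assoc (R13 * R23) _ R12i, mul_assoc (R32 * R31), hinv, mul_one]
    _ = R13 * (R23 * R21 * R31) * R32 * R12i := by rw [yb2]; noncomm_ring
    _ = R13 * R31 * R21 * (R23 * R32) * R12i := by rw [← yb1]; noncomm_ring

lemma fusionB_aux {R12i R13 R31 R23 R32 R21 T1 T2 : Q} (hinv : R21 * R12i = 1)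
    (yb1 : R31 * R21 * R23 = R23 * R21 * R31) (yb2 : R32 * R31 * R21 = R21 * R31 * R32)
    (e1 : R23 * T1 = T1 * R23 * R21) (e2 : R31 * T2 = T2 * R21 * R31) :
    R13 * R23 * (T1 * T2) * (R32 * R31) =
      R13 * T1 * R31 * R21 * (R23 * T2 * R32) * R12i := by
  calc R13 * R23 * (T1 * T2) * (R32 * R31)
      = R13 * (R23 * T1) * T2 * (R32 * R31 * R21) * R12i := by
        rw [mul_assoc _ _ R12i, mul_assoc (R32 * R31), hinv, mul_one]; noncomm_ring
    _ = R13 * T1 * R23 * R21 * (T2 * R21 * R31) * R32 * R12i := by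
        rw [e1, yb2]; noncomm_ring
    _ = R13 * T1 * (R23 * R21 * R31) * T2 * R32 * R12i := by rw [← e2]; noncomm_ring
    _ = R13 * T1 * R31 * R21 * (R23 * T2 * R32) * R12i := by rw [← yb1]; noncomm_ring

lemma exchange_aux {R12 R12i R13 R31 R23 R32 R21 T1 : Q} (hinv : R12 * R12i = 1)
    (yb1 : R31 * R21 * R23 = R23 * R21 * R31) (yb3 : R12 * R13 * R23 = R23 * R13 * R12)
    (yb4 : R13 * R12 * R32 = R32 * R12 * R13) (yb5 : R31 * R32 * R12 = R12 * R32 * R31)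
    (c : R23 * T1 = T1 * R23 * R21) (e : R32 * T1 = T1 * R12 * R32) :
    R12 * (R13 * T1 * R31) * R21 * (R23 * R32) =
      R23 * R32 * R12 * (R13 * T1 * R31) * R12i := by
  calc R12 * (R13 * T1 * R31) * R21 * (R23 * R32)
      = R12 * R13 * T1 * (R31 * R21 * R23) * R32 := by noncomm_ring
    _ = R12 * R13 * (T1 * R23 * R21) * R31 * R32 := by rw [yb1]; noncomm_ring
    _ = (R12 * R13 * R23) * T1 * R31 * R32 := by rw [← c]; noncomm_ring
    _ = R23 * R13 * R12 * T1 * (R31 * R32 * R12) * R12i := by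
        rw [yb3, mul_assoc _ _ R12i, mul_assoc (R31 * R32), hinv, mul_one]; noncomm_ring
    _ = R23 * R13 * R12 * (T1 * R12 * R32) * R31 * R12i := by rw [yb5]; noncomm_ring
    _ = R23 * (R13 * R12 * R32) * T1 * R31 * R12i := by rw [← e]; noncomm_ring
    _ = R23 * R32 * R12 * (R13 * T1 * R31) * R12i := by rw [yb4]; noncomm_ring

end Abstract2

section MatrixLemmas

variable {H : Type*} [Ring H] [HopfAlgebra ℂ H] {A : Type*} [Ring A] [Algebra ℂ A]
  {n ι κ : Type} [Fintype n] [DecidableEq n] [Fintype ι] [DecidableEq ι] [Fintype κ]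
  [DecidableEq κ]

lemma commute_scal_scalar (M : Matrix n n ℂ) (a : A) :
    Commute (scal A n M) (Matrix.scalarAlgHom n ℂ a) := by
  ext i j
  simp [scal, Matrix.mul_diagonal, Matrix.diagonal_mul, Algebra.ofId_apply, Algebra.commutes]

/-- For a matrix representation `ρ` of `H`, the morphism `H ⊗ A → Mat(A)`,
`x ⊗ a ↦ ρ(x) a`. -/
def evMat (A : Type*) [Ring A] [Algebra ℂ A] (ρ : H →ₐ[ℂ] Matrix n n ℂ) :
    H ⊗[ℂ] A →ₐ[ℂ] Matrix n n A :=
  Algebra.TensorProduct.lift ((scal A n).comp ρ) (Matrix.scalarAlgHom n ℂ)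
    fun x a => commute_scal_scalar (ρ x) a

lemma evMat_eq (ρ : H →ₐ[ℂ] Matrix n n ℂ) (X : H ⊗[ℂ] A) :
    evMat A ρ X = coeffMatrix (contractWith X) ρ := by
  ext i j
  simp only [coeffMatrix, Matrix.of_apply, contractWith_apply]
  induction X with
  | zero => simp
  | tmul x a => simp [evMat, scal, Matrix.mul_diagonal, Algebra.ofId_apply, Algebra.smul_def]
  | add x y hx hy => rw [map_add, map_add, ← hx, ← hy]; rfl

/-- The representation `x ↦ I(x) ⊗ 𝕀`. -/
def repL (I : H →ₐ[ℂ] Matrix ι ι ℂ) (J : H →ₐ[ℂ] Matrix κ κ ℂ) :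
    H →ₐ[ℂ] Matrix (ι × κ) (ι × κ) ℂ :=
  (evalRep I J).comp Algebra.TensorProduct.includeLeft

/-- The representation `x ↦ 𝕀 ⊗ J(x)`. -/
def repR (I : H →ₐ[ℂ] Matrix ι ι ℂ) (J : H →ₐ[ℂ] Matrix κ κ ℂ) :
    H →ₐ[ℂ] Matrix (ι × κ) (ι × κ) ℂ :=
  (evalRep I J).comp Algebra.TensorProduct.includeRight

lemma evalRep_tmul (I : H →ₐ[ℂ] Matrix ι ι ℂ) (J : H →ₐ[ℂ] Matrix κ κ ℂ) (x y : H) :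
    evalRep I J (x ⊗ₜ y) = I x ⊗ₖ J y := rfl

lemma coeff_repL (I : H →ₐ[ℂ] Matrix ι ι ℂ) (J : H →ₐ[ℂ] Matrix κ κ ℂ) (s t : ι × κ) :
    coeff (repL I J) s t = (1 : Matrix κ κ ℂ) s.2 t.2 • coeff I s.1 t.1 := by
  ext x
  simp [repL, evalRep_tmul, mul_comm]

lemma coeff_repR (I : H →ₐ[ℂ] Matrix ι ι ℂ) (J : H →ₐ[ℂ] Matrix κ κ ℂ) (s t : ι × κ) :
    coeff (repR I J) s t = (1 : Matrix ι ι ℂ) s.1 t.1 • coeff J s.2 t.2 := by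
  ext x
  simp [repR, evalRep_tmul]

lemma leg₁_coeffMatrix (f : Module.Dual ℂ H →ₗ[ℂ] A)
    (I : H →ₐ[ℂ] Matrix ι ι ℂ) (J : H →ₐ[ℂ] Matrix κ κ ℂ) :
    leg₁ κ (coeffMatrix f I) = coeffMatrix f (repL I J) := by
  ext s t
  simp only [coeffMatrix, Matrix.of_apply, coeff_repL, map_smul]
  simp [leg₁, Matrix.one_apply]

lemma leg₂_coeffMatrix (f : Module.Dual ℂ H →ₗ[ℂ] A)
    (I : H →ₐ[ℂ] Matrix ι ι ℂ) (J : H →ₐ[ℂ] Matrix κ κ ℂ) :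
    leg₂ ι (coeffMatrix f J) = coeffMatrix f (repR I J) := by
  ext s t
  simp only [coeffMatrix, Matrix.of_apply, coeff_repR, map_smul]
  simp [leg₂, Matrix.one_apply]

/-- `x ↦ I(x) ⊗ 𝕀` with values in matrices over `A`. -/
abbrev homL (A : Type*) [Ring A] [Algebra ℂ A] (I : H →ₐ[ℂ] Matrix ι ι ℂ)
    (J : H →ₐ[ℂ] Matrix κ κ ℂ) : H →ₐ[ℂ] Matrix (ι × κ) (ι × κ) A :=
  (scal A _).comp (repL I J)

/-- `x ↦ 𝕀 ⊗ J(x)` with values in matrices over `A`. -/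
abbrev homR (A : Type*) [Ring A] [Algebra ℂ A] (I : H →ₐ[ℂ] Matrix ι ι ℂ)
    (J : H →ₐ[ℂ] Matrix κ κ ℂ) : H →ₐ[ℂ] Matrix (ι × κ) (ι × κ) A :=
  (scal A _).comp (repR I J)

lemma commute_homL_homR (I : H →ₐ[ℂ] Matrix ι ι ℂ) (J : H →ₐ[ℂ] Matrix κ κ ℂ) (x y : H) :
    Commute (homL A I J x) (homR A I J y) := by
  have : Commute (x ⊗ₜ[ℂ] (1 : H)) ((1 : H) ⊗ₜ[ℂ] y) := by
    simp [Commute, SemiconjBy]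
  exact (this.map (evalRep I J)).map (scal A _)

lemma scal_evalRep (I : H →ₐ[ℂ] Matrix ι ι ℂ) (J : H →ₐ[ℂ] Matrix κ κ ℂ) (X : H ⊗[ℂ] H) :
    scal A _ (evalRep I J X) =
      legs (homL A I J).toLinearMap (homR A I J).toLinearMap X := by
  rw [legs_eq_lift _ _ (commute_homL_homR I J)]
  refine DFunLike.congr_fun (f := (scal A _).comp (evalRep I J)) ?_ X
  ext x
  · simp [repL]
  · simp [repR]

lemma scal_tensorRep (I : H →ₐ[ℂ] Matrix ι ι ℂ) (J : H →ₐ[ℂ] Matrix κ κ ℂ) :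
    ((scal A _).comp (tensorRep I J)).toLinearMap =
      conv (homL A I J).toLinearMap (homR A I J).toLinearMap := by
  ext1 x
  exact scal_evalRep I J (comul x)

lemma commute_hom_coeffMatrix_left (f : Module.Dual ℂ H →ₗ[ℂ] A)
    (I : H →ₐ[ℂ] Matrix ι ι ℂ) (J : H →ₐ[ℂ] Matrix κ κ ℂ) (y : H) :
    Commute (homR A I J y) (coeffMatrix f (repL I J)) := by
  rw [← leg₁_coeffMatrix]
  have h : homR A I J y = leg₂ ι (scal A κ (J y)) := by
    ext ⟨a, c⟩ ⟨b, d⟩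
    simp [repR, evalRep_tmul, leg₂, scal, Algebra.ofId_apply, Matrix.one_apply, apply_ite]
    split_ifs <;> simp_all
  rw [h]
  ext ⟨a, c⟩ ⟨b, d⟩
  simp only [leg₁, leg₂, scal, Matrix.mul_apply, Matrix.kroneckerMap_apply, Fintype.sum_prod_type,
    Matrix.one_apply]
  simp [Algebra.ofId_apply, Algebra.commutes]

lemma commute_hom_coeffMatrix_right (f : Module.Dual ℂ H →ₗ[ℂ] A)
    (I : H →ₐ[ℂ] Matrix ι ι ℂ) (J : H →ₐ[ℂ] Matrix κ κ ℂ) (x : H) :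
    Commute (homL A I J x) (coeffMatrix f (repR I J)) := by
  rw [← leg₂_coeffMatrix]
  have h : homL A I J x = leg₁ κ (scal A ι (I x)) := by
    ext ⟨a, c⟩ ⟨b, d⟩
    simp [repL, evalRep_tmul, leg₁, scal, Algebra.ofId_apply, Matrix.one_apply, apply_ite]
    split_ifs <;> simp_all
  rw [h]
  ext ⟨a, c⟩ ⟨b, d⟩
  simp only [leg₁, leg₂, scal, Matrix.mul_apply, Matrix.kroneckerMap_apply, Fintype.sum_prod_type,
    Matrix.one_apply]
  simp [Algebra.ofId_apply, Algebra.commutes]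

lemma scal_inv_mul (I : H →ₐ[ℂ] Matrix ι ι ℂ)
    (J : H →ₐ[ℂ] Matrix κ κ ℂ) (X : (H ⊗[ℂ] H)ˣ) :
    scal A _ (evalRep I J X) * scal A _ (evalRep I J ↑X⁻¹) = 1 := by
  rw [← map_mul, ← map_mul, Units.mul_inv, map_one, map_one]

end MatrixLemmas

section HandleRep

set_option linter.unusedSectionVars false

variable {H : Type*} [Ring H] [HopfAlgebra ℂ H]

/-- The action of `H ⊂ 𝓗(𝓞(H))` on `𝓞(H) = H*`: `h ▷ ψ = ψ(? h)`. -/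
def actH : H →ₐ[ℂ] Module.End ℂ (Module.Dual ℂ H) where
  toFun h := LinearMap.lcomp ℂ ℂ (LinearMap.mulRight ℂ h)
  map_one' := by ext; simp
  map_mul' x y := by ext; simp [mul_assoc]
  map_zero' := by ext; simp
  map_add' x y := by ext; simp [mul_add]
  commutes' c := by ext; simp [Algebra.algebraMap_eq_smul_one]

@[simp] lemma actH_apply (h : H) (ψ : Module.Dual ℂ H) (x : H) : actH h ψ x = ψ (x * h) := rfl

/-- The action of `𝓞(H) ⊂ 𝓗(𝓞(H))` on `𝓞(H) = H*`: `φ ▷ ψ = φ ψ`, where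
`(φ ψ)(x) = φ(x') ψ(x'')`. -/
def actO : Module.Dual ℂ H →ₗ[ℂ] Module.End ℂ (Module.Dual ℂ H) where
  toFun φ :=
    { toFun := fun ψ => conv φ ψ
      map_add' := fun ψ ψ' => by simp [conv, legs, TensorProduct.map_add_right,
        LinearMap.comp_add, LinearMap.add_comp]
      map_smul' := fun c ψ => by simp [conv, legs, TensorProduct.map_smul_right,
        LinearMap.comp_smul, LinearMap.smul_comp] }
  map_add' φ φ' := by
    ext; simp [conv, legs, TensorProduct.map_add_left]
  map_smul' c φ := by
    ext; simp [conv, legs, TensorProduct.map_smul_left]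

@[simp] lemma actO_apply (φ ψ : Module.Dual ℂ H) : actO φ ψ = conv φ ψ := rfl

lemma actO_counit : actO (counit : H →ₗ[ℂ] ℂ) = 1 := by
  refine LinearMap.ext fun ψ => ?_
  have := one_mul (WithConv.toConv (ψ : H →ₗ[ℂ] ℂ))
  exact congrArg WithConv.ofConv this

lemma actO_conv (φ ψ : Module.Dual ℂ H) : actO (conv φ ψ) = actO φ * actO ψ := by
  refine LinearMap.ext fun χ => ?_
  have := mul_assoc (WithConv.toConv (φ : H →ₗ[ℂ] ℂ)) (WithConv.toConv ψ) (WithConv.toConv χ)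
  exact congrArg WithConv.ofConv this

/-- The linear map `y ↦ φ(? y)`. -/
def dualShift (φ : Module.Dual ℂ H) : H →ₗ[ℂ] Module.Dual ℂ H where
  toFun y := φ ∘ₗ LinearMap.mulRight ℂ y
  map_add' y z := by ext; simp [mul_add]
  map_smul' c y := by ext; simp

@[simp] lemma dualShift_apply (φ : Module.Dual ℂ H) (x y : H) : dualShift φ y x = φ (x * y) := rfl

/-- The exchange relation `h φ = φ(? h') h''` of the Heisenberg double. -/
lemma actH_mul_actO (h : H) (φ : Module.Dual ℂ H) :
    actH h * actO φ =
      legs (actO ∘ₗ dualShift φ) actH.toLinearMap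
        (comul h) := by
  refine LinearMap.ext fun ψ => LinearMap.ext fun x => ?_
  have h1 : ∀ (y z : H) (X : H ⊗[ℂ] H), legs φ ψ (X * (y ⊗ₜ z)) =
      legs (φ ∘ₗ LinearMap.mulRight ℂ y) (ψ ∘ₗ LinearMap.mulRight ℂ z) X := by
    intro y z X
    induction X with
    | zero => simp
    | tmul a b => simp
    | add a b ha hb => rw [add_mul, map_add, map_add, ha, hb]
  have h2 : ∀ Y : H ⊗[ℂ] H, legs φ ψ (comul x * Y) =
      legs (actO ∘ₗ dualShift φ) actH.toLinearMap
        Y ψ x := by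
    intro Y
    induction Y with
    | zero => simp
    | tmul y z => rw [h1]; rfl
    | add a b ha hb => rw [mul_add, map_add, map_add, ha, hb]; rfl
  rw [← h2, ← Bialgebra.comul_mul]
  rfl

variable [FiniteDimensional ℂ H]

variable (H) in
/-- The canonical element `Σ x_i ⊗ x^i ∈ H ⊗ H*`, with `H*` acting on itself by
multiplication; its matrices in the representations of `H` are the matrices `T`. -/
def canT : H ⊗[ℂ] Module.End ℂ (Module.Dual ℂ H) :=
  LinearMap.lTensor H actO (coevaluation ℂ H 1)

lemma contractWith_canT : contractWith (canT H) = actO := by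
  refine LinearMap.ext fun φ => ?_
  have hφ : φ = ∑ i, φ (Module.Basis.ofVectorSpace ℂ H i) •
      (Module.Basis.ofVectorSpace ℂ H).coord i := by
    exact ((Module.Basis.ofVectorSpace ℂ H).sum_dual_apply_smul_coord φ).symm
  rw [contractWith_apply, canT, coevaluation_apply_one]
  conv_rhs => rw [hφ]
  simp [map_sum]

/-- The embedding `H ⊗ H → H ⊗ End(H*)` given by the action of the second factor. -/
def inE : H ⊗[ℂ] H →ₐ[ℂ] H ⊗[ℂ] Module.End ℂ (Module.Dual ℂ H) :=
  Algebra.TensorProduct.map (AlgHom.id ℂ H) actH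

variable (R : UniversalRMatrix H)

/-- The action of the coefficients of `A`: the matrix `L⁽⁺⁾ L⁽⁻⁾⁻¹ = (T ⊗ id)(R R')`. -/
def actA : Module.Dual ℂ H →ₗ[ℂ] Module.End ℂ (Module.Dual ℂ H) :=
  contractWith (inE ((R.R : H ⊗[ℂ] H) * R.R'))

/-- The action of the coefficients of `B`: the matrix `L⁽⁺⁾ T L⁽⁻⁾⁻¹`, where
`L⁽⁺⁾ = (T ⊗ id)(R)` and `L⁽⁻⁾⁻¹ = (T ⊗ id)(R')`. -/
def actB : Module.Dual ℂ H →ₗ[ℂ] Module.End ℂ (Module.Dual ℂ H) :=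
  contractWith (inE (R.R : H ⊗[ℂ] H) * canT H * inE (R.R' : H ⊗[ℂ] H))

section

variable {n : Type} [Fintype n] [DecidableEq n]

/-- `H` acting on `H*`, as scalar matrices. -/
abbrev homE (H : Type*) [Ring H] [HopfAlgebra ℂ H] (n : Type) [Fintype n] [DecidableEq n] :
    H →ₐ[ℂ] Matrix n n (Module.End ℂ (Module.Dual ℂ H)) :=
  (Matrix.scalarAlgHom n ℂ).comp actH

lemma commute_scal_homE (M : Matrix n n ℂ) (h : H) : Commute (scal _ n M) (homE H n h) :=
  commute_scal_scalar _ _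

lemma evMat_inE (ρ : H →ₐ[ℂ] Matrix n n ℂ) (X : H ⊗[ℂ] H) :
    evMat _ ρ (inE X) = legs ((scal _ n).comp ρ).toLinearMap (homE H n).toLinearMap X := by
  induction X with
  | zero => simp
  | tmul x y => rfl
  | add x y hx hy => rw [map_add, map_add, map_add, hx, hy]

lemma coeffMatrix_actA (ρ : H →ₐ[ℂ] Matrix n n ℂ) :
    coeffMatrix (actA R) ρ =
      legs ((scal _ n).comp ρ).toLinearMap (homE H n).toLinearMap R.R *
      legs (homE H n).toLinearMap ((scal _ n).comp ρ).toLinearMap R.R := by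
  rw [actA, ← evMat_eq, evMat_inE,
    legs_mul _ _ fun x y => commute_scal_homE (ρ x) y, legs_R' _ _ _ fun x y => commute_scal_homE (ρ x) y]

lemma coeffMatrix_actB (ρ : H →ₐ[ℂ] Matrix n n ℂ) :
    coeffMatrix (actB R) ρ =
      legs ((scal _ n).comp ρ).toLinearMap (homE H n).toLinearMap R.R * coeffMatrix actO ρ *
      legs (homE H n).toLinearMap ((scal _ n).comp ρ).toLinearMap R.R := by
  rw [actB, ← evMat_eq, map_mul, map_mul, evMat_inE, evMat_inE, evMat_eq, contractWith_canT,
    legs_R' _ _ _ fun x y => commute_scal_homE (ρ x) y]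

/-- `r(h) T = T ρ(h') r(h'')`. -/
lemma homE_mul_coeffMatrix (ρ : H →ₐ[ℂ] Matrix n n ℂ) (h : H) :
    homE H n h * coeffMatrix actO ρ =
      coeffMatrix actO ρ * conv ((scal _ n).comp ρ).toLinearMap (homE H n).toLinearMap h := by
  have key : ∀ (s t : n) (Y : H ⊗[ℂ] H),
      (coeffMatrix actO ρ *
        legs ((scal _ n).comp ρ).toLinearMap (homE H n).toLinearMap Y) s t =
      legs (actO ∘ₗ dualShift (coeff ρ s t))
        actH.toLinearMap Y := by
    intro s t Y
    induction Y with
    | zero => simp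
    | tmul y z =>
      have hc : dualShift (coeff ρ s t) y =
          ∑ u, ρ y u t • coeff ρ s u := by
        ext x
        simp [Matrix.mul_apply, mul_comm]
      simp only [legs_tmul, LinearMap.comp_apply, hc, map_sum, map_smul]
      simp [Matrix.mul_apply, scal, coeffMatrix, Algebra.ofId_apply, Matrix.diagonal_apply,
        Finset.sum_mul, Algebra.algebraMap_eq_smul_one]
    | add a b ha hb => rw [map_add, map_add, mul_add, ← ha, ← hb]; rfl
  ext1 s t
  rw [conv, LinearMap.comp_apply, key, ← actH_mul_actO]
  simp [coeffMatrix, Matrix.diagonal_mul]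

end

lemma legs_counit {Q : Type*} [Ring Q] [Algebra ℂ Q] (q : H →ₐ[ℂ] Q) :
    legs ((Algebra.ofId ℂ Q).comp (Bialgebra.counitAlgHom ℂ H)).toLinearMap q.toLinearMap
      (R.R : H ⊗[ℂ] H) = 1 ∧
    legs ((Algebra.ofId ℂ Q).comp (Bialgebra.counitAlgHom ℂ H)).toLinearMap q.toLinearMap
      (R.R' : H ⊗[ℂ] H) = 1 := by
  set e := (Algebra.ofId ℂ Q).comp (Bialgebra.counitAlgHom ℂ H) with he
  have hce : ∀ (z : Q) (x : H), Commute z (e x) := fun z x =>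
    (Algebra.commutes (counit (R := ℂ) x) z).symm
  have hee : conv e.toLinearMap e.toLinearMap = e.toLinearMap := by
    have := one_mul (1 : WithConv (H →ₗ[ℂ] Q))
    exact congrArg WithConv.ofConv this
  have inv : ∀ (p q : H →ₐ[ℂ] Q) (h : ∀ x y, Commute (p x) (q y)),
      IsUnit (legs p.toLinearMap q.toLinearMap (R.R : H ⊗[ℂ] H)) := fun p q h => by
    rw [legs_eq_lift p q h]
    exact R.R.isUnit.map _
  have h1 := legs_conv_left R e e q (fun x y => hce _ _) (fun x y => (hce _ _).symm)
    (fun x y => (hce _ _).symm)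
  have h2 := legs_conv_right R q e e (fun x y => hce _ _) (fun x y => hce _ _)
    (fun x y => hce _ _)
  rw [hee] at h1 h2
  refine ⟨?_, ?_⟩
  · exact ((inv e q fun x y => (hce _ _).symm).mul_eq_left.mp h1.symm)
  · rw [legs_R' R e q fun x y => (hce _ _).symm]
    exact ((inv q e fun x y => hce _ _).mul_eq_left.mp h2.symm)

lemma contract_counit (X : H ⊗[ℂ] Module.End ℂ (Module.Dual ℂ H)) :
    contract (counit : H →ₗ[ℂ] ℂ) X =
      Algebra.TensorProduct.lift ((Algebra.ofId ℂ _).comp (Bialgebra.counitAlgHom ℂ H))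
        (AlgHom.id ℂ _) (fun _ _ => Algebra.commutes _ _) X := by
  induction X with
  | zero => simp
  | tmul x a => rw [contract_tmul, Algebra.smul_def]; rfl
  | add x y hx hy => rw [map_add, map_add, hx, hy]

lemma contract_counit_inE (X : H ⊗[ℂ] H) :
    contract (counit : H →ₗ[ℂ] ℂ) (inE X) =
      legs ((Algebra.ofId ℂ _).comp (Bialgebra.counitAlgHom ℂ H)).toLinearMap
        actH.toLinearMap X := by
  induction X with
  | zero => simp
  | tmul x a => rw [inE, Algebra.TensorProduct.map_tmul, contract_tmul, Algebra.smul_def]; rfl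
  | add x y hx hy => rw [map_add, map_add, map_add, hx, hy]

lemma actA_counit : actA R (counit : H →ₗ[ℂ] ℂ) = 1 := by
  rw [actA, contractWith_apply, map_mul, contract_counit, map_mul, ← contract_counit,
    ← contract_counit, contract_counit_inE, contract_counit_inE, (legs_counit R _).1,
    (legs_counit R _).2, mul_one]

lemma actB_counit : actB R (counit : H →ₗ[ℂ] ℂ) = 1 := by
  rw [actB, contractWith_apply, contract_counit, map_mul, map_mul, ← contract_counit,
    ← contract_counit, ← contract_counit, contract_counit_inE, contract_counit_inE,
    (legs_counit R _).1, (legs_counit R _).2, ← contractWith_apply, contractWith_canT,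
    actO_counit]
  simp

lemma legs_mul_T_left {Q : Type*} [Ring Q] [Algebra ℂ Q] (p q r : H →ₐ[ℂ] Q) (T : Q)
    (hpq : ∀ x y, Commute (p x) (q y)) (hpr : ∀ x y, Commute (p x) (r y))
    (hqr : ∀ x y, Commute (q x) (r y)) (hT : ∀ h, r h * T = T * conv p.toLinearMap r.toLinearMap h)
    (hq : ∀ x, Commute (q x) T) :
    legs q.toLinearMap r.toLinearMap R.R * T =
      T * legs q.toLinearMap r.toLinearMap R.R * legs q.toLinearMap p.toLinearMap R.R := by
  rw [mul_assoc, ← legs_conv_right R q p r (fun x y => (hpq y x).symm) hqr hpr]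
  induction (R.R : H ⊗[ℂ] H) with
  | zero => simp
  | tmul x y =>
    simp only [legs_tmul, AlgHom.toLinearMap_apply]
    rw [mul_assoc, hT, ← mul_assoc, (hq x).eq, mul_assoc]
  | add a b ha hb => rw [map_add, map_add, add_mul, mul_add, ha, hb]

lemma legs_mul_T_right {Q : Type*} [Ring Q] [Algebra ℂ Q] (p q r : H →ₐ[ℂ] Q) (T : Q)
    (hpq : ∀ x y, Commute (p x) (q y)) (hpr : ∀ x y, Commute (p x) (r y))
    (hqr : ∀ x y, Commute (q x) (r y)) (hT : ∀ h, r h * T = T * conv p.toLinearMap r.toLinearMap h)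
    (hq : ∀ x, Commute (q x) T) :
    legs r.toLinearMap q.toLinearMap R.R * T =
      T * legs p.toLinearMap q.toLinearMap R.R * legs r.toLinearMap q.toLinearMap R.R := by
  rw [mul_assoc, ← legs_conv_left R p r q hpr hpq (fun x y => (hqr y x).symm)]
  induction (R.R : H ⊗[ℂ] H) with
  | zero => simp
  | tmul x y =>
    simp only [legs_tmul, AlgHom.toLinearMap_apply]
    rw [mul_assoc, (hq y).eq, ← mul_assoc, hT, mul_assoc]
  | add a b ha hb => rw [map_add, map_add, add_mul, mul_add, ha, hb]

section

variable {ι κ : Type} [Fintype ι] [DecidableEq ι] [Fintype κ] [DecidableEq κ]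

lemma coeffMatrix_actO_tensorRep (I : H →ₐ[ℂ] Matrix ι ι ℂ) (J : H →ₐ[ℂ] Matrix κ κ ℂ) :
    coeffMatrix actO (tensorRep I J) =
      coeffMatrix actO (repL I J) * coeffMatrix actO (repR I J) := by
  ext1 s t
  have h : coeff (tensorRep I J) s t = conv (coeff I s.1 t.1) (coeff J s.2 t.2) := by
    ext x
    have : ∀ X : H ⊗[ℂ] H, evalRep I J X s t = legs (coeff I s.1 t.1) (coeff J s.2 t.2) X := by
      intro X
      induction X with
      | zero => simp
      | tmul x y => simp [evalRep_tmul]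
      | add a b ha hb => rw [map_add, map_add, ← ha, ← hb]; rfl
    exact this (comul x)
  simp only [coeffMatrix, Matrix.of_apply, Matrix.mul_apply, h, actO_conv, coeff_repL, coeff_repR,
    Fintype.sum_prod_type, map_smul, Matrix.one_apply]
  simp

lemma isHandle_act : IsHandle R (actB R) (actA R) := by
  have main : ∀ {ι κ : Type} [Fintype ι] [DecidableEq ι] [Fintype κ] [DecidableEq κ]
      (I : H →ₐ[ℂ] Matrix ι ι ℂ) (J : H →ₐ[ℂ] Matrix κ κ ℂ),
      coeffMatrix (actB R) (tensorRep I J) = fusionRHS R (actB R) I J ∧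
      coeffMatrix (actA R) (tensorRep I J) = fusionRHS R (actA R) I J ∧
      exchangeLHS R (actB R) (actA R) I J = exchangeRHS R (actB R) (actA R) I J := by
    intro ι κ _ _ _ _ I J
    set p := homL (Module.End ℂ (Module.Dual ℂ H)) I J with hp
    set q := homR (Module.End ℂ (Module.Dual ℂ H)) I J with hq
    set r := homE H (ι × κ) with hr
    have hpq : ∀ x y, Commute (p x) (q y) := commute_homL_homR I J
    have hpr : ∀ x y, Commute (p x) (r y) := fun x y => commute_scal_homE _ _
    have hqr : ∀ x y, Commute (q x) (r y) := fun x y => commute_scal_homE _ _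
    have hqp : ∀ x y, Commute (q x) (p y) := fun x y => (hpq y x).symm
    have hrp : ∀ x y, Commute (r x) (p y) := fun x y => (hpr y x).symm
    have hrq : ∀ x y, Commute (r x) (q y) := fun x y => (hqr y x).symm
    have hT1 := homE_mul_coeffMatrix (repL I J)
    have hT2 := homE_mul_coeffMatrix (repR I J)
    have cT1 := commute_hom_coeffMatrix_left (actO (H := H)) I J
    have cT2 := commute_hom_coeffMatrix_right (actO (H := H)) I J
    have e1 := legs_mul_T_left R p q r _ hpq hpr hqr hT1 cT1
    have e1' := legs_mul_T_right R p q r _ hpq hpr hqr hT1 cT1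
    have e2 := legs_mul_T_right R q p r _ hqp hqr hpr hT2 cT2
    have yb1 := (yangBaxter R q r p hqr hqp hrp).symm
    have yb2 := yangBaxter R r q p hrq hrp hqp
    have yb3 := yangBaxter R p q r hpq hpr hqr
    have yb4 := yangBaxter R p r q hpr hpq hrq
    have yb5 := yangBaxter R r p q hrp hrq hpq
    have hi1 := scal_inv_mul (A := Module.End ℂ (Module.Dual ℂ H)) I J R.R'
    have hi2 := scal_inv_mul (A := Module.End ℂ (Module.Dual ℂ H)) I J R.R
    rw [scal_evalRep, legs_R' R _ _ hpq] at hi1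
    rw [scal_evalRep] at hi2
    have t1 := legs_conv_left R p q r hpq hpr hqr
    have t2 := legs_conv_right R r p q hrp hrq hpq
    refine ⟨?_, ?_, ?_⟩
    · rw [fusionRHS, leg₁_coeffMatrix _ I J, leg₂_coeffMatrix _ I J, coeffMatrix_actB,
        coeffMatrix_actB, coeffMatrix_actB, scal_tensorRep, coeffMatrix_actO_tensorRep,
        scal_evalRep I J (R.R' : H ⊗[ℂ] H), legs_R' R _ _ hpq, t1, t2]
      exact fusionB_aux hi1 yb1 yb2 e1 e2
    · rw [fusionRHS, leg₁_coeffMatrix _ I J, leg₂_coeffMatrix _ I J, coeffMatrix_actA,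
        coeffMatrix_actA, coeffMatrix_actA, scal_tensorRep,
        scal_evalRep I J (R.R' : H ⊗[ℂ] H), legs_R' R _ _ hpq, t1, t2]
      exact fusionA_aux hi1 yb1 yb2
    · rw [exchangeLHS, exchangeRHS, leg₁_coeffMatrix _ I J, leg₂_coeffMatrix _ I J,
        coeffMatrix_actA, coeffMatrix_actB, scal_evalRep I J (R.R' : H ⊗[ℂ] H), legs_R' R _ _ hpq,
        scal_evalRep I J (R.R : H ⊗[ℂ] H)]
      exact exchange_aux hi2 yb1 yb3 yb4 yb5 e1 e1'
  exact ⟨⟨actB_counit R, fun I J => (main I J).1⟩, ⟨actA_counit R, fun I J => (main I J).2.1⟩,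
    fun I J => (main I J).2.2⟩

end

/-- The representation `▷` of `𝓛₁₀(H)` on `H*`. -/
def handleRep : HandleAlgebra R →ₐ[ℂ] Module.End ℂ (Module.Dual ℂ H) :=
  handleLift (actB R) (actA R) (isHandle_act R)

end HandleRep

/-! ### The action of `H` on the handle algebra -/

section ConvolutionAlgebra

open WithConv

variable {H : Type*} [Ring H] [HopfAlgebra ℂ H] {Q : Type*} [Ring Q] [Algebra ℂ Q]

/-- The convolution algebra of linear maps `H → Q`. -/
abbrev ConvAlg (H Q : Type*) [Ring H] [HopfAlgebra ℂ H] [Ring Q] [Algebra ℂ Q] : Type _ :=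
  WithConv (H →ₗ[ℂ] Q)

lemma convAlg_mul_apply (F G : ConvAlg H Q) (h : H) :
    (F * G) h = legs F.ofConv G.ofConv (comul h) := rfl

/-- The linear map `h ↦ ε(h) a`. -/
def cstMap (H : Type*) [Ring H] [HopfAlgebra ℂ H] (a : Q) : ConvAlg H Q :=
  toConv (LinearMap.toSpanSingleton ℂ Q a ∘ₗ counit)

@[simp] lemma cstMap_apply (a : Q) (h : H) : cstMap H a h = counit (R := ℂ) h • a := rfl

lemma mul_cstMap_apply (F : ConvAlg H Q) (a : Q) (h : H) : (F * cstMap H a) h = F h * a := by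
  have : ∀ Y : H ⊗[ℂ] H, legs F.ofConv (cstMap H a).ofConv Y =
      legs F.ofConv (1 : ConvAlg H Q).ofConv Y * a := by
    intro Y
    induction Y with
    | zero => simp
    | tmul x y => simp [LinearMap.convOne_def, cstMap, Algebra.algebraMap_eq_smul_one]
    | add x y hx hy => rw [map_add, map_add, add_mul, hx, hy]
  rw [convAlg_mul_apply, this, ← convAlg_mul_apply, mul_one]

lemma cstMap_mul_apply (F : ConvAlg H Q) (a : Q) (h : H) : (cstMap H a * F) h = a * F h := by
  have : ∀ Y : H ⊗[ℂ] H, legs (cstMap H a).ofConv F.ofConv Y =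
      a * legs (1 : ConvAlg H Q).ofConv F.ofConv Y := by
    intro Y
    induction Y with
    | zero => simp
    | tmul x y => simp [LinearMap.convOne_def, cstMap, Algebra.algebraMap_eq_smul_one]
    | add x y hx hy => rw [map_add, map_add, mul_add, hx, hy]
  rw [convAlg_mul_apply, this, ← convAlg_mul_apply, one_mul]

lemma convAlg_ext {F G : ConvAlg H Q} (h : ∀ x, F x = G x) : F = G :=
  WithConv.ext (LinearMap.ext h)

/-- The embedding of `Q` in the convolution algebra, `a ↦ (h ↦ ε(h) a)`. -/
def cst (H Q : Type*) [Ring H] [HopfAlgebra ℂ H] [Ring Q] [Algebra ℂ Q] :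
    Q →ₐ[ℂ] ConvAlg H Q :=
  AlgHom.ofLinearMap
    { toFun := cstMap H
      map_add' := fun a b => convAlg_ext fun h => smul_add _ _ _
      map_smul' := fun c a => convAlg_ext fun h => smul_comm _ _ _ }
    (convAlg_ext fun h => by simp [Algebra.algebraMap_eq_smul_one])
    (fun a b => convAlg_ext fun h => by
      change _ = (cstMap H a * cstMap H b) h
      rw [mul_cstMap_apply]; simp)

@[simp] lemma cst_apply (a : Q) (h : H) : cst H Q a h = counit (R := ℂ) h • a := rfl

lemma mul_cst_apply (F : ConvAlg H Q) (a : Q) (h : H) : (F * cst H Q a) h = F h * a :=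
  mul_cstMap_apply F a h

lemma cst_mul_apply (F : ConvAlg H Q) (a : Q) (h : H) : (cst H Q a * F) h = a * F h :=
  cstMap_mul_apply F a h

lemma commute_cst (F : ConvAlg H Q) (a : Q) (h : ∀ x, Commute (F x) a) :
    Commute F (cst H Q a) :=
  convAlg_ext fun x => by rw [mul_cst_apply, cst_mul_apply, (h x).eq]


/-- The convolution inverse `h ↦ p(S(h))` of a morphism of algebras `p`. -/
def convInv (p : H →ₐ[ℂ] Q) : H →ₗ[ℂ] Q := p.toLinearMap ∘ₗ antipode ℂ

@[simp] lemma convInv_apply (p : H →ₐ[ℂ] Q) (h : H) : convInv p h = p (antipode ℂ h) := rfl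

lemma toConv_mul_convInv (p : H →ₐ[ℂ] Q) :
    toConv p.toLinearMap * toConv (convInv p) = (1 : ConvAlg H Q) := by
  have h := LinearMap.algHom_comp_convMul_distrib p (toConv LinearMap.id)
    (toConv (antipode ℂ (A := H)))
  rw [LinearMap.id_mul_antipode] at h
  refine (WithConv.ext h.symm).trans (convAlg_ext fun x => ?_)
  change p (algebraMap ℂ H (counit x)) = algebraMap ℂ Q (counit x)
  simp

lemma convInv_mul_toConv (p : H →ₐ[ℂ] Q) :
    toConv (convInv p) * toConv p.toLinearMap = (1 : ConvAlg H Q) := by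
  have h := LinearMap.algHom_comp_convMul_distrib p (toConv (antipode ℂ (A := H)))
    (toConv LinearMap.id)
  rw [LinearMap.antipode_mul_id] at h
  refine (WithConv.ext h.symm).trans (convAlg_ext fun x => ?_)
  change p (algebraMap ℂ H (counit x)) = algebraMap ℂ Q (counit x)
  simp

/-- A matrix with coefficients in the convolution algebra, as a linear map from `H` to matrices. -/
def matConvMap {n : Type*} [Fintype n] [DecidableEq n] (M : Matrix n n (ConvAlg H Q)) :
    H →ₗ[ℂ] Matrix n n Q where
  toFun h := Matrix.of fun i j => M i j h
  map_add' x y := by ext; simp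
  map_smul' c x := by ext; simp

@[simp] lemma matConvMap_apply {n : Type*} [Fintype n] [DecidableEq n]
    (M : Matrix n n (ConvAlg H Q)) (h : H) (i j : n) : matConvMap M h i j = M i j h := rfl

variable (H) in
/-- Matrices with coefficients in the convolution algebra, as linear maps from `H` to matrices. -/
def matConv (Q n : Type*) [Ring Q] [Algebra ℂ Q] [Fintype n] [DecidableEq n] :
    Matrix n n (ConvAlg H Q) →ₐ[ℂ] ConvAlg H (Matrix n n Q) :=
  AlgHom.ofLinearMap
    { toFun := fun M => toConv (matConvMap M)
      map_add' := fun M N => rfl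
      map_smul' := fun c M => rfl }
    (convAlg_ext fun h => by
      ext i j
      change (1 : Matrix n n (ConvAlg H Q)) i j h = algebraMap ℂ (Matrix n n Q) (counit h) i j
      by_cases hij : i = j
      · subst hij; simp [Matrix.algebraMap_matrix_apply]
      · simp [Matrix.algebraMap_matrix_apply, hij])
    (fun M N => convAlg_ext fun h => by
      ext i j
      have : ∀ Y : H ⊗[ℂ] H, (∑ k, legs (M i k).ofConv (N k j).ofConv Y) =
          legs (matConvMap M) (matConvMap N) Y i j := by
        intro Y
        induction Y with
        | zero => simp
        | tmul x y => simp [Matrix.mul_apply]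
        | add x y hx hy =>
          simp only [map_add, Finset.sum_add_distrib] at hx hy ⊢
          rw [hx, hy]; rfl
      refine Eq.trans ?_ (this (comul h))
      change (M * N) i j h = _
      rw [Matrix.mul_apply, WithConv.ofConv_sum, LinearMap.sum_apply]
      rfl)

@[simp] lemma matConv_apply {n : Type*} [Fintype n] [DecidableEq n]
    (M : Matrix n n (ConvAlg H Q)) (h : H) (i j : n) : matConv H Q n M h i j = M i j h := rfl

lemma matConv_injective {n : Type*} [Fintype n] [DecidableEq n] :
    Function.Injective (matConv H Q n) := fun M N h => by
  ext1 i j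
  refine convAlg_ext fun x => ?_
  rw [← matConv_apply, h, matConv_apply]

lemma matConv_scal {n : Type*} [Fintype n] [DecidableEq n] (M : Matrix n n ℂ) :
    matConv H Q n (scal (ConvAlg H Q) n M) = cst H _ (scal Q n M) := by
  refine convAlg_ext fun h => ?_
  ext i j
  simp [scal, Algebra.ofId_apply, Algebra.algebraMap_eq_smul_one, smul_smul, mul_comm]

end ConvolutionAlgebra

section Adjoint

open WithConv

variable {H : Type*} [Ring H] [HopfAlgebra ℂ H] {A : Type*} [Ring A] [Algebra ℂ A]

/-- `h ↦ (z ↦ h' z S(h''))`. -/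
def adj : H →ₗ[ℂ] Module.End ℂ H :=
  conv (LinearMap.mul ℂ H) ((LinearMap.mul ℂ H).flip ∘ₗ antipode ℂ)

/-- For a linear map `f : H* → A`, the map which sends `φ` to `h ↦ f(φ(h' ? S(h'')))`. -/
def adConv (f : Module.Dual ℂ H →ₗ[ℂ] A) : Module.Dual ℂ H →ₗ[ℂ] ConvAlg H A where
  toFun φ := toConv (f ∘ₗ LinearMap.llcomp ℂ H H ℂ φ ∘ₗ adj)
  map_add' φ ψ := by ext; simp
  map_smul' c φ := by ext; simp

lemma adConv_apply (f : Module.Dual ℂ H →ₗ[ℂ] A) (φ : Module.Dual ℂ H) (h : H) :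
    adConv f φ h = f (φ ∘ₗ adj h) := rfl

/-- `h ↦ ρ(h') M ρ(S(h''))` represents the action on the matrix `M`. -/
lemma matConv_adConv {n : Type} [Fintype n] [DecidableEq n] (f : Module.Dual ℂ H →ₗ[ℂ] A)
    (ρ : H →ₐ[ℂ] Matrix n n ℂ) :
    matConv H A n (coeffMatrix (adConv f) ρ) =
      toConv ((scal A n).comp ρ).toLinearMap * cst H _ (coeffMatrix f ρ) *
        toConv (convInv ((scal A n).comp ρ)) := by
  refine convAlg_ext fun h => ?_
  have h1 : toConv ((scal A n).comp ρ).toLinearMap * cst H _ (coeffMatrix f ρ) =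
      toConv (LinearMap.mulRight ℂ (coeffMatrix f ρ) ∘ₗ ((scal A n).comp ρ).toLinearMap) :=
    convAlg_ext fun x => mul_cst_apply _ _ _
  rw [h1, convAlg_mul_apply]
  ext i j
  change f (coeff ρ i j ∘ₗ legs _ _ (comul h)) = _
  induction (comul h : H ⊗[ℂ] H) with
  | zero => simp
  | tmul x y =>
    have hc : coeff ρ i j ∘ₗ legs (LinearMap.mul ℂ H)
        ((LinearMap.mul ℂ H).flip ∘ₗ antipode ℂ) (x ⊗ₜ[ℂ] y) =
        ∑ a, ∑ b, (ρ x i a * ρ (antipode ℂ y) b j) • coeff ρ a b := by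
      ext z
      simp only [LinearMap.coe_comp, Function.comp_apply, legs_tmul, Module.End.mul_apply,
        LinearMap.flip_apply, LinearMap.mul_apply', coeff_apply, map_mul, Matrix.mul_apply,
        LinearMap.sum_apply, LinearMap.smul_apply, smul_eq_mul, Finset.mul_sum]
      exact Finset.sum_congr rfl fun a _ => Finset.sum_congr rfl fun b _ => by ring
    rw [hc]
    simp only [map_sum, map_smul]
    simp only [legs_tmul, Matrix.mul_apply, LinearMap.comp_apply, AlgHom.toLinearMap_apply,
      AlgHom.comp_apply, LinearMap.mulRight_apply, convInv_apply, scal, Finset.sum_mul,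
      AlgHom.mapMatrix_apply, Matrix.map_apply, Algebra.ofId_apply, coeffMatrix, Matrix.of_apply]
    rw [Finset.sum_comm]
    refine Finset.sum_congr rfl fun b _ => Finset.sum_congr rfl fun a _ => ?_
    rw [← Algebra.commutes, ← mul_assoc, ← map_mul, ← Algebra.smul_def, mul_comm]
  | add x y hx hy => rw [map_add, map_add, LinearMap.comp_add, map_add, hx, hy]; rfl

end Adjoint

section AdjointAux

variable {Q : Type*} [Ring Q]

lemma fusion_ad_aux {p p' q q' M N S Si : Q} (hp' : p' * p = 1) (hp : p * p' = 1)
    (hq : q * q' = 1) (hq2 : q' * q = 1) (hS : S * Si = 1) (hS' : Si * S = 1)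
    (hc : S * (q * p) = p * q * S) (cM : q * M = M * q) (cN : p * N = N * p) :
    p * q * (M * S * N * Si) * (q' * p') =
      p * M * p' * S * (q * N * q') * Si := by
  have h1 : q * S = p' * S * q * p := by
    calc q * S = p' * (p * q * S) := by
          rw [← mul_assoc, ← mul_assoc, hp', one_mul]
      _ = p' * S * q * p := by rw [← hc]; noncomm_ring
  have h2 : p * Si * q' * p' = q' * Si := by
    have h3 : Si * (p * q) = q * p * Si := by
      calc Si * (p * q) = Si * (p * q * S) * Si := by
            rw [mul_assoc, mul_assoc _ S Si, hS, mul_one]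
        _ = q * p * Si := by rw [← hc, ← mul_assoc, hS', one_mul]
    have h4 : q * (p * Si * q' * p') = q * (q' * Si) := by
      calc q * (p * Si * q' * p') = (q * p * Si) * q' * p' := by noncomm_ring
        _ = Si * p * (q * q') * p' := by rw [← h3]; noncomm_ring
        _ = Si * (p * p') := by rw [hq, mul_one, mul_assoc]
        _ = q * (q' * Si) := by rw [hp, mul_one, ← mul_assoc, hq, one_mul]
    have hu : q' * q * (p * Si * q' * p') = q' * q * (q' * Si) := by
      rw [mul_assoc, h4, mul_assoc]
    rwa [hq2, one_mul, one_mul] at hu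
  calc p * q * (M * S * N * Si) * (q' * p')
      = p * (q * M) * S * N * Si * q' * p' := by noncomm_ring
    _ = p * M * (q * S) * N * Si * q' * p' := by rw [cM]; noncomm_ring
    _ = p * M * p' * S * q * (p * N) * Si * q' * p' := by rw [h1]; noncomm_ring
    _ = p * M * p' * S * q * N * (p * Si * q' * p') := by rw [cN]; noncomm_ring
    _ = p * M * p' * S * (q * N * q') * Si := by rw [h2]; noncomm_ring

lemma exchange_ad_aux {p p' q q' M N S X Xi : Q} (hp : p * p' = 1) (hp' : p' * p = 1)
    (hq : q * q' = 1) (hq' : q' * q = 1) (hX : X * Xi = 1) (hX' : Xi * X = 1)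
    (hc : S * (q * p) = p * q * S) (hcX : X * (p * q) = q * p * X)
    (cM : q * M = M * q) (cM' : q' * M = M * q') (cN : p * N = N * p) (cN' : p' * N = N * p')
    (h : X * M * S * N = N * X * M * Xi) :
    X * (p * M * p') * S * (q * N * q') = q * N * q' * X * (p * M * p') * Xi := by
  have h1 : p' * S * q = q * S * p' := by
    calc p' * S * q = p' * (S * (q * p)) * p' := by
          rw [mul_assoc p' (S * (q * p)) p', mul_assoc S, mul_assoc q, hp, mul_one, mul_assoc]
      _ = (p' * p) * q * S * p' := by rw [hc]; noncomm_ring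
      _ = q * S * p' := by rw [hp', one_mul]
  have h3 : Xi * (q * p) = p * q * Xi := by
    calc Xi * (q * p) = Xi * (q * p * X) * Xi := by
          rw [mul_assoc, mul_assoc _ X Xi, hX, mul_one]
      _ = p * q * Xi := by rw [← hcX, ← mul_assoc, hX', one_mul]
  have h4 : Xi * p' * q' = q' * p' * Xi := by
    calc Xi * p' * q' = (q' * (p' * p) * q) * Xi * p' * q' := by
          rw [hp', mul_one, hq', one_mul]
      _ = q' * p' * (p * q * Xi) * p' * q' := by noncomm_ring
      _ = q' * p' * Xi * (q * (p * p') * q') := by rw [← h3]; noncomm_ring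
      _ = q' * p' * Xi := by rw [hp, mul_one, hq, mul_one]
  have h5 : p * X * q' = q' * X * p := by
    calc p * X * q' = (q' * q) * p * X * q' := by rw [hq', one_mul]
      _ = q' * (q * p * X) * q' := by noncomm_ring
      _ = q' * X * p * (q * q') := by rw [← hcX]; noncomm_ring
      _ = q' * X * p := by rw [hq, mul_one]
  calc X * (p * M * p') * S * (q * N * q')
      = X * p * M * (p' * S * q) * N * q' := by noncomm_ring
    _ = X * p * (q * M) * S * (p' * N) * q' := by rw [h1, cM]; noncomm_ring
    _ = (X * (p * q)) * M * S * N * p' * q' := by rw [cN']; noncomm_ring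
    _ = q * p * (X * M * S * N) * p' * q' := by rw [hcX]; noncomm_ring
    _ = q * (p * N) * X * M * (Xi * p' * q') := by rw [h]; noncomm_ring
    _ = q * N * p * X * (q' * M) * p' * Xi := by rw [h4, cN, cM']; noncomm_ring
    _ = q * N * (p * X * q') * M * p' * Xi := by noncomm_ring
    _ = q * N * q' * X * (p * M * p') * Xi := by rw [h5]; noncomm_ring

end AdjointAux

section Action

open WithConv

variable {H : Type*} [Ring H] [HopfAlgebra ℂ H] (R : UniversalRMatrix H)

lemma conv_legs {Q : Type*} [Ring Q] [Algebra ℂ Q] (p q : H →ₐ[ℂ] Q)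
    (hpq : ∀ x y, Commute (p x) (q y)) :
    cst H Q (legs p.toLinearMap q.toLinearMap R.R) *
        (toConv p.toLinearMap * toConv q.toLinearMap) =
      toConv q.toLinearMap * toConv p.toLinearMap *
        cst H Q (legs p.toLinearMap q.toLinearMap R.R) := by
  refine convAlg_ext fun h => ?_
  rw [cst_mul_apply, mul_cst_apply]
  exact (legs_comul_op R p q h hpq).symm

variable {A : Type*} [Ring A] [Algebra ℂ A]
  {ι κ : Type} [Fintype ι] [DecidableEq ι] [Fintype κ] [DecidableEq κ]

lemma toConv_tensorRep (I : H →ₐ[ℂ] Matrix ι ι ℂ) (J : H →ₐ[ℂ] Matrix κ κ ℂ) :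
    toConv ((scal A _).comp (tensorRep I J)).toLinearMap =
      toConv (homL A I J).toLinearMap * toConv (homR A I J).toLinearMap :=
  congrArg toConv (scal_tensorRep I J)

lemma toConv_convInv_tensorRep (I : H →ₐ[ℂ] Matrix ι ι ℂ) (J : H →ₐ[ℂ] Matrix κ κ ℂ) :
    toConv (convInv ((scal A _).comp (tensorRep I J))) =
      toConv (convInv (homR A I J)) * toConv (convInv (homL A I J)) := by
  refine left_inv_eq_right_inv (convInv_mul_toConv _) ?_
  rw [toConv_tensorRep, mul_assoc, ← mul_assoc (toConv (homR A I J).toLinearMap),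
    toConv_mul_convInv, one_mul, toConv_mul_convInv]

lemma adj_counit (h : H) : (counit : H →ₗ[ℂ] ℂ) ∘ₗ adj h = counit (R := ℂ) h •
    (counit : H →ₗ[ℂ] ℂ) := by
  have h1 : ∀ Y : H ⊗[ℂ] H, (counit : H →ₗ[ℂ] ℂ) ∘ₗ
      legs (LinearMap.mul ℂ H) ((LinearMap.mul ℂ H).flip ∘ₗ antipode ℂ) Y =
      legs (counit : H →ₗ[ℂ] ℂ) counit Y • (counit : H →ₗ[ℂ] ℂ) := by
    intro Y
    induction Y with
    | zero => simp
    | tmul x y => ext z; simp; ring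
    | add x y hx hy => rw [map_add, map_add, LinearMap.comp_add, hx, hy, add_smul]
  have h2 : legs (counit : H →ₗ[ℂ] ℂ) counit (comul h) = counit (R := ℂ) h :=
    congrArg (fun F : ConvAlg H ℂ => F h) (one_mul (1 : ConvAlg H ℂ))
  rw [← h2]
  exact h1 (comul h)

variable {R}

lemma IsLoop.adConv {f : Module.Dual ℂ H →ₗ[ℂ] A} (hf : IsLoop R f) : IsLoop R (adConv f) where
  unit := convAlg_ext fun h => by
    rw [adConv_apply, adj_counit, map_smul, hf.unit]
    simp [Algebra.algebraMap_eq_smul_one]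
  fusion I J := by
    refine matConv_injective ?_
    have hpq := commute_homL_homR (A := A) I J
    have hf' := hf.fusion I J
    rw [fusionRHS, leg₁_coeffMatrix _ I J, leg₂_coeffMatrix _ I J] at hf'
    rw [fusionRHS, leg₁_coeffMatrix _ I J, leg₂_coeffMatrix _ I J, map_mul, map_mul, map_mul,
      matConv_scal, matConv_scal, matConv_adConv, matConv_adConv, matConv_adConv,
      toConv_tensorRep, toConv_convInv_tensorRep, hf', map_mul, map_mul, map_mul]
    have hc := conv_legs R (homR A I J) (homL A I J) fun x y => (hpq y x).symm
    rw [← legs_R' R _ _ hpq, ← scal_evalRep] at hc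
    refine fusion_ad_aux (convInv_mul_toConv _) (toConv_mul_convInv _) (toConv_mul_convInv _)
      (convInv_mul_toConv _) ?_ ?_ hc
      (commute_cst _ _ fun x => commute_hom_coeffMatrix_left f I J x)
      (commute_cst _ _ fun x => commute_hom_coeffMatrix_right f I J x)
    · rw [← map_mul, scal_inv_mul, map_one]
    · rw [← map_mul, ← map_mul, ← map_mul, Units.inv_mul, map_one, map_one, map_one]

lemma IsHandle.adConv {fB fA : Module.Dual ℂ H →ₗ[ℂ] A} (hf : IsHandle R fB fA) :
    IsHandle R (adConv fB) (adConv fA) where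
  isLoopB := hf.isLoopB.adConv
  isLoopA := hf.isLoopA.adConv
  exchange I J := by
    refine matConv_injective ?_
    have hpq := commute_homL_homR (A := A) I J
    have hf' := congrArg (cst H _) (hf.exchange I J)
    rw [exchangeLHS, exchangeRHS, leg₁_coeffMatrix _ I J, leg₂_coeffMatrix _ I J] at hf'
    rw [exchangeLHS, exchangeRHS, leg₁_coeffMatrix _ I J, leg₂_coeffMatrix _ I J]
    simp only [map_mul, matConv_scal, matConv_adConv] at hf' ⊢
    have hc := conv_legs R (homR A I J) (homL A I J) fun x y => (hpq y x).symm
    rw [← legs_R' R _ _ hpq, ← scal_evalRep] at hc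
    have hcX := conv_legs R (homL A I J) (homR A I J) hpq
    rw [← scal_evalRep] at hcX
    refine exchange_ad_aux (toConv_mul_convInv _) (convInv_mul_toConv _) (toConv_mul_convInv _)
      (convInv_mul_toConv _) ?_ ?_ hc hcX
      (commute_cst _ _ fun x => commute_hom_coeffMatrix_left fB I J x)
      (commute_cst _ _ fun x => commute_hom_coeffMatrix_left fB I J _)
      (commute_cst _ _ fun x => commute_hom_coeffMatrix_right fA I J x)
      (commute_cst _ _ fun x => commute_hom_coeffMatrix_right fA I J _) hf'
    · rw [← map_mul, scal_inv_mul, map_one]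
    · rw [← map_mul, ← map_mul, ← map_mul, Units.inv_mul, map_one, map_one, map_one]

variable (R)

/-- The right action of `H` on the handle algebra, as a map `x ↦ (h ↦ x · h)`. It is given by
`U · h = h' U S(h'')` for `U = A, B`, i.e. `U(φ) · h = U(φ(h' ? S(h'')))`, and by
`(x y) · h = (x · h') (y · h'')`, `1 · h = ε(h)`, i.e. `x ↦ (h ↦ x · h)` is a
morphism to the convolution algebra. -/
def handleAction : HandleAlgebra R →ₐ[ℂ] ConvAlg H (HandleAlgebra R) :=
  handleLift (adConv (handleB R)) (adConv (handleA R)) (isHandle R).adConv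

/-- The subalgebra `𝓛₁₀ⁱⁿᵛ(H)` of invariants: the `x` with `x · h = ε(h) x` for all `h`. -/
def invariants : Subalgebra ℂ (HandleAlgebra R) :=
  AlgHom.equalizer (handleAction R) (cst H (HandleAlgebra R))

variable {R}

lemma mem_invariants {x : HandleAlgebra R} :
    x ∈ invariants R ↔ ∀ h, handleAction R x h = counit (R := ℂ) h • x :=
  ⟨fun hx h => congrArg (fun F : ConvAlg H (HandleAlgebra R) => F h) hx,
    fun hx => convAlg_ext hx⟩

end Action

/-! ### Symmetric linear forms -/

section SymmetricForms

set_option linter.unusedSectionVars false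

open WithConv

variable (H : Type*) [Ring H] [HopfAlgebra ℂ H]

/-- The space `SLF(H)` of symmetric linear forms on `H`. -/
def SLF : Submodule ℂ (Module.Dual ℂ H) where
  carrier := {ψ | ∀ x y, ψ (x * y) = ψ (y * x)}
  add_mem' {ψ χ} h h' x y := by
    rw [LinearMap.add_apply, LinearMap.add_apply, h x y, h' x y]
  zero_mem' _ _ := rfl
  smul_mem' c ψ h x y := by rw [LinearMap.smul_apply, LinearMap.smul_apply, h x y]

variable {H}

lemma mem_SLF {ψ : Module.Dual ℂ H} : ψ ∈ SLF H ↔ ∀ x y, ψ (x * y) = ψ (y * x) := Iff.rfl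

/-- `h ↦ (ψ ↦ ψ(h ?))`. -/
def actL : H →ₗ[ℂ] Module.End ℂ (Module.Dual ℂ H) where
  toFun h := LinearMap.lcomp ℂ ℂ (LinearMap.mulLeft ℂ h)
  map_add' x y := by ext; simp [add_mul]
  map_smul' c x := by ext; simp

@[simp] lemma actL_apply (h : H) (ψ : Module.Dual ℂ H) (x : H) : actL h ψ x = ψ (h * x) := rfl

lemma commute_actL_actH (h k : H) : Commute (actL h) (actH k) := by
  refine LinearMap.ext fun ψ => LinearMap.ext fun x => ?_
  simp [mul_assoc]

variable (H) in
/-- `h ↦ (ψ ↦ ψ(h'' ? S(h')))`. -/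
def coadK : ConvAlg H (Module.End ℂ (Module.Dual ℂ H)) :=
  toConv (convInv actH) * toConv actL

lemma mem_SLF_iff_coadK (ψ : Module.Dual ℂ H) :
    ψ ∈ SLF H ↔ ∀ h, coadK H h ψ = counit (R := ℂ) h • ψ := by
  have key : ∀ (F G G' : ConvAlg H (Module.End ℂ (Module.Dual ℂ H))),
      (∀ h, G h ψ = G' h ψ) → ∀ h, (F * G) h ψ = (F * G') h ψ := by
    intro F G G' hG h
    rw [convAlg_mul_apply, convAlg_mul_apply]
    induction (comul h : H ⊗[ℂ] H) with
    | zero => simp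
    | tmul x y => simp [hG]
    | add x y hx hy => simp only [map_add, LinearMap.add_apply, hx, hy]
  have h1 : ∀ h, (1 : ConvAlg H (Module.End ℂ (Module.Dual ℂ H))) h ψ =
      counit (R := ℂ) h • ψ := fun h => rfl
  constructor
  · intro hψ h
    rw [coadK, key (toConv (convInv actH)) (toConv actL) (toConv actH.toLinearMap)
      (fun k => LinearMap.ext fun x => hψ k x), convInv_mul_toConv, h1]
  · intro hψ x y
    have h2 := key (toConv actH.toLinearMap) (coadK H) 1 (fun h => (hψ h).trans (h1 h).symm) x
    rw [coadK, ← mul_assoc, toConv_mul_convInv, one_mul, mul_one] at h2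
    exact congrArg (fun χ : Module.Dual ℂ H => χ y) h2

/-- Postcomposition with a morphism of algebras. -/
def convMap (H : Type*) [Ring H] [HopfAlgebra ℂ H] {A B : Type*} [Ring A] [Algebra ℂ A] [Ring B]
    [Algebra ℂ B] (g : A →ₐ[ℂ] B) : ConvAlg H A →ₐ[ℂ] ConvAlg H B :=
  AlgHom.ofLinearMap
    { toFun := fun F => toConv (g.toLinearMap ∘ₗ F.ofConv)
      map_add' := fun F G => by ext; simp
      map_smul' := fun c F => by ext; simp }
    (convAlg_ext fun h => g.commutes _)
    (fun F G => WithConv.ext (LinearMap.algHom_comp_convMul_distrib g F G))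

lemma convMap_apply {A B : Type*} [Ring A] [Algebra ℂ A] [Ring B]
    [Algebra ℂ B] (g : A →ₐ[ℂ] B) (F : ConvAlg H A) (h : H) : convMap H g F h = g (F h) := rfl

/-- `(φ ψ)(h ?) = φ(h' ?) ψ(h'' ?)`. -/
lemma actL_mul_actO (h : H) (φ : Module.Dual ℂ H) (L : H →ₗ[ℂ] Module.Dual ℂ H)
    (hL : ∀ k x, L k x = φ (k * x)) :
    actL h * actO φ = legs (actO ∘ₗ L) actL (comul h) := by
  refine LinearMap.ext fun ψ => LinearMap.ext fun x => ?_
  have h1 : ∀ (y z : H) (X : H ⊗[ℂ] H), legs φ ψ ((y ⊗ₜ z) * X) =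
      legs (L y) (ψ ∘ₗ LinearMap.mulLeft ℂ z) X := by
    intro y z X
    induction X with
    | zero => simp
    | tmul a b => simp [hL]
    | add a b ha hb => rw [mul_add, map_add, map_add, ha, hb]
  have h2 : ∀ Y : H ⊗[ℂ] H, legs φ ψ (Y * comul x) = legs (actO ∘ₗ L) actL Y ψ x := by
    intro Y
    induction Y with
    | zero => simp
    | tmul y z => rw [h1]; rfl
    | add a b ha hb => rw [add_mul, map_add, map_add, ha, hb]; rfl
  rw [← h2, ← Bialgebra.comul_mul]
  rfl

section

variable {n : Type} [Fintype n] [DecidableEq n]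

/-- `actL` as scalar matrices. -/
abbrev linL (H : Type*) [Ring H] [HopfAlgebra ℂ H] (n : Type) [Fintype n] [DecidableEq n] :
    H →ₗ[ℂ] Matrix n n (Module.End ℂ (Module.Dual ℂ H)) :=
  (Matrix.scalarAlgHom n ℂ).toLinearMap ∘ₗ actL

/-- `l(h) T = ρ(h') T l(h'')`. -/
lemma linL_mul_coeffMatrix (ρ : H →ₐ[ℂ] Matrix n n ℂ) :
    toConv (linL H n) * cst H _ (coeffMatrix actO ρ) =
      toConv ((scal _ n).comp ρ).toLinearMap * cst H _ (coeffMatrix actO ρ) *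
        toConv (linL H n) := by
  refine convAlg_ext fun h => ?_
  have h1 : toConv ((scal _ n).comp ρ).toLinearMap * cst H _ (coeffMatrix actO ρ) =
      toConv (LinearMap.mulRight ℂ (coeffMatrix actO ρ) ∘ₗ ((scal _ n).comp ρ).toLinearMap) :=
    convAlg_ext fun x => mul_cst_apply _ _ _
  rw [h1, mul_cst_apply, convAlg_mul_apply]
  ext1 i j
  have h2 := actL_mul_actO h (coeff ρ i j)
    { toFun := fun k => coeff ρ i j ∘ₗ LinearMap.mulLeft ℂ k
      map_add' := fun x y => by ext; simp [add_mul]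
      map_smul' := fun c x => by ext; simp } (fun k x => rfl)
  have h3 : (linL H n h * coeffMatrix actO ρ) i j = actL h * actO (coeff ρ i j) := by
    simp [coeffMatrix, Matrix.diagonal_mul]
  refine h3.trans (h2.trans ?_)
  induction (comul h : H ⊗[ℂ] H) with
  | zero => simp
  | tmul x y =>
    have hc : coeff ρ i j ∘ₗ LinearMap.mulLeft ℂ x = ∑ u, ρ x i u • coeff ρ u j := by
      ext z
      simp [Matrix.mul_apply]
    simp only [legs_tmul, LinearMap.comp_apply, LinearMap.coe_mk, AddHom.coe_mk, hc, map_sum,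
      map_smul]
    simp [Matrix.mul_apply, scal, coeffMatrix, Algebra.ofId_apply, Matrix.diagonal_apply,
      Algebra.algebraMap_eq_smul_one]
  | add x y hx hy => rw [map_add, map_add, hx, hy]; rfl

lemma matConv_scalar {Q : Type*} [Ring Q] [Algebra ℂ Q] (F : ConvAlg H Q) :
    matConv H Q n (Matrix.scalarAlgHom n ℂ F) =
      toConv ((Matrix.scalarAlgHom n ℂ).toLinearMap ∘ₗ F.ofConv) := by
  refine convAlg_ext fun h => ?_
  ext i j
  by_cases hij : i = j
  · subst hij; simp
  · simp [hij]

lemma matConv_coadK : matConv H _ n (Matrix.scalarAlgHom n ℂ (coadK H)) =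
    toConv (convInv (homE H n)) * toConv (linL H n) := by
  rw [coadK, map_mul, map_mul, matConv_scalar, matConv_scalar]
  rfl

lemma matConv_cst {Q : Type*} [Ring Q] [Algebra ℂ Q] (f : Module.Dual ℂ H →ₗ[ℂ] Q)
    (ρ : H →ₐ[ℂ] Matrix n n ℂ) :
    matConv H Q n (coeffMatrix ((cst H Q).toLinearMap ∘ₗ f) ρ) = cst H _ (coeffMatrix f ρ) :=
  rfl

/-- Every linear form is a linear combination of matrix coefficients. -/
lemma span_coeff [FiniteDimensional ℂ H] {V : Type*} [AddCommGroup V] [Module ℂ V]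
    (f g : Module.Dual ℂ H →ₗ[ℂ] V)
    (h : ∀ (n : ℕ) (ρ : H →ₐ[ℂ] Matrix (Fin n) (Fin n) ℂ) (i j : Fin n),
      f (coeff ρ i j) = g (coeff ρ i j)) : f = g := by
  refine LinearMap.ext fun φ => ?_
  let b := Module.finBasis ℂ H
  have hφ : φ = ∑ i, ∑ j, (φ (b i) * b.repr 1 j) • coeff (Algebra.leftMulMatrix b) i j := by
    refine LinearMap.ext fun x => ?_
    have h1 : φ (x * 1) = ∑ j, b.repr 1 j * φ (x * b j) := by
      conv_lhs => rw [← b.sum_repr 1]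
      simp only [Finset.mul_sum, mul_smul_comm, map_sum, map_smul, smul_eq_mul]
    have h2 : ∀ j, φ (x * b j) = ∑ i, b.repr (x * b j) i * φ (b i) := by
      intro j
      conv_lhs => rw [← b.sum_repr (x * b j)]
      simp only [map_sum, map_smul, smul_eq_mul]
    rw [mul_one] at h1
    rw [h1]
    simp only [h2, Finset.mul_sum, LinearMap.sum_apply, LinearMap.smul_apply, coeff_apply,
      Algebra.leftMulMatrix_eq_repr_mul, smul_eq_mul]
    rw [Finset.sum_comm]
    exact Finset.sum_congr rfl fun _ _ => Finset.sum_congr rfl fun _ _ => by ring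
  rw [hφ]
  simp only [map_sum, map_smul, h]

end

lemma handle_induction {R : UniversalRMatrix H} (S : Subalgebra ℂ (HandleAlgebra R))
    (hB : ∀ φ, handleB R φ ∈ S) (hA : ∀ φ, handleA R φ ∈ S) (x : HandleAlgebra R) : x ∈ S := by
  obtain ⟨y, rfl⟩ := RingQuot.mkAlgHom_surjective ℂ (HandleRel R) x
  induction y using TensorAlgebra.induction with
  | algebraMap r => rw [AlgHom.commutes]; exact S.algebraMap_mem r
  | ι a =>
    have : TensorAlgebra.ι ℂ a = preB a.1 + preA a.2 := by
      simp [preA, preB, ← map_add]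
    rw [this, map_add]
    exact S.add_mem (hB a.1) (hA a.2)
  | mul a b ha hb => rw [map_mul]; exact S.mul_mem ha hb
  | add a b ha hb => rw [map_add]; exact S.add_mem ha hb

section Intertwine

variable {Q : Type*} [Ring Q]

lemma intertwineA_aux {p p' r r' l U V : Q} (hp : p * p' = 1) (hr : r * r' = 1) (hr' : r' * r = 1)
    (hU : U * (p * r) = r * p * U) (hV : V * (r * p) = p * r * V) (lU : l * U = U * l)
    (lV : l * V = V * l) :
    p * (U * V) * p' * (r' * l) = r' * l * (U * V) := by
  calc p * (U * V) * p' * (r' * l) = r' * (r * p * U) * V * p' * (r' * l) := by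
        rw [← one_mul (p * (U * V) * p' * (r' * l)), ← hr']; noncomm_ring
    _ = r' * U * (p * r * V) * p' * (r' * l) := by rw [← hU]; noncomm_ring
    _ = r' * U * V * r * (p * p') * r' * l := by rw [← hV]; noncomm_ring
    _ = r' * U * V * (r * r') * l := by rw [hp]; noncomm_ring
    _ = r' * U * (V * l) := by rw [hr]; noncomm_ring
    _ = r' * (U * l) * V := by rw [← lV]; noncomm_ring
    _ = r' * l * (U * V) := by rw [← lU]; noncomm_ring

lemma intertwineB_aux {p p' r r' l U V T : Q} (hp : p * p' = 1) (hr : r * r' = 1)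
    (hr' : r' * r = 1)
    (hU : U * (p * r) = r * p * U) (hV : V * (r * p) = p * r * V) (lU : l * U = U * l)
    (lV : l * V = V * l) (hT : r * T = T * (p * r)) (lT : l * T = p * T * l) :
    p * (U * T * V) * p' * (r' * l) = r' * l * (U * T * V) := by
  calc p * (U * T * V) * p' * (r' * l) = r' * (r * p * U) * T * V * p' * (r' * l) := by
        rw [← one_mul (p * (U * T * V) * p' * (r' * l)), ← hr']; noncomm_ring
    _ = r' * U * p * (r * T) * V * p' * (r' * l) := by rw [← hU]; noncomm_ring
    _ = r' * U * p * T * (p * r * V) * p' * (r' * l) := by rw [hT]; noncomm_ring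
    _ = r' * U * p * T * V * r * (p * p') * r' * l := by rw [← hV]; noncomm_ring
    _ = r' * U * p * T * V * (r * r') * l := by rw [hp]; noncomm_ring
    _ = r' * U * p * T * (V * l) := by rw [hr]; noncomm_ring
    _ = r' * U * (p * T * l) * V := by rw [← lV]; noncomm_ring
    _ = r' * (U * l) * T * V := by rw [← lT]; noncomm_ring
    _ = r' * l * (U * T * V) := by rw [← lU]; noncomm_ring

variable (R : UniversalRMatrix H) [FiniteDimensional ℂ H]

lemma adConv_mul_coadK_of {n : Type} [Fintype n] [DecidableEq n] (ρ : H →ₐ[ℂ] Matrix n n ℂ)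
    (f : Module.Dual ℂ H →ₗ[ℂ] Module.End ℂ (Module.Dual ℂ H))
    (hf : toConv ((scal _ n).comp ρ).toLinearMap * cst H _ (coeffMatrix f ρ) *
        toConv (convInv ((scal _ n).comp ρ)) *
          (toConv (convInv (homE H n)) * toConv (linL H n)) =
        toConv (convInv (homE H n)) * toConv (linL H n) * cst H _ (coeffMatrix f ρ))
    (i j : n) :
    adConv f (coeff ρ i j) * coadK H = coadK H * cst H _ (f (coeff ρ i j)) := by
  rw [← matConv_adConv, ← matConv_coadK, ← matConv_cst, ← map_mul, ← map_mul] at hf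
  have h1 := congrFun (congrFun (matConv_injective hf) i) j
  have h2 : ∀ (M : Matrix n n (ConvAlg H (Module.End ℂ (Module.Dual ℂ H)))) (k),
      (M * Matrix.scalarAlgHom n ℂ k) i j = M i j * k := fun M k => by
    exact (Matrix.mul_diagonal (fun _ => k) M i j)
  have h3 : ∀ (M : Matrix n n (ConvAlg H (Module.End ℂ (Module.Dual ℂ H)))) (k),
      (Matrix.scalarAlgHom n ℂ k * M) i j = k * M i j := fun M k => by
    exact (Matrix.diagonal_mul (fun _ => k) M i j)
  rw [h2, h3] at h1
  exact h1

lemma intertwine_conv {Q : Type*} [Ring Q] [Algebra ℂ Q] (p r : H →ₐ[ℂ] Q) (l : H →ₗ[ℂ] Q)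
    (hpr : ∀ x y, Commute (p x) (r y)) (cp : ∀ x y, Commute (l x) (p y))
    (cr : ∀ x y, Commute (l x) (r y)) (T : Q)
    (hT : ∀ h, r h * T = T * conv p.toLinearMap r.toLinearMap h)
    (lT : toConv l * cst H Q T = toConv p.toLinearMap * cst H Q T * toConv l) :
    (toConv p.toLinearMap * cst H _ (legs p.toLinearMap r.toLinearMap R.R * T *
        legs r.toLinearMap p.toLinearMap R.R) * toConv (convInv p) *
          (toConv (convInv r) * toConv l) =
        toConv (convInv r) * toConv l * cst H _ (legs p.toLinearMap r.toLinearMap R.R * T *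
        legs r.toLinearMap p.toLinearMap R.R)) ∧
    (toConv p.toLinearMap * cst H _ (legs p.toLinearMap r.toLinearMap R.R *
        legs r.toLinearMap p.toLinearMap R.R) * toConv (convInv p) *
          (toConv (convInv r) * toConv l) =
        toConv (convInv r) * toConv l * cst H _ (legs p.toLinearMap r.toLinearMap R.R *
        legs r.toLinearMap p.toLinearMap R.R)) := by
  have hU := conv_legs R p r hpr
  have hV := conv_legs R r p fun x y => (hpr y x).symm
  have lU := commute_cst (toConv l) _ fun x =>
    commute_legs p.toLinearMap r.toLinearMap (l x) (cp x) (cr x) (R.R : H ⊗[ℂ] H)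
  have lV := commute_cst (toConv l) _ fun x =>
    commute_legs r.toLinearMap p.toLinearMap (l x) (cr x) (cp x) (R.R : H ⊗[ℂ] H)
  have hT' : toConv r.toLinearMap * cst H _ T =
      cst H _ T * (toConv p.toLinearMap * toConv r.toLinearMap) := convAlg_ext fun h => by
    rw [mul_cst_apply, cst_mul_apply]
    exact hT h
  refine ⟨?_, ?_⟩
  · rw [map_mul, map_mul]
    exact intertwineB_aux (toConv_mul_convInv p) (toConv_mul_convInv r) (convInv_mul_toConv r)
      hU hV lU lV hT' lT
  · rw [map_mul]
    exact intertwineA_aux (toConv_mul_convInv p) (toConv_mul_convInv r) (convInv_mul_toConv r)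
      hU hV lU lV

lemma adConv_mul_coadK {n : Type} [Fintype n] [DecidableEq n] (ρ : H →ₐ[ℂ] Matrix n n ℂ)
    (i j : n) :
    adConv (actB R) (coeff ρ i j) * coadK H = coadK H * cst H _ (actB R (coeff ρ i j)) ∧
    adConv (actA R) (coeff ρ i j) * coadK H = coadK H * cst H _ (actA R (coeff ρ i j)) := by
  have key := intertwine_conv R ((scal (Module.End ℂ (Module.Dual ℂ H)) n).comp ρ) (homE H n)
    (linL H n) (fun x y => commute_scal_homE _ _) (fun x y => (commute_scal_scalar _ _).symm)
    (fun x y => (commute_actL_actH x y).map (Matrix.scalarAlgHom n ℂ)) (coeffMatrix actO ρ)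
    (homE_mul_coeffMatrix ρ) (linL_mul_coeffMatrix ρ)
  rw [← coeffMatrix_actB, ← coeffMatrix_actA] at key
  exact ⟨adConv_mul_coadK_of _ _ key.1 _ _, adConv_mul_coadK_of _ _ key.2 _ _⟩

/-- The representation `▷` intertwines the action of `H` on the handle algebra
with the coadjoint action on `H*`. -/
lemma handleRep_intertwine (x : HandleAlgebra R) :
    convMap H (handleRep R) (handleAction R x) * coadK H = coadK H * cst H _ (handleRep R x) := by
  let S : Subalgebra ℂ (HandleAlgebra R) :=
    { carrier := {x | convMap H (handleRep R) (handleAction R x) * coadK H =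
        coadK H * cst H _ (handleRep R x)}
      mul_mem' := fun {x y} hx hy => by
        simp only [Set.mem_ofPred_eq, map_mul] at hx hy ⊢
        rw [mul_assoc, hy, ← mul_assoc, hx, mul_assoc]
      add_mem' := fun {x y} hx hy => by
        simp only [Set.mem_ofPred_eq, map_add] at hx hy ⊢
        rw [add_mul, mul_add, hx, hy]
      algebraMap_mem' := fun r => by
        simp only [Set.mem_ofPred_eq, AlgHom.commutes]
        exact Algebra.commutes _ _ }
  refine handle_induction S (fun φ => ?_) (fun φ => ?_) x
  · have key := span_coeff
      ((LinearMap.mulRight ℂ (coadK H)) ∘ₗ adConv (actB R))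
      ((LinearMap.mulLeft ℂ (coadK H)) ∘ₗ (cst H _).toLinearMap ∘ₗ actB R)
      fun n ρ i j => (adConv_mul_coadK R ρ i j).1
    have h1 : convMap H (handleRep R) (handleAction R (handleB R φ)) = adConv (actB R) φ := by
      refine convAlg_ext fun h => ?_
      rw [handleAction, handleLift_handleB, convMap_apply, adConv_apply, adConv_apply, handleRep,
        handleLift_handleB]
    change _ * _ = _ * _
    rw [h1, handleRep, handleLift_handleB]
    exact congrArg (fun F => F φ) key
  · have key := span_coeff
      ((LinearMap.mulRight ℂ (coadK H)) ∘ₗ adConv (actA R))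
      ((LinearMap.mulLeft ℂ (coadK H)) ∘ₗ (cst H _).toLinearMap ∘ₗ actA R)
      fun n ρ i j => (adConv_mul_coadK R ρ i j).2
    have h1 : convMap H (handleRep R) (handleAction R (handleA R φ)) = adConv (actA R) φ := by
      refine convAlg_ext fun h => ?_
      rw [handleAction, handleLift_handleA, convMap_apply, adConv_apply, adConv_apply, handleRep,
        handleLift_handleA]
    change _ * _ = _ * _
    rw [h1, handleRep, handleLift_handleA]
    exact congrArg (fun F => F φ) key

/-- The invariants preserve the subspace `SLF(H)` of `H*`. -/
lemma handleRep_mem_SLF {x : HandleAlgebra R} (hx : x ∈ invariants R) {ψ : Module.Dual ℂ H}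
    (hψ : ψ ∈ SLF H) : handleRep R x ψ ∈ SLF H := by
  rw [mem_SLF_iff_coadK] at hψ ⊢
  intro h
  have h1 := congrArg (fun F => F h ψ) (handleRep_intertwine R x)
  have h2 : handleAction R x = cst H _ x := hx
  have h3 : convMap H (handleRep R) (cst H _ x) = cst H _ (handleRep R x) :=
    convAlg_ext fun h => by simp [convMap_apply]
  simp only [h2, h3, mul_cst_apply, cst_mul_apply, Module.End.mul_apply, hψ] at h1
  rw [← h1, map_smul]

/-- The representation `ρ_SLF` of the algebra of invariants on `SLF(H)`, obtained by
restricting `▷`. -/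
def rhoSLF : invariants R →ₐ[ℂ] Module.End ℂ (SLF H) where
  toFun x := (handleRep R x).restrict fun _ hψ => handleRep_mem_SLF R x.2 hψ
  map_one' := by ext; simp
  map_mul' x y := by ext; simp
  map_zero' := by ext; simp
  map_add' x y := by ext; simp
  commutes' c := by ext; simp [Algebra.algebraMap_eq_smul_one]

lemma rhoSLF_apply (x : invariants R) (ψ : SLF H) :
    (rhoSLF R x ψ : Module.Dual ℂ H) = handleRep R x ψ := rfl

end Intertwine

end SymmetricForms

/-! ### Elements of `H` in the loop algebra and in the handle algebra -/

section Central

open WithConv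

variable {H : Type*} [Ring H] [HopfAlgebra ℂ H] (R : UniversalRMatrix H)

lemma actH_injective : Function.Injective (actH : H →ₐ[ℂ] Module.End ℂ (Module.Dual ℂ H)) := by
  intro x y hxy
  rw [← sub_eq_zero, ← Module.forall_dual_apply_eq_zero_iff ℂ]
  intro φ
  have := congrArg (fun f => f φ 1) hxy
  simpa [sub_eq_zero] using this

lemma actA_eq [FiniteDimensional ℂ H] :
    actA R = actH.toLinearMap ∘ₗ R.drinfeldMap := by
  refine LinearMap.ext fun φ => ?_
  simp only [actA, UniversalRMatrix.drinfeldMap, contractWith_apply, LinearMap.comp_apply]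
  induction ((R.R : H ⊗[ℂ] H) * R.R') with
  | zero => simp
  | tmul x y => simp [inE]
  | add x y hx hy => simp only [map_add, hx, hy]

lemma isLoop_drinfeldMap [FiniteDimensional ℂ H] : IsLoop R R.drinfeldMap := by
  have h := (isHandle_act R).isLoopA
  rw [actA_eq] at h
  refine ⟨actH_injective (by simpa using h.unit), fun {ι κ} _ _ _ _ I J => ?_⟩
  have h1 := h.fusion I J
  rw [← map_coeffMatrix, ← map_fusionRHS] at h1
  ext s t
  exact actH_injective (congrFun (congrFun h1 s) t)

/-- The morphism of algebras `𝓛₀₁(H) → H`, `M ↦ (T ⊗ id)(R R')`. If `H` is factorizable, it is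
an isomorphism, by which `𝓛₀₁(H)` and `H` are identified. -/
def loopToH [FiniteDimensional ℂ H] : LoopAlgebra R →ₐ[ℂ] H :=
  loopLift R.drinfeldMap (isLoop_drinfeldMap R)

variable {R}

/-- An element of the factorizable Hopf algebra `H`, viewed as an element of `𝓛₀₁(H)`. -/
def loopOfH (hR : R.IsFactorizable) (x : H) : LoopAlgebra R :=
  loopM R ((LinearEquiv.ofBijective R.drinfeldMap hR).symm x)

@[simp] lemma loopToH_loopOfH [FiniteDimensional ℂ H] (hR : R.IsFactorizable) (x : H) :
    loopToH R (loopOfH hR x) = x := by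
  rw [loopToH, loopOfH, loopLift_loopM]
  exact (LinearEquiv.ofBijective R.drinfeldMap hR).apply_symm_apply x

/-- `x_A = j_A(x)` for `x ∈ H = 𝓛₀₁(H)`. -/
def elemA (hR : R.IsFactorizable) (x : H) : HandleAlgebra R := jA R (loopOfH hR x)

/-- `x_B = j_B(x)` for `x ∈ H = 𝓛₀₁(H)`. -/
def elemB (hR : R.IsFactorizable) (x : H) : HandleAlgebra R := jB R (loopOfH hR x)

variable (R)

/-- `(h' ⊗ 1) R R' (S(h'') ⊗ 1) = (1 ⊗ S(h')) R R' (1 ⊗ h'')`. -/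
lemma conv_RR' {Q : Type*} [Ring Q] [Algebra ℂ Q] (p q : H →ₐ[ℂ] Q)
    (hpq : ∀ x y, Commute (p x) (q y)) :
    toConv p.toLinearMap *
        cst H Q (legs p.toLinearMap q.toLinearMap ((R.R : H ⊗[ℂ] H) * R.R')) *
        toConv (convInv p) =
      toConv (convInv q) *
        cst H Q (legs p.toLinearMap q.toLinearMap ((R.R : H ⊗[ℂ] H) * R.R')) *
        toConv q.toLinearMap := by
  have hU := conv_legs R p q hpq
  have hV := conv_legs R q p fun x y => (hpq y x).symm
  have hp := toConv_mul_convInv p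
  have hq := toConv_mul_convInv q
  have hq' := convInv_mul_toConv q
  rw [legs_mul p q hpq, legs_R' R p q hpq, map_mul]
  generalize cst H Q (legs p.toLinearMap q.toLinearMap (R.R : H ⊗[ℂ] H)) = U at *
  generalize cst H Q (legs q.toLinearMap p.toLinearMap (R.R : H ⊗[ℂ] H)) = V at *
  generalize toConv p.toLinearMap = P at *
  generalize toConv q.toLinearMap = S at *
  generalize toConv (convInv p) = P' at *
  generalize toConv (convInv q) = S' at *
  calc P * (U * V) * P' = (S' * S) * (P * (U * V) * P') := by rw [hq', one_mul]
    _ = S' * (S * P * U) * V * P' := by noncomm_ring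
    _ = S' * U * (P * S * V) * P' := by rw [← hU]; noncomm_ring
    _ = S' * (U * V) * S * (P * P') := by rw [← hV]; noncomm_ring
    _ = S' * (U * V) * S := by rw [hp, mul_one]

lemma legs_include (X : H ⊗[ℂ] H) :
    legs (Algebra.TensorProduct.includeLeft : H →ₐ[ℂ] H ⊗[ℂ] H).toLinearMap
      (Algebra.TensorProduct.includeRight : H →ₐ[ℂ] H ⊗[ℂ] H).toLinearMap X = X := by
  induction X with
  | zero => simp
  | tmul x y => simp
  | add x y hx hy => rw [map_add, hx, hy]

lemma drinfeldMap_adj (φ : Module.Dual ℂ H) (h : H) :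
    R.drinfeldMap (φ ∘ₗ adj h) =
      legs (LinearMap.mulRight ℂ (R.drinfeldMap φ) ∘ₗ antipode ℂ) LinearMap.id (comul h) := by
  set i₁ : H →ₐ[ℂ] H ⊗[ℂ] H := Algebra.TensorProduct.includeLeft
  set i₂ : H →ₐ[ℂ] H ⊗[ℂ] H := Algebra.TensorProduct.includeRight
  set X := (R.R : H ⊗[ℂ] H) * R.R' with hX
  have key := conv_RR' R i₁ i₂ fun x y => by
    simp [i₁, i₂, Commute, SemiconjBy]
  rw [legs_include, ← hX] at key
  have h1 : toConv i₁.toLinearMap * cst H _ X =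
      toConv (LinearMap.mulRight ℂ X ∘ₗ i₁.toLinearMap) :=
    convAlg_ext fun x => mul_cst_apply _ _ _
  have h2 : toConv (convInv i₂) * cst H _ X =
      toConv (LinearMap.mulRight ℂ X ∘ₗ convInv i₂) :=
    convAlg_ext fun x => mul_cst_apply _ _ _
  rw [h1, h2] at key
  have key' := congrArg (fun F => contract φ (F h)) key
  simp only [convAlg_mul_apply] at key'
  have e1 : ∀ Y : H ⊗[ℂ] H, contract φ (legs (LinearMap.mulRight ℂ X ∘ₗ i₁.toLinearMap)
      (convInv i₁) Y) = contract (φ ∘ₗ legs (LinearMap.mul ℂ H)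
        ((LinearMap.mul ℂ H).flip ∘ₗ antipode ℂ) Y) X := by
    intro Y
    induction Y with
    | zero => simp [contract]
    | tmul x y =>
      induction X with
      | zero => simp
      | tmul a b => simp [i₁, mul_assoc]
      | add a b ha hb => simp only [map_add, ← ha, ← hb]; simp [mul_add, add_mul]
    | add x y hx hy => rw [map_add, map_add, map_add, hx, hy]; simp [contract, LinearMap.comp_add]
  have e2 : ∀ Y : H ⊗[ℂ] H, contract φ (legs (LinearMap.mulRight ℂ X ∘ₗ convInv i₂)
      i₂.toLinearMap Y) = legs (LinearMap.mulRight ℂ (contract φ X) ∘ₗ antipode ℂ)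
        LinearMap.id Y := by
    intro Y
    induction Y with
    | zero => simp
    | tmul x y =>
      induction X with
      | zero => simp
      | tmul a b => simp [i₂, mul_assoc]
      | add a b ha hb =>
        simp only [legs_tmul, LinearMap.comp_apply, LinearMap.mulRight_apply, map_add, mul_add,
          add_mul] at ha hb ⊢
        rw [ha, hb]
    | add x y hx hy => rw [map_add, map_add, map_add, hx, hy]
  refine (e1 (comul h)).symm.trans (key'.trans ?_)
  exact e2 (comul h)

variable {R}

lemma adj_of_central (hR : R.IsFactorizable) {z : H} (hz : ∀ x, z * x = x * z)
    (φ : Module.Dual ℂ H) (hφ : R.drinfeldMap φ = z) (h : H) :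
    φ ∘ₗ adj h = counit (R := ℂ) h • φ := by
  refine hR.1 ?_
  rw [drinfeldMap_adj, map_smul, hφ]
  have h1 : ∀ Y : H ⊗[ℂ] H, legs (LinearMap.mulRight ℂ z ∘ₗ antipode ℂ) LinearMap.id Y =
      z * legs (antipode ℂ) LinearMap.id Y := by
    intro Y
    induction Y with
    | zero => simp
    | tmul x y => simp [← hz, mul_assoc]
    | add x y hx hy => rw [map_add, map_add, mul_add, hx, hy]
  have h2 : legs (antipode ℂ) LinearMap.id (comul h) = algebraMap ℂ H (counit h) :=
    congrArg (fun F : ConvAlg H H => F h) LinearMap.antipode_mul_id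
  rw [h1, h2, Algebra.smul_def, Algebra.commutes]

lemma elemA_mem_invariants (hR : R.IsFactorizable) {z : H} (hz : ∀ x, z * x = x * z) :
    elemA hR z ∈ invariants R := by
  rw [mem_invariants]
  intro h
  rw [elemA, loopOfH, jA, loopLift_loopM, handleAction, handleLift_handleA, adConv_apply,
    adj_of_central hR hz _ ((LinearEquiv.ofBijective R.drinfeldMap hR).apply_symm_apply z) h,
    map_smul]

lemma elemB_mem_invariants (hR : R.IsFactorizable) {z : H} (hz : ∀ x, z * x = x * z) :
    elemB hR z ∈ invariants R := by
  rw [mem_invariants]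
  intro h
  rw [elemB, loopOfH, jB, loopLift_loopM, handleAction, handleLift_handleB, adConv_apply,
    adj_of_central hR hz _ ((LinearEquiv.ofBijective R.drinfeldMap hR).apply_symm_apply z) h,
    map_smul]

lemma RibbonElement.inv_central (v : RibbonElement R) (x : H) :
    (↑v.v⁻¹ : H) * x = x * ↑v.v⁻¹ :=
  (Commute.units_inv_left (u := v.v) (a := x) (v.central x)).eq

/-- The invariant element `v_A⁻¹`. -/
def ribbonA (hR : R.IsFactorizable) (v : RibbonElement R) : invariants R :=
  ⟨elemA hR ↑v.v⁻¹, elemA_mem_invariants hR v.inv_central⟩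

/-- The invariant element `v_B⁻¹`. -/
def ribbonB (hR : R.IsFactorizable) (v : RibbonElement R) : invariants R :=
  ⟨elemB hR ↑v.v⁻¹, elemB_mem_invariants hR v.inv_central⟩

end Central

/-! ### Projective representations and the mapping class group of the torus -/

section Projective

open scoped MatrixGroups

variable (V : Type*) [AddCommGroup V] [Module ℂ V]

/-- The group of non-zero scalar operators on `V`. -/
def scalarUnits : Subgroup (Module.End ℂ V)ˣ :=
  (Units.map (algebraMap ℂ (Module.End ℂ V)).toMonoidHom).range

instance : (scalarUnits V).Normal where
  conj_mem := by
    rintro _ ⟨c, rfl⟩ g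
    refine ⟨c, Units.ext ?_⟩
    have : (g : Module.End ℂ V) * algebraMap ℂ _ (c : ℂ) = algebraMap ℂ _ (c : ℂ) * g :=
      (Algebra.commutes _ _).symm
    change algebraMap ℂ (Module.End ℂ V) c = g * algebraMap ℂ _ (c : ℂ) * ↑g⁻¹
    rw [this, mul_assoc, Units.mul_inv, mul_one]

/-- The projective linear group `PGL(V)`. A projective representation of a group `G` on `V` is
a morphism of groups `G → PGL(V)`. -/
abbrev PGL : Type _ := (Module.End ℂ V)ˣ ⧸ scalarUnits V

/-- The class in `PGL(V)` of an invertible operator. -/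
def PGL.mk : (Module.End ℂ V)ˣ →* PGL V := QuotientGroup.mk' _

/-- The Dehn twist `τ_a` in `MCG(Σ₁,₀) = SL₂(ℤ)`: it fixes `a` and maps `b` to `b a`. The matrix is
that of its action on the first homology group of the torus, in the basis `(b, -a)`. -/
def tauA : SL(2, ℤ) := ⟨!![1, 0; -1, 1], by simp⟩

/-- The Dehn twist `τ_b` in `MCG(Σ₁,₀) = SL₂(ℤ)`: it maps `a` to `b⁻¹ a` and fixes `b`. The matrix
is that of its action on the first homology group of the torus, in the basis `(b, -a)`. -/
def tauB : SL(2, ℤ) := ⟨!![1, 1; 0, 1], by simp⟩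

end Projective

end

end TorusModular

/-! SL₂(ℤ) is presented by a, b with aba = bab and (ab)⁶ = 1, and adding (ab)³ = 1 presents PSL₂(ℤ)
(`exists_hom_SL2Z`, `exists_hom_PSL2Z`). Since τ_a and τ_b generate, uniqueness is immediate, and
everything reduces to relations, up to scalars, between two operators on SLF(H).

These operators are explicit. Let g = uv⁻¹ be the pivotal element: it is group-like and S² is
conjugation by g. Then χ ↦ χ(? g) turns symmetric forms into forms f with f(hx) = f(x S²(h)), and
the Drinfeld map Ψ sends the latter to the centre. Let φ = Ψ⁻¹(v⁻¹) and σ = φ(? g⁻¹), a symmetric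
form. The element v_A⁻¹ acts by a : ψ ↦ ψ(? v⁻¹). By `actB_eq`, v_B⁻¹ acts by a n a⁻¹, where n : ψ ↦
σψ is invertible because Ψ(βt) = Ψ(β)Ψ(t) when Ψ(t) is central (`drinfeldMap_conv`).

The main fact is `integral`: φ(? v⁻¹) is an integral in H*. With θ = σ(? v⁻¹), it gives the rule
ρ·θ(? x) = ρ(S(x')g) θ(? x'') of `conv_actH_inv`, which moves any factor ρ past θ. Combined with
Δ(v⁻¹) = R'R(v⁻¹ ⊗ v⁻¹) and (Δ ⊗ id)(R'R) = R'₂₃R'₁₃R₁₃R₂₃, it yields the braid relation n a n = a n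
a (`conv_actH_inv_conv`). The same rule shows that a n a is a Fourier transform ψ ↦ θ(? Ψ(ψ(? g)))
(`actH_inv_conv_actH_inv`), whose square is a multiple of ψ ↦ ψ ∘ S (`sq_actH_inv_conv_actH_inv`).

With b = a n a⁻¹ it follows that aba = bab and that (ab)³ = a(ana)²a⁻¹ is a multiple of ψ ↦ ψ ∘ S.
This map squares to the identity on symmetric forms because S² is inner, so (ab)⁶ is a scalar; when
S fixes every symmetric form, (ab)³ already is. -/

namespace TorusModular

/-! ### Presentations of SL₂(ℤ) and PSL₂(ℤ) -/

section Presentation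

open scoped MatrixGroups
open ModularGroup

lemma coe_tauA : (tauA : Matrix (Fin 2) (Fin 2) ℤ) = !![1, 0; -1, 1] := rfl

lemma coe_tauB : (tauB : Matrix (Fin 2) (Fin 2) ℤ) = !![1, 1; 0, 1] := rfl

lemma coe_tauA_inv : (↑(tauA⁻¹) : Matrix (Fin 2) (Fin 2) ℤ) = !![1, 0; 1, 1] := by
  rw [Matrix.SpecialLinearGroup.coe_inv, coe_tauA, Matrix.adjugate_fin_two]
  simp

/-- The usual generators are words in the twists: T is τ_b, and S is the inverse of τ_a τ_b τ_a. -/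
lemma closure_tau : Subgroup.closure {tauA, tauB} = (⊤ : Subgroup SL(2, ℤ)) := by
  rw [eq_top_iff, ← SpecialLinearGroup.SL2Z_generators, Subgroup.closure_le]
  have hA : tauA ∈ Subgroup.closure {tauA, tauB} := Subgroup.subset_closure (by simp)
  have hB : tauB ∈ Subgroup.closure {tauA, tauB} := Subgroup.subset_closure (by simp)
  have hS : S * (tauA * tauB * tauA) = 1 := by
    ext1
    simp [coe_S, coe_tauA, coe_tauB, Matrix.one_fin_two]
  have hT : T = tauB := by
    ext i j
    fin_cases i <;> fin_cases j <;> simp [coe_T, coe_tauB]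
  rintro x (rfl | rfl)
  · rw [eq_inv_of_mul_eq_one_left hS]
    exact inv_mem (mul_mem (mul_mem hA hB) hA)
  · rw [hT]
    exact hB

/-- The positive words in `τ_a⁻¹` and `τ_b` which are the identity matrix are empty. -/
lemma positive_word {G : Type*} [Group G] {P B : SL(2, ℤ) × G} (hP : P.1 = tauA⁻¹)
    (hB : B.1 = tauB) {m : SL(2, ℤ) × G} (hm : m ∈ Submonoid.closure {P, B}) :
    (∀ i j, 0 ≤ m.1 i j) ∧ (m = 1 ∨ 2 < m.1 0 0 + m.1 0 1 + m.1 1 0 + m.1 1 1) := by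
  have hP' : ∀ x : SL(2, ℤ), (x * tauA⁻¹) 0 0 = x 0 0 + x 0 1 ∧ (x * tauA⁻¹) 0 1 = x 0 1 ∧
      (x * tauA⁻¹) 1 0 = x 1 0 + x 1 1 ∧ (x * tauA⁻¹) 1 1 = x 1 1 := fun x => by
    rw [Matrix.SpecialLinearGroup.coe_mul, coe_tauA_inv]
    simp [Matrix.mul_apply, Fin.sum_univ_two]
  have hB' : ∀ x : SL(2, ℤ), (x * tauB) 0 0 = x 0 0 ∧ (x * tauB) 0 1 = x 0 0 + x 0 1 ∧
      (x * tauB) 1 0 = x 1 0 ∧ (x * tauB) 1 1 = x 1 0 + x 1 1 := fun x => by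
    rw [Matrix.SpecialLinearGroup.coe_mul, coe_tauB]
    simp [Matrix.mul_apply, Fin.sum_univ_two]
  induction hm using Submonoid.closure_induction_right with
  | one => exact ⟨fun i j => by fin_cases i <;> fin_cases j <;> simp, Or.inl rfl⟩
  | mul_right x hx y hy ih =>
    obtain ⟨h0, h1⟩ := ih
    -- The identity has entry sum exactly 2; any further letter must push the sum strictly above it.
    have h2 : 2 ≤ x.1 0 0 + x.1 0 1 + x.1 1 0 + x.1 1 1 := by
      rcases h1 with rfl | h1
      · simp
      · exact h1.le
    have hdet : x.1 0 0 * x.1 1 1 - x.1 0 1 * x.1 1 0 = 1 := by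
      rw [← Matrix.det_fin_two, x.1.det_coe]
    have e := h0 0 0
    have e1 := h0 0 1
    have e2 := h0 1 0
    have e3 := h0 1 1
    -- Right multiplication by a letter adds one column to the other, so the entry sum grows by a
    -- column sum. A nonnegative column with zero sum would make the determinant vanish.
    have c0 : 0 < x.1 0 0 + x.1 1 0 := by
      by_contra hc
      have h00 : x.1 0 0 = 0 := by omega
      have h10 : x.1 1 0 = 0 := by omega
      simp [h00, h10] at hdet
    have c1 : 0 < x.1 0 1 + x.1 1 1 := by
      by_contra hc
      have h00 : x.1 0 1 = 0 := by omega
      have h10 : x.1 1 1 = 0 := by omega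
      simp [h00, h10] at hdet
    rcases hy with rfl | rfl
    · obtain ⟨q0, q1, q2, q3⟩ := hP' x.1
      rw [Prod.fst_mul, hP]
      refine ⟨fun i j => ?_, Or.inr ?_⟩
      · fin_cases i <;> fin_cases j <;> simp only [Fin.zero_eta, Fin.mk_one] <;> omega
      · omega
    · obtain ⟨q0, q1, q2, q3⟩ := hB' x.1
      rw [Prod.fst_mul, hB]
      refine ⟨fun i j => ?_, Or.inr ?_⟩
      · fin_cases i <;> fin_cases j <;> simp only [Fin.zero_eta, Fin.mk_one] <;> omega
      · omega

/-- Normal form in a group generated by two elements `P⁻¹` and `B` with the braid relation. -/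
lemma braid_normalForm {K : Type*} [Group K] {P B s : K} (hs : s = P⁻¹ * B * P⁻¹)
    (hs' : s = B * P⁻¹ * B) {x : K} (hx : x ∈ Subgroup.closure {P⁻¹, B}) :
    ∃ i j : ℤ, ∃ m ∈ Submonoid.closure {P, B}, x = s ^ i * m * s ^ j := by
  have hPm : P ∈ Submonoid.closure {P, B} := Submonoid.subset_closure (by simp)
  have hBm : B ∈ Submonoid.closure {P, B} := Submonoid.subset_closure (by simp)
  have sP : s * P * s⁻¹ = B⁻¹ := by
    have h : s * P = B⁻¹ * s := by
      rw [hs', ← mul_assoc, ← mul_assoc, inv_mul_cancel, one_mul, ← hs', hs]; group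
    rw [h, mul_inv_cancel_right]
  have sB : s * B * s⁻¹ = P⁻¹ := by
    have h : s * B = P⁻¹ * s := by
      rw [hs, mul_assoc (P⁻¹ * B), mul_assoc P⁻¹ B, ← mul_assoc B, ← hs', ← hs]
    rw [h, mul_inv_cancel_right]
  have conj1 : ∀ {y : K}, (s * y⁻¹ * s⁻¹) = (s * y * s⁻¹)⁻¹ := fun {y} => by group
  have sP' : s * P⁻¹ * s⁻¹ = B := by rw [conj1, sP, inv_inv]
  have sB' : s * B⁻¹ * s⁻¹ = P := by rw [conj1, sB, inv_inv]
  have aux : ∀ {z z' : K}, s * z * s⁻¹ = z' → s⁻¹ * z' * s = z := fun {z z'} h => by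
    rw [← h]; group
  -- Conjugation by s exchanges P with B⁻¹ and B with P⁻¹, hence permutes these four letters. A
  -- letter can therefore be carried leftwards across a power of s.
  let gen : Set K := {P, B, P⁻¹, B⁻¹}
  have hgen : ∀ y ∈ gen, s * y * s⁻¹ ∈ gen ∧ s⁻¹ * y * s ∈ gen := by
    rintro y (rfl | rfl | rfl | rfl)
    · exact ⟨by rw [sP]; simp [gen], by rw [aux sB']; simp [gen]⟩
    · exact ⟨by rw [sB]; simp [gen], by rw [aux sP']; simp [gen]⟩
    · exact ⟨by rw [sP']; simp [gen], by rw [aux sB]; simp [gen]⟩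
    · exact ⟨by rw [sB']; simp [gen], by rw [aux sP]; simp [gen]⟩
  have hpow : ∀ j : ℤ, ∀ y ∈ gen, s ^ j * y * s ^ (-j) ∈ gen := by
    intro j
    induction j with
    | zero => intro y hy; simpa using hy
    | succ n ih =>
      intro y hy
      have := (hgen _ (ih y hy)).1
      rwa [show s ^ ((n : ℤ) + 1) * y * s ^ (-((n : ℤ) + 1)) =
        s * (s ^ (n : ℤ) * y * s ^ (-(n : ℤ))) * s⁻¹ by group]
    | pred n ih =>
      intro y hy
      have := (hgen _ (ih y hy)).2
      rwa [show s ^ (-(n : ℤ) - 1) * y * s ^ (-(-(n : ℤ) - 1)) =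
        s⁻¹ * (s ^ (-(n : ℤ)) * y * s ^ (-(-(n : ℤ)))) * s by group]
  have hlast : ∀ m ∈ Submonoid.closure {P, B},
      m = 1 ∨ ∃ m' ∈ Submonoid.closure {P, B}, m = m' * P ∨ m = m' * B := by
    intro m hm
    induction hm using Submonoid.closure_induction_right with
    | one => exact Or.inl rfl
    | mul_right x hx y hy _ =>
      refine Or.inr ⟨x, hx, ?_⟩
      rcases hy with rfl | rfl <;> simp
  -- An inverse letter cancels an equal last letter of m. After the other letter it is traded for
  -- s^{±1} by BP⁻¹ = Ps and PB⁻¹ = Bs⁻¹, and after the empty word by P⁻¹ = sBs⁻¹ and B⁻¹ = sPs⁻¹.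
  have step : ∀ m ∈ Submonoid.closure {P, B}, ∀ y ∈ gen, ∃ i j : ℤ,
      ∃ m' ∈ Submonoid.closure {P, B}, m * y = s ^ i * m' * s ^ j := by
    rintro m hm y (rfl | rfl | rfl | rfl)
    · exact ⟨0, 0, m * y, mul_mem hm hPm, by simp⟩
    · exact ⟨0, 0, m * y, mul_mem hm hBm, by simp⟩
    · rcases hlast m hm with rfl | ⟨m', hm', rfl | rfl⟩
      · exact ⟨1, -1, B, hBm, by simp [sB]⟩
      · exact ⟨0, 0, m', hm', by simp⟩
      · refine ⟨0, 1, m' * P, mul_mem hm' hPm, ?_⟩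
        rw [zpow_zero, one_mul, zpow_one, hs]; group
    · rcases hlast m hm with rfl | ⟨m', hm', rfl | rfl⟩
      · exact ⟨1, -1, P, hPm, by simp [sP]⟩
      · refine ⟨0, -1, m' * B, mul_mem hm' hBm, ?_⟩
        rw [zpow_zero, one_mul, zpow_neg_one, hs']; group
      · exact ⟨0, 0, m', hm', by simp⟩
  have main : ∀ {x : K}, (∃ i j : ℤ, ∃ m ∈ Submonoid.closure {P, B}, x = s ^ i * m * s ^ j) →
      ∀ y ∈ gen, ∃ i j : ℤ, ∃ m ∈ Submonoid.closure {P, B}, x * y = s ^ i * m * s ^ j := by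
    rintro _ ⟨i, j, m, hm, rfl⟩ y hy
    obtain ⟨i', j', m', hm', h⟩ := step m hm _ (hpow j y hy)
    refine ⟨i + i', j' + j, m', hm', ?_⟩
    calc s ^ i * m * s ^ j * y = s ^ i * (m * (s ^ j * y * s ^ (-j))) * s ^ j := by group
      _ = s ^ (i + i') * m' * s ^ (j' + j) := by rw [h]; group
  induction hx using Subgroup.closure_induction_right with
  | one => exact ⟨0, 0, 1, one_mem _, by simp⟩
  | mul_right x hx y hy ih =>
    rcases hy with rfl | rfl
    · exact main ih _ (by simp [gen])
    · exact main ih _ (by simp [gen])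
  | mul_inv_cancel x hx y hy ih =>
    rcases hy with rfl | rfl
    · exact main ih _ (by simp [gen])
    · exact main ih _ (by simp [gen])

/-- The presentation `⟨a, b | a b a = b a b, (a b)⁶ = 1⟩` of `SL₂(ℤ)`. -/
theorem exists_hom_SL2Z {G : Type*} [Group G] (a b : G) (hab : a * b * a = b * a * b)
    (h6 : (a * b) ^ 6 = 1) : ∃ θ : SL(2, ℤ) →* G, θ tauA = a ∧ θ tauB = b := by
  set A : SL(2, ℤ) × G := (tauA, a)
  set B : SL(2, ℤ) × G := (tauB, b)
  -- Γ will be the graph of the wanted morphism, once its projection to SL₂(ℤ) is shown to be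
  -- bijective. The double inverse matches the form of `braid_normalForm` for P = A⁻¹.
  set Γ : Subgroup (SL(2, ℤ) × G) := Subgroup.closure {A⁻¹⁻¹, B} with hΓ
  have hA : A ∈ Γ := Subgroup.subset_closure (by simp)
  have hB : B ∈ Γ := Subgroup.subset_closure (by simp)
  set s := A * B * A with hs
  have hbraid : tauA * tauB * tauA = tauB * tauA * tauB := by
    ext1
    simp [coe_tauA, coe_tauB]
  have hs' : s = B * A * B := Prod.ext hbraid hab
  have hsm : (s.1 : Matrix (Fin 2) (Fin 2) ℤ) = !![0, 1; -1, 0] := by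
    simp [hs, A, B, coe_tauA, coe_tauB]
  have hs2 : ((s ^ 2).1 : Matrix (Fin 2) (Fin 2) ℤ) = !![-1, 0; 0, -1] := by
    rw [Prod.pow_fst, Matrix.SpecialLinearGroup.coe_pow, hsm]; simp [pow_two]
  have hs3 : ((s ^ 3).1 : Matrix (Fin 2) (Fin 2) ℤ) = !![0, -1; 1, 0] := by
    rw [Prod.pow_fst, Matrix.SpecialLinearGroup.coe_pow, hsm]; simp [pow_succ]
  have hs4 : s ^ 4 = 1 := by
    refine Prod.ext ?_ ?_
    · ext i j
      rw [Prod.pow_fst, Matrix.SpecialLinearGroup.coe_pow, hsm]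
      fin_cases i <;> fin_cases j <;> simp [pow_succ]
    -- The braid relation gives (aba)² = (ab)³, so this is the relation (ab)⁶ = 1.
    · change (a * b * a) ^ 4 = 1
      have : (a * b * a) ^ 2 = (a * b) ^ 3 := by
        rw [pow_two]; nth_rw 2 [hab]; simp only [pow_succ, pow_zero, one_mul, mul_assoc]
      rw [show 4 = 2 * 2 from rfl, pow_mul, this, ← pow_mul, h6]
  have hinj : Function.Injective ((MonoidHom.fst SL(2, ℤ) G).comp Γ.subtype) := by
    rw [injective_iff_map_eq_one]
    rintro ⟨x, hx⟩ h1
    change x.1 = 1 at h1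
    obtain ⟨i, j, m, hm, rfl⟩ := braid_normalForm (P := A⁻¹) (B := B) (s := s)
      (by rw [inv_inv]) (by rw [inv_inv, hs']) hx
    obtain ⟨h0, h2⟩ := positive_word (P := A⁻¹) (B := B) rfl rfl hm
    have hm1 : m.1 = (s ^ (-(i + j))).1 := by
      have h4 : (s ^ i).1 * m.1 * (s ^ j).1 = 1 := h1
      calc m.1 = (s ^ i).1⁻¹ * ((s ^ i).1 * m.1 * (s ^ j).1) * (s ^ j).1⁻¹ := by group
        _ = (s ^ (-(i + j))).1 := by
          rw [h4, mul_one, ← Prod.fst_inv, ← Prod.fst_inv, ← Prod.fst_mul]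
          congr 1; group
    have hk : s ^ (-(i + j)) = s ^ ((-(i + j)) % 4) := by
      conv_lhs => rw [← Int.emod_add_mul_ediv (-(i + j)) 4, zpow_add, zpow_mul]
      rw [show s ^ (4 : ℤ) = 1 from (zpow_natCast s 4).trans hs4]; simp
    have hk1 : s ^ (-(i + j)) = 1 := by
      rw [hk] at hm1 ⊢
      have hlt := Int.emod_lt_of_pos (-(i + j)) (by norm_num : (0 : ℤ) < 4)
      have hge := Int.emod_nonneg (-(i + j)) (by norm_num : (4 : ℤ) ≠ 0)
      generalize (-(i + j)) % 4 = k at *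
      -- A positive word has nonnegative entries, whereas the matrices of s, s² and s³ each have an
      -- entry −1; only k = 0 survives.
      interval_cases k
      · simp
      · have := h0 1 0
        rw [hm1, zpow_one, hsm] at this
        simp at this
      · have := h0 0 0
        rw [hm1, show s ^ (2 : ℤ) = s ^ 2 from zpow_natCast s 2, hs2] at this
        simp at this
      · have := h0 0 1
        rw [hm1, show s ^ (3 : ℤ) = s ^ 3 from zpow_natCast s 3, hs3] at this
        simp at this
    -- `positive_word` controls the pair and not only its matrix: a word with identity matrix is the
    -- empty word, so its component in G is trivial too. This is what makes the projection
    -- injective.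
    have hm0 : m = 1 := by
      refine h2.resolve_right fun h => ?_
      rw [hm1, hk1] at h
      simp at h
    ext1
    change s ^ i * m * s ^ j = 1
    rw [hm0, mul_one, ← zpow_add, ← inv_inj, ← zpow_neg, hk1, inv_one]
  have hsurj : Function.Surjective ((MonoidHom.fst SL(2, ℤ) G).comp Γ.subtype) := by
    rw [← MonoidHom.range_eq_top, eq_top_iff, ← closure_tau, Subgroup.closure_le]
    rintro _ (rfl | rfl)
    · exact ⟨⟨A, hA⟩, rfl⟩
    · exact ⟨⟨B, hB⟩, rfl⟩
  let e := MulEquiv.ofBijective _ ⟨hinj, hsurj⟩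
  have e1 : ∀ x : Γ, e.symm x.1.1 = x := fun x => e.symm_apply_apply x
  refine ⟨((MonoidHom.snd SL(2, ℤ) G).comp Γ.subtype).comp e.symm.toMonoidHom, ?_, ?_⟩
  · change (e.symm tauA).1.2 = a
    rw [e1 ⟨A, hA⟩]
  · change (e.symm tauB).1.2 = b
    rw [e1 ⟨B, hB⟩]

lemma hom_SL2Z_ext {G : Type*} [Group G] {θ θ' : SL(2, ℤ) →* G} (hA : θ tauA = θ' tauA)
    (hB : θ tauB = θ' tauB) : θ = θ' := by
  refine MonoidHom.eq_of_eqOn_top ?_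
  rw [← closure_tau]
  refine MonoidHom.eqOn_closure ?_
  rintro _ (rfl | rfl)
  · exact hA
  · exact hB

/-- The presentation `⟨a, b | a b a = b a b, (a b)³ = 1⟩` of `PSL₂(ℤ)`. -/
theorem exists_hom_PSL2Z {G : Type*} [Group G] (a b : G) (hab : a * b * a = b * a * b)
    (h3 : (a * b) ^ 3 = 1) : ∃ θ : Matrix.ProjectiveSpecialLinearGroup (Fin 2) ℤ →* G,
      θ (QuotientGroup.mk tauA) = a ∧ θ (QuotientGroup.mk tauB) = b := by
  obtain ⟨θ, hA, hB⟩ := exists_hom_SL2Z a b hab (by rw [show 6 = 3 * 2 from rfl, pow_mul, h3]; simp)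
  have hneg : θ (-1) = 1 := by
    have : (-1 : SL(2, ℤ)) = (tauA * tauB) ^ 3 := by
      ext i j
      fin_cases i <;> fin_cases j <;> simp [coe_tauA, coe_tauB, pow_succ]
    rw [this, map_pow, map_mul, hA, hB, h3]
  refine ⟨QuotientGroup.lift _ θ ?_, hA, hB⟩
  intro x hx
  -- A central element is a scalar matrix r with r² = 1, that is ±1.
  obtain ⟨r, hr, hrx⟩ := Matrix.SpecialLinearGroup.mem_center_iff.mp hx
  have h : x = 1 ∨ x = -1 := by
    rw [Fintype.card_fin, sq_eq_one_iff] at hr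
    rcases hr with rfl | rfl
    · left; ext1; simp [← hrx]
    · right; ext1; simp [← hrx]
  rcases h with rfl | rfl
  · exact map_one θ
  · exact hneg

lemma hom_PSL2Z_ext {G : Type*} [Group G]
    {θ θ' : Matrix.ProjectiveSpecialLinearGroup (Fin 2) ℤ →* G}
    (hA : θ (QuotientGroup.mk tauA) = θ' (QuotientGroup.mk tauA))
    (hB : θ (QuotientGroup.mk tauB) = θ' (QuotientGroup.mk tauB)) : θ = θ' :=
  QuotientGroup.monoidHom_ext _ (hom_SL2Z_ext hA hB)

end Presentation
end TorusModular

namespace TorusModular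

open scoped TensorProduct
open Coalgebra HopfAlgebra WithConv

noncomputable section

/-! ### Identities for R, the antipode and the Drinfeld element -/

section QuasiTriangular

set_option linter.unusedSectionVars false

variable {H : Type*} [Ring H] [HopfAlgebra ℂ H]

lemma legs_antipode_id (h : H) :
    legs (antipode ℂ) LinearMap.id (comul h) = algebraMap ℂ H (counit h) :=
  congrArg (fun F : ConvAlg H H => F h) LinearMap.antipode_mul_id

lemma legs_id_antipode (h : H) :
    legs LinearMap.id (antipode ℂ) (comul h) = algebraMap ℂ H (counit h) :=
  congrArg (fun F : ConvAlg H H => F h) LinearMap.id_mul_antipode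

namespace UniversalRMatrix

variable (R : UniversalRMatrix H)

/-- The number of terms of a decomposition `R = ∑ aᵢ ⊗ bᵢ`. -/
def size : ℕ := (TensorProduct.exists_sum_tmul_eq (R.R : H ⊗[ℂ] H)).choose

/-- The elements `aᵢ` of a decomposition `R = ∑ aᵢ ⊗ bᵢ`. -/
def a : Fin R.size → H := (TensorProduct.exists_sum_tmul_eq (R.R : H ⊗[ℂ] H)).choose_spec.choose

/-- The elements `bᵢ` of a decomposition `R = ∑ aᵢ ⊗ bᵢ`. -/
def b : Fin R.size → H :=
  (TensorProduct.exists_sum_tmul_eq (R.R : H ⊗[ℂ] H)).choose_spec.choose_spec.choose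

lemma R_eq : (R.R : H ⊗[ℂ] H) = ∑ i, R.a i ⊗ₜ R.b i :=
  (TensorProduct.exists_sum_tmul_eq (R.R : H ⊗[ℂ] H)).choose_spec.choose_spec.choose_spec

lemma R'_eq : (R.R' : H ⊗[ℂ] H) = ∑ i, R.b i ⊗ₜ R.a i := by
  change TensorProduct.comm ℂ H H (R.R : H ⊗[ℂ] H) = _
  rw [R_eq, map_sum]
  simp

lemma legs_R_eq {Q : Type*} [Ring Q] [Algebra ℂ Q] (p q : H →ₗ[ℂ] Q) :
    legs p q (R.R : H ⊗[ℂ] H) = ∑ i, p (R.a i) * q (R.b i) := by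
  rw [R_eq, map_sum]
  simp

/-- The axiom (Δ ⊗ id)(R) = R₁₃R₂₃ in a fixed decomposition of R. From here on R is handled by
finite sums, so that identities can be pushed through arbitrary linear maps. -/
lemma sum_comul_a : ∑ i, (comul (R := ℂ) (R.a i) ⊗ₜ[ℂ] R.b i : (H ⊗[ℂ] H) ⊗[ℂ] H) =
    ∑ i, ∑ j, (R.a i ⊗ₜ R.a j) ⊗ₜ (R.b i * R.b j) := by
  have h := R.comul_left
  rw [legs_R_eq, legs_R_eq, R_eq, map_sum, Finset.sum_mul_sum] at h
  simpa using h

lemma sum_comul_b : ∑ i, (R.a i ⊗ₜ[ℂ] comul (R := ℂ) (R.b i) : H ⊗[ℂ] (H ⊗[ℂ] H)) =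
    ∑ i, ∑ j, (R.a i * R.a j) ⊗ₜ (R.b j ⊗ₜ R.b i) := by
  have h := R.comul_right
  rw [legs_R_eq, legs_R_eq, R_eq, map_sum, Finset.sum_mul_sum] at h
  have h' := congrArg (TensorProduct.assoc ℂ H H H) h
  rw [LinearEquiv.apply_symm_apply] at h'
  simpa using h'

variable [FiniteDimensional ℂ H]

lemma sum_counit_a : ∑ i, counit (R := ℂ) (R.a i) • R.b i = 1 := by
  have h := (legs_counit R (AlgHom.id ℂ H)).1
  rw [legs_R_eq] at h
  simpa [Algebra.ofId_apply, Algebra.smul_def] using h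

lemma sum_counit_b : ∑ i, counit (R := ℂ) (R.b i) • R.a i = 1 := by
  have h := (legs_counit R (AlgHom.id ℂ H)).2
  rw [R'_eq, map_sum] at h
  simpa [Algebra.ofId_apply, Algebra.smul_def] using h

/-- Contracting the first two legs of (Δ ⊗ id)(R) = R₁₃R₂₃ by S(x)y leaves ε on the left and R₁₃R₂₃
turned into (S ⊗ id)(R)·R on the right. -/
lemma sum_antipode_a_left :
    ∑ i, ∑ j, (antipode ℂ (R.a i) * R.a j) ⊗ₜ[ℂ] (R.b i * R.b j) = 1 := by
  have h := congrArg (LinearMap.rTensor H (legs (antipode ℂ) LinearMap.id)) R.sum_comul_a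
  simp only [map_sum, LinearMap.rTensor_tmul, legs_antipode_id, legs_tmul, LinearMap.id_apply] at h
  have h1 := congrArg (fun z : H => (1 : H) ⊗ₜ[ℂ] z) R.sum_counit_a
  simp only [TensorProduct.tmul_sum] at h1
  rw [← h, Algebra.TensorProduct.one_def, ← h1]
  simp [Algebra.algebraMap_eq_smul_one, TensorProduct.smul_tmul']

lemma sum_antipode_a_right :
    ∑ i, ∑ j, (R.a i * antipode ℂ (R.a j)) ⊗ₜ[ℂ] (R.b i * R.b j) = 1 := by
  have h := congrArg (LinearMap.rTensor H (legs LinearMap.id (antipode ℂ))) R.sum_comul_a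
  simp only [map_sum, LinearMap.rTensor_tmul, legs_id_antipode, legs_tmul, LinearMap.id_apply] at h
  have h1 := congrArg (fun z : H => (1 : H) ⊗ₜ[ℂ] z) R.sum_counit_a
  simp only [TensorProduct.tmul_sum] at h1
  rw [← h, Algebra.TensorProduct.one_def, ← h1]
  simp [Algebra.algebraMap_eq_smul_one, TensorProduct.smul_tmul']

/-- The same contraction on (id ⊗ Δ)(R) = R₁₃R₁₂, now by x S(y). The second legs come out in
reversed order, so this is an inversion formula in H ⊗ Hᵒᵖ. -/
lemma sum_antipode_b_right :
    ∑ i, ∑ j, (R.a i * R.a j) ⊗ₜ[ℂ] (R.b j * antipode ℂ (R.b i)) = 1 := by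
  have h := congrArg (LinearMap.lTensor H (legs LinearMap.id (antipode ℂ))) R.sum_comul_b
  simp only [map_sum, LinearMap.lTensor_tmul, legs_id_antipode, legs_tmul, LinearMap.id_apply] at h
  have h1 := congrArg (fun z : H => z ⊗ₜ[ℂ] (1 : H)) R.sum_counit_b
  simp only [TensorProduct.sum_tmul] at h1
  rw [← h, Algebra.TensorProduct.one_def, ← h1]
  simp [Algebra.algebraMap_eq_smul_one, TensorProduct.smul_tmul']

/-- `R⁻¹ = (S ⊗ id)(R)`. -/
lemma R_inv_eq : (↑R.R⁻¹ : H ⊗[ℂ] H) = ∑ i, antipode ℂ (R.a i) ⊗ₜ R.b i := by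
  refine Units.inv_eq_of_mul_eq_one_right ?_
  rw [R_eq, Finset.sum_mul_sum]
  simpa using R.sum_antipode_a_right

lemma R'_inv_eq : (↑R.R'⁻¹ : H ⊗[ℂ] H) = ∑ i, R.b i ⊗ₜ antipode ℂ (R.a i) := by
  change TensorProduct.comm ℂ H H (↑R.R⁻¹ : H ⊗[ℂ] H) = _
  rw [R_inv_eq, map_sum]
  simp

/-- `(S ⊗ S)(R) = R`. -/
lemma sum_antipode_antipode :
    ∑ i, antipode ℂ (R.a i) ⊗ₜ[ℂ] antipode ℂ (R.b i) = (R.R : H ⊗[ℂ] H) := by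
  -- In H ⊗ Hᵒᵖ the element (id ⊗ S)(R) has left inverse (S ⊗ S)(R), obtained by applying id ⊗ S to
  -- (S ⊗ id)(R)·R = 1, and right inverse R. The two inverses agree.
  set e : H ⊗[ℂ] H →ₗ[ℂ] H ⊗[ℂ] Hᵐᵒᵖ :=
    LinearMap.lTensor H (MulOpposite.opLinearEquiv ℂ).toLinearMap with he
  have he' : ∀ x y : H, e (x ⊗ₜ y) = x ⊗ₜ MulOpposite.op y := fun x y => rfl
  have hinj : Function.Injective e :=
    (LinearEquiv.lTensor H (MulOpposite.opLinearEquiv ℂ : H ≃ₗ[ℂ] Hᵐᵒᵖ)).injective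
  have hone : e 1 = 1 := rfl
  set X := e (∑ i, antipode ℂ (R.a i) ⊗ₜ[ℂ] antipode ℂ (R.b i)) with hX
  set Y := e (∑ i, R.a i ⊗ₜ[ℂ] antipode ℂ (R.b i)) with hY
  set Z := e (∑ i, R.a i ⊗ₜ[ℂ] R.b i) with hZ
  have h1 : X * Y = 1 := by
    have h := congrArg (e ∘ₗ LinearMap.lTensor H (antipode ℂ)) R.sum_antipode_a_left
    simp only [LinearMap.comp_apply, map_sum, LinearMap.lTensor_tmul, antipode_mul_antidistrib,
      he', Algebra.TensorProduct.one_def, antipode_one] at h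
    rw [hX, hY]
    simp only [map_sum, he', Finset.sum_mul_sum, Algebra.TensorProduct.tmul_mul_tmul,
      ← MulOpposite.op_mul]
    rw [h]; rfl
  have h2 : Y * Z = 1 := by
    have h := congrArg e R.sum_antipode_b_right
    rw [hone] at h
    rw [hZ, hY]
    simp only [map_sum, he', Finset.sum_mul_sum, Algebra.TensorProduct.tmul_mul_tmul,
      ← MulOpposite.op_mul] at h ⊢
    exact h
  rw [R_eq]
  exact hinj (left_inv_eq_right_inv h1 h2)

/-- The substitution rule (a, b) → (S(a), S(b)) inside any linear expression in R. It is applied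
repeatedly to one copy of R among several. -/
lemma sum_map_antipode {M : Type*} [AddCommGroup M] [Module ℂ M] (F : H ⊗[ℂ] H →ₗ[ℂ] M) :
    ∑ i, F (antipode ℂ (R.a i) ⊗ₜ antipode ℂ (R.b i)) = ∑ i, F (R.a i ⊗ₜ R.b i) := by
  rw [← map_sum, sum_antipode_antipode, R_eq, map_sum]

lemma drinfeldElement_eq : R.drinfeldElement = ∑ i, antipode ℂ (R.b i) * R.a i := by
  rw [drinfeldElement, R'_eq, map_sum]
  simp

/-- `S(u) = aᵢ S(bᵢ)`. -/
lemma antipode_drinfeldElement :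
    antipode ℂ R.drinfeldElement = ∑ i, R.a i * antipode ℂ (R.b i) := by
  have h := R.sum_map_antipode (legs LinearMap.id (antipode ℂ))
  simp only [legs_tmul, LinearMap.id_apply] at h
  rw [← h, drinfeldElement_eq, map_sum]
  simp [antipode_mul_antidistrib]

end UniversalRMatrix

section Operators

variable {E : Type*} [Ring E] [Algebra ℂ E]

/-- The operators of left multiplication by the image of a morphism. -/
def leftOp (i : H →ₐ[ℂ] E) : H →ₐ[ℂ] Module.End ℂ E := (Algebra.lmul ℂ E).comp i

@[simp] lemma leftOp_apply (i : H →ₐ[ℂ] E) (x : H) (z : E) : leftOp i x z = i x * z := rfl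

/-- The operators `z ↦ z i(S(x))`. -/
def rightOp (i : H →ₐ[ℂ] E) : H →ₐ[ℂ] Module.End ℂ E :=
  AlgHom.ofLinearMap ((LinearMap.mul ℂ E).flip ∘ₗ i.toLinearMap ∘ₗ antipode ℂ)
    (by ext; simp) (fun x y => by ext; simp [antipode_mul_antidistrib, mul_assoc])

@[simp] lemma rightOp_apply (i : H →ₐ[ℂ] E) (x : H) (z : E) :
    rightOp i x z = z * i (antipode ℂ x) := rfl

lemma commute_leftOp_rightOp (i j : H →ₐ[ℂ] E) (x y : H) :
    Commute (leftOp i x) (rightOp j y) := by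
  ext z
  simp [mul_assoc]

lemma commute_leftOp (i j : H →ₐ[ℂ] E) (hij : ∀ x y, Commute (i x) (j y)) (x y : H) :
    Commute (leftOp i x) (leftOp j y) := by
  ext z
  simp only [Module.End.mul_apply, leftOp_apply]
  rw [← mul_assoc, (hij x y).eq, mul_assoc]

lemma commute_rightOp (i j : H →ₐ[ℂ] E) (hij : ∀ x y, Commute (i x) (j y)) (x y : H) :
    Commute (rightOp i x) (rightOp j y) := by
  ext z
  simp only [Module.End.mul_apply, rightOp_apply]
  rw [mul_assoc, mul_assoc, (hij _ _).eq]

/-- In a convolution product of operators the right factor acts first, so only its values on the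
given vector matter. -/
lemma convAlg_apply_congr {V : Type*} [AddCommGroup V] [Module ℂ V]
    {F G G' : ConvAlg H (Module.End ℂ V)} {z : V} (hG : ∀ h, G h z = G' h z) (h : H) :
    (F * G) h z = (F * G') h z := by
  rw [convAlg_mul_apply, convAlg_mul_apply]
  induction (comul h : H ⊗[ℂ] H) with
  | zero => simp
  | tmul x y => simp [hG]
  | add x y hx hy => simp only [map_add, LinearMap.add_apply, hx, hy]

end Operators

variable [FiniteDimensional ℂ H] (R : UniversalRMatrix H)

/-- Let H act on itself by left multiplication and by right multiplication through S. Then R sends 1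
to aᵢS(bᵢ) = S(u), and Δᵒᵖ(k)R = RΔ(k) applied to 1 reads k''S(u)S(k') = ε(k)S(u). Undoing the right
action by convolution gives the claim. -/
lemma mul_antipode_drinfeldElement (h : H) :
    h * antipode ℂ R.drinfeldElement =
      antipode ℂ R.drinfeldElement * antipode ℂ (antipode ℂ h) := by
  set l := leftOp (AlgHom.id ℂ H)
  set r := rightOp (AlgHom.id ℂ H)
  have hlr : ∀ x y, Commute (l x) (r y) := commute_leftOp_rightOp _ _
  have hU : legs l.toLinearMap r.toLinearMap R.R 1 = antipode ℂ R.drinfeldElement := by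
    rw [R.legs_R_eq, R.antipode_drinfeldElement]
    simp [l, r]
  have h1 : ∀ k, conv l.toLinearMap r.toLinearMap k 1 = counit (R := ℂ) k • (1 : H) := by
    intro k
    rw [← Algebra.algebraMap_eq_smul_one, ← legs_id_antipode, conv, LinearMap.comp_apply]
    induction (comul k : H ⊗[ℂ] H) with
    | zero => simp
    | tmul x y => simp [l, r]
    | add x y hx hy => simp only [map_add, LinearMap.add_apply, hx, hy]
  have h2 : ∀ k, (toConv r.toLinearMap * toConv l.toLinearMap) k (antipode ℂ R.drinfeldElement) =
      (1 : ConvAlg H (Module.End ℂ H)) k (antipode ℂ R.drinfeldElement) := by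
    intro k
    have := congrArg (fun F : Module.End ℂ H => F 1) (legs_comul_op R l r k hlr)
    simp only [Module.End.mul_apply, hU, h1, map_smul] at this
    exact this
  have h3 := convAlg_apply_congr (F := toConv (convInv r)) h2 h
  rw [← mul_assoc, convInv_mul_toConv, one_mul, mul_one] at h3
  exact h3

/-- Anticomultiplicativity Δ(S(x)) = S(x'') ⊗ S(x'), by uniqueness of the convolution inverse of Δ,
which is the convolution of the two inclusions. -/
lemma toConv_convInv_comul : toConv (convInv (Bialgebra.comulAlgHom ℂ H)) =
    toConv (convInv (Algebra.TensorProduct.includeRight : H →ₐ[ℂ] H ⊗[ℂ] H)) *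
      toConv (convInv (Algebra.TensorProduct.includeLeft : H →ₐ[ℂ] H ⊗[ℂ] H)) := by
  have h : toConv (Bialgebra.comulAlgHom ℂ H).toLinearMap =
      toConv (Algebra.TensorProduct.includeLeft : H →ₐ[ℂ] H ⊗[ℂ] H).toLinearMap *
        toConv (Algebra.TensorProduct.includeRight : H →ₐ[ℂ] H ⊗[ℂ] H).toLinearMap :=
    convAlg_ext fun x => (legs_include (comul x)).symm
  refine left_inv_eq_right_inv (convInv_mul_toConv _) ?_
  rw [h, mul_assoc, ← mul_assoc (toConv _) (toConv (convInv _)) _, toConv_mul_convInv, one_mul,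
    toConv_mul_convInv]

/-- H acts on H ⊗ H in four commuting ways: p, q multiply on the left in each factor, r, s on the
right through S. Then Δ(S(u)) is R₁₃R₁₄R₂₃R₂₄ applied to 1, with indices 1, 2, 3, 4 for p, q, r, s,
and left multiplication by R'R is R₂₁R₁₂. The Yang–Baxter equation brings R₁₂ next to R₁₄ and R₂₁
next to R₂₃, where they cancel, leaving R₁₃R₂₄. -/
lemma RR_mul_comul_antipode_drinfeldElement :
    ((R.R' * R.R : (H ⊗[ℂ] H)ˣ) : H ⊗[ℂ] H) * comul (antipode ℂ R.drinfeldElement) =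
      antipode ℂ R.drinfeldElement ⊗ₜ antipode ℂ R.drinfeldElement := by
  set i₁ : H →ₐ[ℂ] H ⊗[ℂ] H := Algebra.TensorProduct.includeLeft with hi₁
  set i₂ : H →ₐ[ℂ] H ⊗[ℂ] H := Algebra.TensorProduct.includeRight with hi₂
  have hi : ∀ x y, Commute (i₁ x) (i₂ y) := fun x y => by simp [i₁, i₂, Commute, SemiconjBy]
  have hi' : ∀ x y, Commute (i₂ x) (i₁ y) := fun x y => (hi y x).symm
  set p := leftOp i₁ with hp
  set q := leftOp i₂ with hq
  set r := rightOp i₁ with hr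
  set s := rightOp i₂ with hs
  have hpq : ∀ x y, Commute (p x) (q y) := commute_leftOp _ _ hi
  have hqp : ∀ x y, Commute (q x) (p y) := commute_leftOp _ _ hi'
  have hpr : ∀ x y, Commute (p x) (r y) := commute_leftOp_rightOp _ _
  have hps : ∀ x y, Commute (p x) (s y) := commute_leftOp_rightOp _ _
  have hqr : ∀ x y, Commute (q x) (r y) := commute_leftOp_rightOp _ _
  have hqs : ∀ x y, Commute (q x) (s y) := commute_leftOp_rightOp _ _
  have hrs : ∀ x y, Commute (r x) (s y) := commute_rightOp _ _ hi
  have hsr : ∀ x y, Commute (s x) (r y) := commute_rightOp _ _ hi'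
  set c := Bialgebra.comulAlgHom ℂ H
  have hlc : (leftOp c).toLinearMap = conv p.toLinearMap q.toLinearMap := by
    ext1 x
    change Algebra.lmul ℂ _ (comul x) = legs _ _ (comul x)
    induction (comul x : H ⊗[ℂ] H) with
    | zero => simp
    | tmul x y => refine LinearMap.ext fun z => ?_; simp [p, q, i₁, i₂, ← mul_assoc]
    | add x y hx hy => rw [map_add, map_add, hx, hy]
  -- The order of s and r is reversed because S reverses the coproduct.
  have hrc : (rightOp c).toLinearMap = conv s.toLinearMap r.toLinearMap := by
    ext1 x
    have h := congrArg (fun F : ConvAlg H (H ⊗[ℂ] H) => F x) (toConv_convInv_comul (H := H))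
    simp only [convAlg_mul_apply] at h
    have h' : (rightOp c).toLinearMap x = (LinearMap.mul ℂ (H ⊗[ℂ] H)).flip
      (legs (convInv i₂) (convInv i₁) (comul x)) :=
      congrArg (LinearMap.mul ℂ (H ⊗[ℂ] H)).flip h
    rw [h', conv, LinearMap.comp_apply]
    induction (comul x : H ⊗[ℂ] H) with
    | zero => simp
    | tmul x y =>
      refine LinearMap.ext fun z => ?_
      simp [r, s, i₁, i₂, mul_assoc]
    | add x y hx hy => rw [map_add, map_add, map_add, hx, hy]
  have hu : ∀ (i : H →ₐ[ℂ] H ⊗[ℂ] H),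
      legs (leftOp i).toLinearMap (rightOp i).toLinearMap (R.R : H ⊗[ℂ] H) 1 =
        i (antipode ℂ R.drinfeldElement) := fun i => by
    rw [R.legs_R_eq, R.antipode_drinfeldElement]
    simp
  have hΔ : comul (R := ℂ) (antipode ℂ R.drinfeldElement) =
      legs p.toLinearMap r.toLinearMap (R.R : H ⊗[ℂ] H)
        (legs p.toLinearMap s.toLinearMap (R.R : H ⊗[ℂ] H)
          (legs q.toLinearMap r.toLinearMap (R.R : H ⊗[ℂ] H)
            (legs q.toLinearMap s.toLinearMap (R.R : H ⊗[ℂ] H) 1))) := by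
    have hc1 : ∀ x y, Commute (p x) (rightOp c y) := commute_leftOp_rightOp _ _
    have hc2 : ∀ x y, Commute (q x) (rightOp c y) := commute_leftOp_rightOp _ _
    have h := hu c
    rw [hlc, legs_conv_left R p q (rightOp c) hpq hc1 hc2, hrc,
      legs_conv_right R p s r hps hpr hsr, legs_conv_right R q s r hqs hqr hsr] at h
    exact h.symm
  have hmul : ∀ z, ((R.R' * R.R : (H ⊗[ℂ] H)ˣ) : H ⊗[ℂ] H) * z =
      legs q.toLinearMap p.toLinearMap (R.R : H ⊗[ℂ] H)
        (legs p.toLinearMap q.toLinearMap (R.R : H ⊗[ℂ] H) z) := by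
    intro z
    rw [Units.val_mul, R.legs_R_eq, R.legs_R_eq, R.R_eq, R.R'_eq]
    simp [p, q, i₁, i₂, Finset.sum_mul, Finset.mul_sum, ← mul_assoc, LinearMap.sum_apply]
  -- Here R₁₄R₁₂ applied to 1 is aᵢaⱼ ⊗ bⱼS(bᵢ), which `sum_antipode_b_right` evaluates.
  have hcancel : legs p.toLinearMap s.toLinearMap (R.R : H ⊗[ℂ] H)
      (legs p.toLinearMap q.toLinearMap (R.R : H ⊗[ℂ] H) 1) = 1 := by
    refine Eq.trans ?_ R.sum_antipode_b_right
    rw [R.legs_R_eq, R.legs_R_eq]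
    simp only [LinearMap.sum_apply, map_sum]
    rw [Finset.sum_comm]
    simp [p, q, s, i₁, i₂]
  set w := antipode ℂ R.drinfeldElement with hw
  have hcancel' : legs q.toLinearMap r.toLinearMap (R.R : H ⊗[ℂ] H)
      (legs q.toLinearMap p.toLinearMap (R.R : H ⊗[ℂ] H) (1 ⊗ₜ w)) = 1 ⊗ₜ w := by
    have h := congrArg (fun z => TensorProduct.comm ℂ H H z * (1 ⊗ₜ[ℂ] w)) R.sum_antipode_b_right
    simp only [map_sum, TensorProduct.comm_tmul, Algebra.TensorProduct.one_def,
      Finset.sum_mul, Algebra.TensorProduct.tmul_mul_tmul, mul_one, one_mul] at h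
    refine Eq.trans ?_ h
    rw [R.legs_R_eq, R.legs_R_eq]
    simp only [LinearMap.sum_apply, map_sum]
    rw [Finset.sum_comm]
    simp [p, q, r, i₁, i₂, mul_assoc]
  have yb1 := yangBaxter R p q r hpq hpr hqr
  have yb2 := yangBaxter R p q s hpq hps hqs
  have yb3 := yangBaxter R q p r hqp hqr hpr
  have hcomm : Commute (legs p.toLinearMap s.toLinearMap (R.R : H ⊗[ℂ] H))
      (legs q.toLinearMap r.toLinearMap (R.R : H ⊗[ℂ] H)) := by
    refine commute_legs _ _ _ (fun x => ?_) (fun x => ?_) _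
    · exact (commute_legs _ _ _ (hqp x) (hqs x) _).symm
    · exact (commute_legs _ _ _ (fun y => (hpr y x).symm) (hrs x) _).symm
  have hqs1 : legs q.toLinearMap s.toLinearMap (R.R : H ⊗[ℂ] H) 1 = 1 ⊗ₜ w := hu i₂
  rw [hmul, hΔ]
  set R₁₂ := legs p.toLinearMap q.toLinearMap (R.R : H ⊗[ℂ] H)
  set R₂₁ := legs q.toLinearMap p.toLinearMap (R.R : H ⊗[ℂ] H)
  set R₁₃ := legs p.toLinearMap r.toLinearMap (R.R : H ⊗[ℂ] H) with hR₁₃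
  set R₁₄ := legs p.toLinearMap s.toLinearMap (R.R : H ⊗[ℂ] H)
  set R₂₃ := legs q.toLinearMap r.toLinearMap (R.R : H ⊗[ℂ] H)
  set R₂₄ := legs q.toLinearMap s.toLinearMap (R.R : H ⊗[ℂ] H)
  -- Three uses of the Yang–Baxter equation, on the triples (p, q, r), (p, q, s) and (q, p, r),
  -- besides the commutation of R₁₄ with R₂₃.
  have key : R₂₁ * R₁₂ * R₁₃ * R₁₄ * R₂₃ * R₂₄ = R₁₃ * R₂₃ * R₂₁ * R₂₄ * (R₁₄ * R₁₂) := by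
    calc R₂₁ * R₁₂ * R₁₃ * R₁₄ * R₂₃ * R₂₄ = R₂₁ * R₁₂ * R₁₃ * (R₁₄ * R₂₃) * R₂₄ := by
          simp only [mul_assoc]
      _ = R₂₁ * (R₁₂ * R₁₃ * R₂₃) * R₁₄ * R₂₄ := by rw [hcomm.eq]; simp only [mul_assoc]
      _ = R₂₁ * R₂₃ * R₁₃ * (R₁₂ * R₁₄ * R₂₄) := by rw [yb1]; simp only [mul_assoc]
      _ = (R₂₁ * R₂₃ * R₁₃) * R₂₄ * (R₁₄ * R₁₂) := by rw [yb2]; simp only [mul_assoc]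
      _ = R₁₃ * R₂₃ * R₂₁ * R₂₄ * (R₁₄ * R₁₂) := by rw [yb3]
  have key1 := congrArg (fun F : Module.End ℂ (H ⊗[ℂ] H) => F 1) key
  simp only [Module.End.mul_apply, hcancel, hqs1, hcancel'] at key1
  rw [hqs1, key1, hR₁₃, R.legs_R_eq, hw, R.antipode_drinfeldElement]
  simp [p, r, i₁, LinearMap.sum_apply, TensorProduct.sum_tmul]

end QuasiTriangular
end
end TorusModular

namespace TorusModular

open scoped TensorProduct
open Coalgebra HopfAlgebra WithConv

noncomputable section

/-! ### The pivotal element and double braidings -/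

section Ribbon

set_option linter.unusedSectionVars false

variable {H : Type*} [Ring H] [HopfAlgebra ℂ H] [FiniteDimensional ℂ H]

/-- One-sided inverses are two-sided for operators on a finite-dimensional space, hence in H through
its regular representation. -/
lemma mul_eq_one_of_finiteDimensional {x y : H} (h : x * y = 1) : y * x = 1 := by
  have h1 : Algebra.lmul ℂ H x * Algebra.lmul ℂ H y = 1 := by rw [← map_mul, h, map_one]
  have h2 := mul_eq_one_comm.mp h1
  simpa using congrArg (fun F : Module.End ℂ H => F 1) h2

namespace RibbonElement

variable {R : UniversalRMatrix H} (v : RibbonElement R)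

lemma antipode_inv : antipode ℂ (↑v.v⁻¹ : H) = ↑v.v⁻¹ := by
  symm
  refine Units.inv_eq_of_mul_eq_one_left ?_
  have h := congrArg (antipode ℂ) v.v.mul_inv
  rwa [antipode_mul_antidistrib, v.antipode_eq, antipode_one] at h

/-- This is uS(u) = v² divided by the central element v²; it exhibits S(u)v⁻¹ as the inverse of the
pivotal element. -/
lemma drinfeldElement_mul_inv : R.drinfeldElement * (↑v.v⁻¹ : H) *
    (antipode ℂ R.drinfeldElement * ↑v.v⁻¹) = 1 := by
  have h : R.drinfeldElement * antipode ℂ R.drinfeldElement = v.v * v.v := by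
    rw [← v.sq_eq, sq]
  rw [mul_assoc, ← mul_assoc (↑v.v⁻¹ : H), v.inv_central, mul_assoc, ← mul_assoc, h]
  simp [mul_assoc]

/-- The pivotal element `g = u v⁻¹`. -/
def pivot : Hˣ where
  val := R.drinfeldElement * ↑v.v⁻¹
  inv := antipode ℂ R.drinfeldElement * ↑v.v⁻¹
  val_inv := v.drinfeldElement_mul_inv
  inv_val := mul_eq_one_of_finiteDimensional v.drinfeldElement_mul_inv

lemma drinfeldElement_eq : R.drinfeldElement = v.pivot * v.v := by
  simp [pivot, mul_assoc]

lemma antipode_drinfeldElement_eq : antipode ℂ R.drinfeldElement = ↑v.pivot⁻¹ * v.v := by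
  have : (↑v.pivot⁻¹ : H) = antipode ℂ R.drinfeldElement * ↑v.v⁻¹ := rfl
  simp [this, mul_assoc]

lemma antipode_pivot : antipode ℂ (v.pivot : H) = ↑v.pivot⁻¹ := by
  change antipode ℂ (R.drinfeldElement * ↑v.v⁻¹) = antipode ℂ R.drinfeldElement * ↑v.v⁻¹
  rw [antipode_mul_antidistrib, v.antipode_inv, v.inv_central]

/-- `S²(h) = g h g⁻¹`. -/
lemma antipode_sq (h : H) :
    antipode ℂ (antipode ℂ h) = v.pivot * h * ↑v.pivot⁻¹ := by
  have h1 := mul_antipode_drinfeldElement R h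
  rw [v.antipode_drinfeldElement_eq, ← mul_assoc, mul_assoc _ (v.v : H), v.central,
    ← mul_assoc, Units.mul_left_inj] at h1
  rw [mul_assoc, h1, Units.mul_inv_cancel_left]

/-- S² is an inner automorphism, so S cannot have a kernel. -/
lemma antipode_injective (v : RibbonElement R) :
    Function.Injective (antipode ℂ : H →ₗ[ℂ] H) := by
  intro x y hxy
  have h := congrArg (antipode ℂ) hxy
  rw [v.antipode_sq, v.antipode_sq] at h
  simpa using h

lemma antipode_pivot_inv : antipode ℂ (↑v.pivot⁻¹ : H) = v.pivot := by
  rw [← v.antipode_pivot, v.antipode_sq]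
  simp

/-- `Δ(v⁻¹) = R' R (v⁻¹ ⊗ v⁻¹)`. -/
lemma comul_inv : comul (R := ℂ) (↑v.v⁻¹ : H) =
    ((R.R' * R.R : (H ⊗[ℂ] H)ˣ) : H ⊗[ℂ] H) * ((↑v.v⁻¹ : H) ⊗ₜ[ℂ] (↑v.v⁻¹ : H)) := by
  refine left_inv_eq_right_inv (a := comul (R := ℂ) (v.v : H)) ?_ ?_
  · rw [← Bialgebra.comul_mul, Units.inv_mul, Bialgebra.comul_one]
  · rw [v.comul_eq]
    have hc : ((v.v : H) ⊗ₜ[ℂ] (v.v : H)) * ((R.R' * R.R : (H ⊗[ℂ] H)ˣ) : H ⊗[ℂ] H) =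
        ((R.R' * R.R : (H ⊗[ℂ] H)ˣ) : H ⊗[ℂ] H) * ((v.v : H) ⊗ₜ[ℂ] (v.v : H)) := by
      induction ((R.R' * R.R : (H ⊗[ℂ] H)ˣ) : H ⊗[ℂ] H) with
      | zero => simp
      | tmul x y => simp [v.central]
      | add x y hx hy => rw [mul_add, add_mul, hx, hy]
    rw [mul_assoc, ← mul_assoc ((v.v : H) ⊗ₜ[ℂ] (v.v : H)), hc, mul_assoc, ← mul_assoc,
      Units.inv_mul, one_mul]
    simp [Algebra.TensorProduct.one_def]

lemma inv_tmul_inv_mul (X : H ⊗[ℂ] H) : ((↑v.v⁻¹ : H) ⊗ₜ[ℂ] (↑v.v⁻¹ : H)) * X =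
    X * ((↑v.v⁻¹ : H) ⊗ₜ[ℂ] (↑v.v⁻¹ : H)) := by
  induction X with
  | zero => simp
  | tmul x y => simp [v.inv_central]
  | add x y hx hy => rw [mul_add, add_mul, hx, hy]

/-- Write g⁻¹ = v⁻¹S(u). The factor R'R in Δ(v⁻¹) is exactly the one by which Δ(S(u)) fails to be
S(u) ⊗ S(u), so it disappears. -/
lemma comul_pivot_inv : comul (R := ℂ) (↑v.pivot⁻¹ : H) =
    (↑v.pivot⁻¹ : H) ⊗ₜ[ℂ] (↑v.pivot⁻¹ : H) := by
  have h : (↑v.pivot⁻¹ : H) = ↑v.v⁻¹ * antipode ℂ R.drinfeldElement := by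
    rw [v.inv_central]; rfl
  have h' : (↑v.pivot⁻¹ : H) = antipode ℂ R.drinfeldElement * ↑v.v⁻¹ := rfl
  conv_lhs => rw [h, Bialgebra.comul_mul, v.comul_inv, ← v.inv_tmul_inv_mul, mul_assoc,
    RR_mul_comul_antipode_drinfeldElement, Algebra.TensorProduct.tmul_mul_tmul, ← h]

/-- A left inverse for u. Moving u through S²(x)u = ux turns the product into bᵢS(bⱼ)aⱼaᵢ, which is
`sum_antipode_b_right` flipped and multiplied out. -/
lemma sum_b_antipode_a (v : RibbonElement R) : (∑ i, R.b i * antipode ℂ (antipode ℂ (R.a i))) *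
    R.drinfeldElement = 1 := by
  have h : ∀ x, antipode ℂ (antipode ℂ x) * R.drinfeldElement = R.drinfeldElement * x := by
    intro x
    rw [v.antipode_sq, v.drinfeldElement_eq]
    simp only [mul_assoc, Units.inv_mul_cancel_left, v.central]
  have h1 := congrArg (LinearMap.mul' ℂ H ∘ₗ (TensorProduct.comm ℂ H H).toLinearMap)
    R.sum_antipode_b_right
  simp only [map_sum, LinearMap.comp_apply, LinearEquiv.coe_coe, TensorProduct.comm_tmul,
    LinearMap.mul'_apply, Algebra.TensorProduct.one_def, mul_one] at h1
  rw [← h1, Finset.sum_mul, Finset.sum_comm]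
  refine Finset.sum_congr rfl fun i _ => ?_
  rw [mul_assoc, h, R.drinfeldElement_eq, Finset.sum_mul, Finset.mul_sum]
  simp [mul_assoc]

/-- `bᵢ g aᵢ = v⁻¹`. -/
lemma sum_b_pivot_a : ∑ i, R.b i * v.pivot * R.a i = (↑v.v⁻¹ : H) := by
  have h := v.sum_b_antipode_a
  rw [v.drinfeldElement_eq, ← mul_assoc, Finset.sum_mul] at h
  rw [eq_comm]
  refine Units.inv_eq_of_mul_eq_one_left ?_
  rw [← h]
  congr 1
  refine Finset.sum_congr rfl fun i _ => ?_
  rw [v.antipode_sq]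
  simp [mul_assoc]

/-- `aᵢ g⁻¹ bᵢ = v⁻¹`. -/
lemma sum_a_pivot_inv_b : ∑ i, R.a i * ↑v.pivot⁻¹ * R.b i = (↑v.v⁻¹ : H) := by
  have h := R.sum_map_antipode (LinearMap.mul' ℂ H ∘ₗ
    LinearMap.rTensor H (LinearMap.mulRight ℂ (↑v.pivot⁻¹ : H)))
  -- Applying S to bᵢ g aᵢ = v⁻¹ gives S(aᵢ)g⁻¹S(bᵢ); the invariance of R under S ⊗ S removes the
  -- antipodes.
  simp only [LinearMap.comp_apply, LinearMap.rTensor_tmul, LinearMap.mulRight_apply,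
    LinearMap.mul'_apply] at h
  rw [← h, ← v.antipode_inv, ← v.sum_b_pivot_a, map_sum]
  simp only [antipode_mul_antidistrib, v.antipode_pivot, mul_assoc]

/-- `aᵢ S(bᵢ) = g⁻¹ v`. -/
lemma sum_a_antipode_b : ∑ i, R.a i * antipode ℂ (R.b i) = ↑v.pivot⁻¹ * (v.v : H) := by
  rw [← R.antipode_drinfeldElement, v.antipode_drinfeldElement_eq]

/-- `S(aᵢ) g bᵢ = v`. -/
lemma sum_antipode_a_pivot_b : ∑ i, antipode ℂ (R.a i) * v.pivot * R.b i = (v.v : H) := by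
  have h : antipode ℂ R.drinfeldElement * v.pivot = v.v := by
    rw [v.antipode_drinfeldElement_eq, mul_assoc, v.central, Units.inv_mul_cancel_left]
  rw [← h, R.drinfeldElement_eq, map_sum, Finset.sum_mul]
  refine Finset.sum_congr rfl fun i _ => ?_
  rw [antipode_mul_antidistrib, v.antipode_sq]
  simp [mul_assoc]

end RibbonElement

/-- `x ⊗ y ↦ (s ⊗ x) ⊗ c y d`. -/
def wrapOuter (s c d : H) : H ⊗[ℂ] H →ₗ[ℂ] (H ⊗[ℂ] H) ⊗[ℂ] H :=
  TensorProduct.map (TensorProduct.mk ℂ H H s) (LinearMap.mulLeft ℂ c ∘ₗ LinearMap.mulRight ℂ d)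

@[simp] lemma wrapOuter_tmul (s c d x y : H) :
    wrapOuter s c d (x ⊗ₜ y) = (s ⊗ₜ x) ⊗ₜ (c * (y * d)) := rfl

/-- `x ⊗ y ↦ (x ⊗ t) ⊗ c y d`. -/
def wrapInner (t c d : H) : H ⊗[ℂ] H →ₗ[ℂ] (H ⊗[ℂ] H) ⊗[ℂ] H :=
  TensorProduct.map ((TensorProduct.mk ℂ H H).flip t)
    (LinearMap.mulLeft ℂ c ∘ₗ LinearMap.mulRight ℂ d)

@[simp] lemma wrapInner_tmul (t c d x y : H) :
    wrapInner t c d (x ⊗ₜ y) = (x ⊗ₜ t) ⊗ₜ (c * (y * d)) := rfl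

namespace UniversalRMatrix

variable (R : UniversalRMatrix H)

lemma RR'_eq : (R.R : H ⊗[ℂ] H) * (R.R' : H ⊗[ℂ] H) = ∑ i, ∑ j, (R.a i * R.b j) ⊗ₜ (R.b i * R.a j) := by
  rw [R_eq, R'_eq, Finset.sum_mul_sum]
  simp

lemma R'R_eq : (R.R' : H ⊗[ℂ] H) * (R.R : H ⊗[ℂ] H) = ∑ i, ∑ j, (R.b i * R.a j) ⊗ₜ (R.a i * R.b j) := by
  rw [R_eq, R'_eq, Finset.sum_mul_sum]
  simp

lemma rTensor_comul_R' : LinearMap.rTensor H comul (R.R' : H ⊗[ℂ] H) =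
    ∑ j, ∑ i, (R.b j ⊗ₜ R.b i) ⊗ₜ (R.a i * R.a j) := by
  rw [Finset.sum_comm]
  have h := congrArg (TensorProduct.comm ℂ H (H ⊗[ℂ] H)) R.sum_comul_b
  rw [R'_eq]
  simpa using h

lemma rTensor_comul_R : LinearMap.rTensor H comul (R.R : H ⊗[ℂ] H) =
    ∑ i, ∑ j, (R.a i ⊗ₜ R.a j) ⊗ₜ (R.b i * R.b j) := by
  rw [← sum_comul_a, R_eq]
  simp

lemma rTensor_comul_mul (X Y : H ⊗[ℂ] H) : LinearMap.rTensor H comul (X * Y) =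
    LinearMap.rTensor H comul X * LinearMap.rTensor H comul Y :=
  map_mul (Algebra.TensorProduct.map (Bialgebra.comulAlgHom ℂ H) (AlgHom.id ℂ H)) X Y

/-- `(Δ ⊗ id)(R R') = R₁₃ R₂₃ R'₂₃ R'₁₃`. -/
lemma rTensor_comul_RR' : LinearMap.rTensor H comul ((R.R : H ⊗[ℂ] H) * (R.R' : H ⊗[ℂ] H)) =
    ∑ i, ∑ j, wrapOuter (R.a i * R.b j) (R.b i) (R.a j) ((R.R : H ⊗[ℂ] H) * (R.R' : H ⊗[ℂ] H)) := by
  rw [rTensor_comul_mul, rTensor_comul_R, rTensor_comul_R', RR'_eq]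
  simp only [map_sum, wrapOuter_tmul, Finset.sum_mul_sum, Algebra.TensorProduct.tmul_mul_tmul,
    mul_assoc]

/-- `(Δ ⊗ id)(R' R) = R'₂₃ R'₁₃ R₁₃ R₂₃`. -/
lemma rTensor_comul_R'R : LinearMap.rTensor H comul ((R.R' : H ⊗[ℂ] H) * (R.R : H ⊗[ℂ] H)) =
    ∑ i, ∑ j, wrapInner (R.b i * R.a j) (R.a i) (R.b j) ((R.R' : H ⊗[ℂ] H) * (R.R : H ⊗[ℂ] H)) := by
  rw [rTensor_comul_mul, rTensor_comul_R, rTensor_comul_R', R'R_eq]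
  rw [Finset.sum_comm, Finset.sum_comm (f := fun i j => (R.a i ⊗ₜ[ℂ] R.a j) ⊗ₜ[ℂ] (R.b i * R.b j))]
  simp only [map_sum, wrapInner_tmul, Finset.sum_mul_sum, Algebra.TensorProduct.tmul_mul_tmul,
    mul_assoc]

end UniversalRMatrix

end Ribbon
end
end TorusModular

namespace TorusModular

open scoped TensorProduct
open Coalgebra HopfAlgebra WithConv

noncomputable section

/-! ### Twisted forms and the integral attached to v -/

section Integral

set_option linter.unusedSectionVars false

variable {H : Type*} [Ring H] [HopfAlgebra ℂ H] [FiniteDimensional ℂ H]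

/-- A linear form `f` with `f(h x) = f(x S²(h))`. -/
def IsTwisted (f : Module.Dual ℂ H) : Prop :=
  ∀ h x, f (h * x) = f (x * antipode ℂ (antipode ℂ h))

/-- Insert S(h''S(h''')) = ε: f(hx) = f(h' x S²(h''')S(h'')), and invariance under the first two
components of h leaves f(x S²(h)). -/
lemma isTwisted_of_adj {f : Module.Dual ℂ H} (hf : ∀ h, f ∘ₗ adj h = counit (R := ℂ) h • f) :
    IsTwisted f := by
  intro h x
  -- G sends p ⊗ q ⊗ r to f(p x S(q S(r))). Coassociativity of h is evaluated through it in two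
  -- ways: contracting the last two legs gives one side, the first two the other.
  set G : H ⊗[ℂ] (H ⊗[ℂ] H) →ₗ[ℂ] ℂ := TensorProduct.lift (LinearMap.mk₂ ℂ
    (fun p (Z : H ⊗[ℂ] H) => f (p * (x * antipode ℂ (legs LinearMap.id (antipode ℂ) Z))))
    (fun p q Z => by simp [add_mul]) (fun c p Z => by simp)
    (fun p Y Z => by simp [mul_add]) (fun c p Z => by simp)) with hG
  have hG' : ∀ p Z, G (p ⊗ₜ Z) =
    f (p * (x * antipode ℂ (legs LinearMap.id (antipode ℂ) Z))) := fun p Z => rfl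
  have h0 := congrArg G (coassoc_apply (R := ℂ) h)
  have h1 : ∀ Y : H ⊗[ℂ] H, G (LinearMap.lTensor H comul Y) =
      legs (f ∘ₗ LinearMap.mulRight ℂ x) (counit : H →ₗ[ℂ] ℂ) Y := by
    intro Y
    induction Y with
    | zero => simp
    | tmul p k =>
      rw [LinearMap.lTensor_tmul, hG', legs_id_antipode]
      simp [Algebra.algebraMap_eq_smul_one, mul_comm]
    | add Y Z hY hZ => rw [map_add, map_add, map_add, hY, hZ]
  have h2 : ∀ Y : H ⊗[ℂ] H, G (TensorProduct.assoc ℂ H H H (LinearMap.rTensor H comul Y)) =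
      legs (counit : H →ₗ[ℂ] ℂ)
        (f ∘ₗ LinearMap.mulLeft ℂ x ∘ₗ antipode ℂ ∘ₗ antipode ℂ) Y := by
    intro Y
    induction Y with
    | zero => simp
    | tmul p k =>
      have h3 := congrArg (fun F : Module.Dual ℂ H => F (x * antipode ℂ (antipode ℂ k))) (hf p)
      have h4 : ∀ Z : H ⊗[ℂ] H, G (TensorProduct.assoc ℂ H H H (Z ⊗ₜ k)) =
          f (legs (LinearMap.mul ℂ H) ((LinearMap.mul ℂ H).flip ∘ₗ antipode ℂ) Z
            (x * antipode ℂ (antipode ℂ k))) := by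
        intro Z
        induction Z with
        | zero => simp
        | tmul y z =>
          rw [TensorProduct.assoc_tmul, hG']
          simp [antipode_mul_antidistrib, mul_assoc]
        | add Y Z hY hZ =>
          rw [TensorProduct.add_tmul, map_add, map_add, map_add, hY, hZ, LinearMap.add_apply,
            map_add]
      rw [LinearMap.rTensor_tmul, h4]
      exact h3
    | add Y Z hY hZ => rw [map_add, map_add, map_add, map_add, hY, hZ]
  rw [h1, h2] at h0
  have e1 := congrArg (fun F : ConvAlg H ℂ => F h)
    (one_mul (toConv (f ∘ₗ LinearMap.mulLeft ℂ x ∘ₗ antipode ℂ ∘ₗ antipode ℂ)))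
  have e2 := congrArg (fun F : ConvAlg H ℂ => F h)
    (mul_one (toConv (f ∘ₗ LinearMap.mulRight ℂ x)))
  exact e2.symm.trans (h0.symm.trans e1)

/-- `y ↦ y' f(y'')`. -/
def hit (f : Module.Dual ℂ H) : Module.End ℂ H :=
  contract f ∘ₗ (TensorProduct.comm ℂ H H).toLinearMap ∘ₗ comul

lemma hit_apply (f : Module.Dual ℂ H) (y : H) :
    hit f y = contract f (TensorProduct.comm ℂ H H (comul y)) := rfl

lemma hit_smul (c : ℂ) (f : Module.Dual ℂ H) (y : H) : hit (c • f) y = c • hit f y := by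
  rw [hit_apply, hit_apply, ← contractWith_apply, map_smul, contractWith_apply]

lemma hit_sub (f f' : Module.Dual ℂ H) (y : H) : hit (f - f') y = hit f y - hit f' y := by
  rw [hit_apply, hit_apply, hit_apply, ← contractWith_apply, map_sub]; rfl

/-- Multiplication by g on the right in H* is the transpose of y ↦ y'g(y''). Statements about
products in H* can thus be proved in H, and conversely. -/
lemma conv_eq_hit (f g : Module.Dual ℂ H) (y : H) : conv f g y = f (hit g y) := by
  rw [hit_apply, conv, LinearMap.comp_apply]
  induction (comul y : H ⊗[ℂ] H) with
  | zero => simp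
  | tmul x y => simp [mul_comm]
  | add x y hx hy => simp only [map_add, hx, hy]

lemma hit_conv (f g : Module.Dual ℂ H) (y : H) : hit (conv f g) y = hit f (hit g y) := by
  refine Module.forall_dual_apply_eq_zero_iff ℂ _ |>.mp (fun k => ?_) |> sub_eq_zero.mp
  rw [map_sub, ← conv_eq_hit, ← conv_eq_hit, ← conv_eq_hit, sub_eq_zero]
  have h := congrArg (fun F => F g y) (actO_conv k f)
  exact h.symm

lemma hit_one (f : Module.Dual ℂ H) : hit f 1 = f 1 • (1 : H) := by
  rw [hit_apply, Bialgebra.comul_one, Algebra.TensorProduct.one_def, TensorProduct.comm_tmul,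
    contract_tmul]

variable {R : UniversalRMatrix H}

lemma drinfeldMap_eq (f : Module.Dual ℂ H) :
    R.drinfeldMap f = ∑ i, ∑ j, f (R.a i * R.b j) • (R.b i * R.a j) := by
  rw [UniversalRMatrix.drinfeldMap, contractWith_apply, R.RR'_eq]
  simp

/-- Ψ carries the coadjoint action to the adjoint one and is injective, so a central image forces an
invariant form. -/
lemma isTwisted_of_central (hR : R.IsFactorizable) {f : Module.Dual ℂ H}
    (hf : ∀ x, R.drinfeldMap f * x = x * R.drinfeldMap f) : IsTwisted f :=
  isTwisted_of_adj fun h => adj_of_central hR hf f rfl h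

/-- Convolving S(h')zh'' = ε(h)z with the identity on the left cancels the antipode and leaves zx =
xz. -/
lemma central_of_adj {z : H}
    (hz : ∀ h : H, legs (LinearMap.mulRight ℂ z ∘ₗ antipode ℂ) LinearMap.id (comul h) =
      counit (R := ℂ) h • z) (x : H) : z * x = x * z := by
  have h1 : toConv (antipode ℂ) * cst H H z * toConv LinearMap.id = cst H H z := by
    have h2 : toConv (antipode ℂ) * cst H H z =
      toConv (LinearMap.mulRight ℂ z ∘ₗ antipode ℂ) := convAlg_ext fun x => mul_cst_apply _ _ _
    rw [h2]
    exact convAlg_ext hz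
  have h3 := congrArg (fun F : ConvAlg H H => ((toConv LinearMap.id : ConvAlg H H) * F) x) h1
  simp only [mul_cst_apply] at h3
  rw [← mul_assoc, ← mul_assoc, LinearMap.id_mul_antipode, one_mul, cst_mul_apply] at h3
  exact h3

lemma contract_mul_tmul (f : Module.Dual ℂ H) (X : H ⊗[ℂ] H) (x y : H) :
    contract f (X * (x ⊗ₜ y)) = contract (actH x f) X * y := by
  induction X with
  | zero => simp
  | tmul a b => simp
  | add a b ha hb => rw [add_mul, map_add, map_add, ha, hb, add_mul]

variable (R) in
lemma comm_R : Algebra.TensorProduct.comm ℂ H H (R.R : H ⊗[ℂ] H) = R.R' := rfl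

variable (R) in
lemma comm_R' : Algebra.TensorProduct.comm ℂ H H (R.R' : H ⊗[ℂ] H) = R.R := by
  rw [← comm_R, R.R_eq]
  simp

variable (v : RibbonElement R)

lemma comm_comul_inv : TensorProduct.comm ℂ H H (comul (R := ℂ) (↑v.v⁻¹ : H)) =
    (R.R : H ⊗[ℂ] H) * (R.R' : H ⊗[ℂ] H) * ((↑v.v⁻¹ : H) ⊗ₜ[ℂ] (↑v.v⁻¹ : H)) := by
  rw [v.comul_inv]
  change Algebra.TensorProduct.comm ℂ H H _ = _
  rw [map_mul, Units.val_mul, map_mul, comm_R, comm_R', Algebra.TensorProduct.comm_tmul]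

lemma comm_comul_ribbon : TensorProduct.comm ℂ H H (comul (R := ℂ) (v.v : H)) =
    (↑(R.R * R.R')⁻¹ : H ⊗[ℂ] H) * ((v.v : H) ⊗ₜ[ℂ] (v.v : H)) := by
  rw [v.comul_eq]
  change Algebra.TensorProduct.comm ℂ H H _ = _
  have h1 : Algebra.TensorProduct.comm ℂ H H (↑R.R⁻¹ : H ⊗[ℂ] H) = ↑R.R'⁻¹ := by
    rw [R.R_inv_eq, R.R'_inv_eq]
    simp
  have h2 : Algebra.TensorProduct.comm ℂ H H (↑R.R'⁻¹ : H ⊗[ℂ] H) = ↑R.R⁻¹ := by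
    rw [R.R_inv_eq, R.R'_inv_eq]
    simp
  rw [map_mul, mul_inv_rev, Units.val_mul, map_mul, mul_inv_rev, Units.val_mul, h1, h2,
    Algebra.TensorProduct.comm_tmul]

/-- Since Δ(v⁻¹) is the double braiding up to central factors, hitting v⁻¹ by f is Ψ of a shift of
f. Under factorizability f is therefore determined by what it does to v⁻¹ alone. -/
lemma hit_inv (f : Module.Dual ℂ H) :
    hit f (↑v.v⁻¹ : H) = R.drinfeldMap (actH (↑v.v⁻¹ : H) f) * ↑v.v⁻¹ := by
  rw [hit_apply, comm_comul_inv, contract_mul_tmul]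
  rfl

/-- The counterpart at v, where the inverse double braiding appears; `antipode_contract_inv` brings
it back to Ψ. -/
lemma hit_ribbon (f : Module.Dual ℂ H) :
    hit f (v.v : H) = contract (actH (v.v : H) f) (↑(R.R * R.R')⁻¹ : H ⊗[ℂ] H) * v.v := by
  rw [hit_apply, comm_comul_ribbon, contract_mul_tmul]

/-- `bᵢ ⊗ S²(aᵢ) = g⁻¹ bᵢ g ⊗ aᵢ`. -/
lemma sum_b_antipode_sq {M : Type*} [AddCommGroup M] [Module ℂ M] (F : H →ₗ[ℂ] H →ₗ[ℂ] M) :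
    ∑ i, F (R.b i) (antipode ℂ (antipode ℂ (R.a i))) =
      ∑ i, F (↑v.pivot⁻¹ * R.b i * v.pivot) (R.a i) := by
  set F' : H ⊗[ℂ] H →ₗ[ℂ] M := TensorProduct.lift
    (F ∘ₗ LinearMap.mulLeft ℂ (↑v.pivot⁻¹ : H) ∘ₗ LinearMap.mulRight ℂ (v.pivot : H)).flip
  have h1 := R.sum_map_antipode F'
  have h2 := R.sum_map_antipode (F' ∘ₗ TensorProduct.map (antipode ℂ) (antipode ℂ))
  simp only [LinearMap.comp_apply, TensorProduct.map_tmul] at h2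
  rw [h1] at h2
  simp only [F', TensorProduct.lift.tmul, LinearMap.flip_apply, LinearMap.comp_apply,
    LinearMap.mulLeft_apply, LinearMap.mulRight_apply, v.antipode_sq (R.b _)] at h2
  simpa [mul_assoc] using h2

/-- Expanding the inverse double braiding by R⁻¹ = (S ⊗ id)(R) and applying S leaves antipodes in
both copies of R. The invariance of R under S ⊗ S clears one copy; in the other S² is transferred to
the first leg as a conjugation by g, which twistedness of f absorbs. -/
lemma antipode_contract_inv (v : RibbonElement R) {f : Module.Dual ℂ H} (hf : IsTwisted f) :
    antipode ℂ (contract f (↑(R.R * R.R')⁻¹ : H ⊗[ℂ] H)) = R.drinfeldMap f := by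
  have h1 : antipode ℂ (contract f (↑(R.R * R.R')⁻¹ : H ⊗[ℂ] H)) =
      ∑ i, ∑ j, f (R.b i * antipode ℂ (R.a j)) •
        (antipode ℂ (R.b j) * antipode ℂ (antipode ℂ (R.a i))) := by
    rw [mul_inv_rev, Units.val_mul, R.R_inv_eq, R.R'_inv_eq, Finset.sum_mul_sum]
    simp [antipode_mul_antidistrib]
  have h2 : ∀ i, ∑ j, f (R.b i * antipode ℂ (R.a j)) •
        (antipode ℂ (R.b j) * antipode ℂ (antipode ℂ (R.a i))) =
      ∑ j, f (R.b i * R.a j) • (R.b j * antipode ℂ (antipode ℂ (R.a i))) := by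
    intro i
    have h := R.sum_map_antipode (LinearMap.mulRight ℂ (antipode ℂ (antipode ℂ (R.a i))) ∘ₗ
      contract (f ∘ₗ LinearMap.mulLeft ℂ (R.b i)))
    simpa using h
  have h3 : ∀ j, ∑ i, f (R.b i * R.a j) • (R.b j * antipode ℂ (antipode ℂ (R.a i))) =
      ∑ i, f (R.a j * R.b i) • (R.b j * R.a i) := by
    intro j
    have h := sum_b_antipode_sq v (LinearMap.mk₂ ℂ
      (fun y x => f (y * R.a j) • (R.b j * x))
      (fun y z x => by rw [add_mul, map_add, add_smul])
      (fun c y x => by rw [smul_mul_assoc, map_smul, smul_assoc])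
      (fun y x z => by rw [mul_add, smul_add])
      (fun c y x => by rw [mul_smul_comm, smul_comm]))
    simp only [LinearMap.mk₂_apply] at h
    rw [h]
    refine Finset.sum_congr rfl fun i _ => ?_
    rw [hf (R.a j), v.antipode_sq, mul_assoc, mul_assoc, hf (↑v.pivot⁻¹ : H),
      v.antipode_pivot_inv, v.antipode_pivot]
    simp only [mul_assoc]
  rw [h1, drinfeldMap_eq, Finset.sum_congr rfl fun i _ => h2 i, Finset.sum_comm,
    Finset.sum_congr rfl fun j _ => h3 j, Finset.sum_comm]

/-- If `Ψ(φ) = v⁻¹`, then `φ(v⁻¹ ?)` is an integral. -/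
lemma integral (hR : R.IsFactorizable) {φ : Module.Dual ℂ H}
    (hφ : R.drinfeldMap φ = (↑v.v⁻¹ : H)) (y : H) :
    hit (actH (↑v.v⁻¹ : H) φ) y = actH (↑v.v⁻¹ : H) φ y • (1 : H) := by
  -- The argument starts from Ψ⁻¹(v) rather than Ψ⁻¹(v⁻¹): hitting v⁻¹ by t₀ = φ₀(? v) gives vv⁻¹ =
  -- 1.
  obtain ⟨φ₀, hφ₀⟩ := hR.2 v.v
  set t₀ := actH (v.v : H) φ₀ with ht₀
  have hvw : ∀ f : Module.Dual ℂ H, actH (↑v.v⁻¹ : H) (actH (v.v : H) f) = f := fun f => by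
    rw [← Module.End.mul_apply, ← map_mul, Units.inv_mul, map_one, Module.End.one_apply]
  have hone : hit t₀ (↑v.v⁻¹ : H) = 1 := by
    rw [hit_inv, ht₀, hvw, hφ₀, Units.mul_inv]
  -- Both sides have the same effect on v⁻¹, namely β(1)·1, and `hit_inv` says that this effect
  -- determines a form. So t₀ is an integral in H*.
  have hconv : ∀ β : Module.Dual ℂ H, conv β t₀ = β 1 • t₀ := by
    intro β
    have h0 : hit (conv β t₀ - β 1 • t₀) (↑v.v⁻¹ : H) = 0 := by
      rw [hit_sub, hit_conv, hone, hit_one, hit_smul, hone, sub_self]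
    rw [hit_inv, Units.mul_left_eq_zero, ← map_zero R.drinfeldMap] at h0
    have h1 := hR.1 h0
    have h2 : actH (v.v : H) (actH (↑v.v⁻¹ : H) (conv β t₀ - β 1 • t₀)) = 0 := by
      rw [h1, map_zero]
    rw [← Module.End.mul_apply, ← map_mul, Units.mul_inv, map_one, Module.End.one_apply,
      sub_eq_zero] at h2
    exact h2
  have hint : ∀ y, hit t₀ y = t₀ y • (1 : H) := by
    intro y
    rw [← sub_eq_zero, ← Module.forall_dual_apply_eq_zero_iff ℂ]
    intro β
    rw [map_sub, ← conv_eq_hit, hconv, map_smul, LinearMap.smul_apply, smul_eq_mul, smul_eq_mul,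
      mul_comm, sub_self]
  have hφ₀' : IsTwisted φ₀ := isTwisted_of_central hR fun x => by rw [hφ₀, v.central]
  have htw : IsTwisted (actH (v.v : H) t₀) := by
    intro h x
    have hc : ∀ x : H, x * v.v * v.v = v.v * v.v * x := fun x => by
      rw [← v.central x, mul_assoc, ← v.central x, mul_assoc]
    simp only [ht₀, actH_apply]
    rw [mul_assoc, mul_assoc, hφ₀' h, ← mul_assoc, hc, hc, ← mul_assoc]
  -- Comparison with φ: hitting v by the integral t₀ gives the scalar t₀(v), while `hit_ribbon` and
  -- S identify the result with Ψ(t₀(? v)) = t₀(v)v⁻¹. Hence t₀ is proportional to φ(? v⁻¹).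
  have hv : actH (v.v : H) t₀ = t₀ v.v • φ := by
    refine hR.1 ?_
    have h1 := hit_ribbon v t₀
    rw [hint] at h1
    have h2 := congrArg (fun z => antipode ℂ (z * (↑v.v⁻¹ : H))) h1
    simp only [Units.mul_inv_cancel_right, antipode_contract_inv v htw, smul_mul_assoc, one_mul,
      map_smul, v.antipode_inv] at h2
    rw [map_smul, hφ, h2]
  have hv' : t₀ = t₀ v.v • actH (↑v.v⁻¹ : H) φ := by
    rw [← map_smul, ← hv, hvw]
  -- Otherwise t₀ would vanish, contrary to its effect 1 on v⁻¹.
  have hne : t₀ v.v ≠ 0 := by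
    intro h
    rw [h, zero_smul] at hv'
    rw [hv', ← zero_smul ℂ (0 : Module.Dual ℂ H), hit_smul, zero_smul] at hone
    have := congrArg (counit (R := ℂ)) hone
    simp at this
  have h3 := hint y
  generalize t₀ v.v = c at hv' hne
  rw [hv', hit_smul, LinearMap.smul_apply, smul_assoc] at h3
  exact smul_right_injective _ hne h3

end Integral
end
end TorusModular

namespace TorusModular

open scoped TensorProduct
open Coalgebra HopfAlgebra WithConv

noncomputable section

/-! ### Symmetric forms and the Drinfeld map -/

section SymmetricFormsOfRibbon

set_option linter.unusedSectionVars false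

variable {H : Type*} [Ring H] [HopfAlgebra ℂ H] [FiniteDimensional ℂ H]

lemma legs_mul_comm {φ ψ : Module.Dual ℂ H} (hφ : φ ∈ SLF H) (hψ : ψ ∈ SLF H) (X Y : H ⊗[ℂ] H) :
    legs φ ψ (X * Y) = legs φ ψ (Y * X) := by
  induction X with
  | zero => simp
  | add a b ha hb => rw [add_mul, mul_add, map_add, map_add, ha, hb]
  | tmul x y =>
    induction Y with
    | zero => simp
    | add a b ha hb => rw [add_mul, mul_add, map_add, map_add, ha, hb]
    | tmul x' y' => simp [hφ x x', hψ y y']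

lemma conv_mem_SLF {φ ψ : Module.Dual ℂ H} (hφ : φ ∈ SLF H) (hψ : ψ ∈ SLF H) :
    conv φ ψ ∈ SLF H := by
  intro x y
  rw [conv, LinearMap.comp_apply, LinearMap.comp_apply, Bialgebra.comul_mul,
    Bialgebra.comul_mul]
  exact legs_mul_comm hφ hψ _ _

lemma actH_mem_SLF {z : H} (hz : ∀ x, z * x = x * z) {ψ : Module.Dual ℂ H} (hψ : ψ ∈ SLF H) :
    actH z ψ ∈ SLF H := by
  intro x y
  rw [actH_apply, actH_apply, mul_assoc, hψ, mul_assoc, hz, mul_assoc]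

variable {R : UniversalRMatrix H}

/-- The product of symmetric linear forms is commutative. -/
lemma conv_comm_of_mem_SLF (R : UniversalRMatrix H) {φ ψ : Module.Dual ℂ H} (hφ : φ ∈ SLF H) (hψ : ψ ∈ SLF H) :
    conv φ ψ = conv ψ φ := by
  ext y
  have h1 : ∀ X : H ⊗[ℂ] H, legs ψ φ X = legs φ ψ (TensorProduct.comm ℂ H H X) := by
    intro X
    induction X with
    | zero => simp
    | tmul x y => simp [mul_comm]
    | add x y hx hy => simp only [map_add, hx, hy]
  -- R conjugates Δ(y) into Δᵒᵖ(y), and a product of two symmetric forms does not see this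
  -- conjugation.
  have h2 : TensorProduct.comm ℂ H H (comul (R := ℂ) y) =
      (R.R : H ⊗[ℂ] H) * (comul y * (↑R.R⁻¹ : H ⊗[ℂ] H)) := by
    rw [← mul_assoc, ← R.comul_op, Units.mul_inv_cancel_right]
  rw [conv, conv, LinearMap.comp_apply, LinearMap.comp_apply, h1, h2, legs_mul_comm hφ hψ,
    mul_assoc, Units.inv_mul, mul_one]

lemma counit_drinfeldMap (β : Module.Dual ℂ H) : counit (R := ℂ) (R.drinfeldMap β) = β 1 := by
  have h : ∀ i, ∑ j, β (R.a i * R.b j) * (counit (R := ℂ) (R.b i) * counit (R := ℂ) (R.a j)) =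
      β (counit (R := ℂ) (R.b i) • R.a i) := by
    intro i
    have h := congrArg (fun z => β (counit (R := ℂ) (R.b i) • (R.a i * z))) R.sum_counit_a
    simp only [mul_one] at h
    rw [← h, Finset.mul_sum, Finset.smul_sum, map_sum]
    refine Finset.sum_congr rfl fun j _ => ?_
    simp only [mul_smul_comm, map_smul, smul_eq_mul]
    ring
  rw [drinfeldMap_eq]
  simp only [map_sum, map_smul, Bialgebra.counit_mul, smul_eq_mul]
  rw [Finset.sum_congr rfl fun i _ => h i, ← map_sum, R.sum_counit_b]

/-- In (Δ ⊗ id)(RR') = R₁₃(RR')₂₃R'₁₃ the outer copy of RR' can be summed first. If that sum is a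
bilinear expression in the inner legs, a single copy of RR' remains. -/
lemma lift_rTensor_comul_RR' {M : Type*} [AddCommGroup M] [Module ℂ M]
    (T : H →ₗ[ℂ] H →ₗ[ℂ] H →ₗ[ℂ] M) (F : H →ₗ[ℂ] H →ₗ[ℂ] M)
    (h : ∀ x y, ∑ i, ∑ j, T (R.a i * R.b j) x (R.b i * (y * R.a j)) = F x y) :
    TensorProduct.lift (TensorProduct.lift T)
        (LinearMap.rTensor H comul ((R.R : H ⊗[ℂ] H) * (R.R' : H ⊗[ℂ] H))) =
      TensorProduct.lift F ((R.R : H ⊗[ℂ] H) * (R.R' : H ⊗[ℂ] H)) := by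
  rw [R.rTensor_comul_RR']
  induction ((R.R : H ⊗[ℂ] H) * (R.R' : H ⊗[ℂ] H)) with
  | zero => simp
  | tmul x y => simpa using h x y
  | add x y hx hy => simp only [map_add, ← hx, ← hy, Finset.sum_add_distrib]

/-- The analogue for R'₂₃(R'R)₁₃R₂₃: now the outer copy occupies the legs 2 and 3. -/
lemma lift_rTensor_comul_R'R {M : Type*} [AddCommGroup M] [Module ℂ M]
    (T : H →ₗ[ℂ] H →ₗ[ℂ] H →ₗ[ℂ] M) (F : H →ₗ[ℂ] H →ₗ[ℂ] M)
    (h : ∀ x y, ∑ i, ∑ j, T x (R.b i * R.a j) (R.a i * (y * R.b j)) = F x y) :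
    TensorProduct.lift (TensorProduct.lift T)
        (LinearMap.rTensor H comul ((R.R' : H ⊗[ℂ] H) * (R.R : H ⊗[ℂ] H))) =
      TensorProduct.lift F ((R.R' : H ⊗[ℂ] H) * (R.R : H ⊗[ℂ] H)) := by
  rw [R.rTensor_comul_R'R]
  induction ((R.R' : H ⊗[ℂ] H) * (R.R : H ⊗[ℂ] H)) with
  | zero => simp
  | tmul x y => simpa using h x y
  | add x y hx hy => simp only [map_add, ← hx, ← hy, Finset.sum_add_distrib]

/-- The trilinear map `(x, y, z) ↦ f(x, z) p(y)`. -/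
def trilin {M : Type*} [AddCommGroup M] [Module ℂ M] (f : H →ₗ[ℂ] H →ₗ[ℂ] ℂ) (p : H →ₗ[ℂ] M) :
    H →ₗ[ℂ] H →ₗ[ℂ] H →ₗ[ℂ] M :=
  LinearMap.mk₂ ℂ (fun x y => (f x).smulRight (p y))
    (fun x x' y => by ext; simp [add_smul]) (fun c x y => by ext; simp [mul_smul])
    (fun x y y' => by ext; simp) (fun c x y => LinearMap.ext fun z => by
      simp only [LinearMap.smulRight_apply, map_smul, LinearMap.smul_apply]
      exact smul_comm _ _ _)

@[simp] lemma trilin_apply {M : Type*} [AddCommGroup M] [Module ℂ M] (f : H →ₗ[ℂ] H →ₗ[ℂ] ℂ)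
    (p : H →ₗ[ℂ] M) (x y z : H) : trilin f p x y z = f x z • p y := rfl

/-- If `Ψ(t)` is central, then `Ψ(β t) = Ψ(β) Ψ(t)`. -/
lemma drinfeldMap_conv {t : Module.Dual ℂ H}
    (ht : ∀ x, R.drinfeldMap t * x = x * R.drinfeldMap t) (β : Module.Dual ℂ H) :
    R.drinfeldMap (conv β t) = R.drinfeldMap β * R.drinfeldMap t := by
  set T : H →ₗ[ℂ] H →ₗ[ℂ] H →ₗ[ℂ] H := β.smulRight (t.smulRight LinearMap.id) with hT
  have h1 : R.drinfeldMap (conv β t) = TensorProduct.lift (TensorProduct.lift T)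
      (LinearMap.rTensor H comul ((R.R : H ⊗[ℂ] H) * (R.R' : H ⊗[ℂ] H))) := by
    rw [UniversalRMatrix.drinfeldMap, contractWith_apply]
    induction ((R.R : H ⊗[ℂ] H) * (R.R' : H ⊗[ℂ] H)) with
    | zero => simp
    | tmul x y =>
      rw [contract_tmul, LinearMap.rTensor_tmul, TensorProduct.lift.tmul, conv,
        LinearMap.comp_apply]
      induction (comul x : H ⊗[ℂ] H) with
      | zero => simp
      | tmul x y => simp [hT, mul_smul]
      | add x y hx hy => simp only [map_add, add_smul, LinearMap.add_apply, hx, hy]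
    | add x y hx hy => simp only [map_add, hx, hy]
  rw [h1, R.rTensor_comul_RR']
  have h2 : ∀ i j, TensorProduct.lift (TensorProduct.lift T)
      (wrapOuter (R.a i * R.b j) (R.b i) (R.a j) ((R.R : H ⊗[ℂ] H) * (R.R' : H ⊗[ℂ] H))) =
      β (R.a i * R.b j) • (R.b i * R.a j) * R.drinfeldMap t := by
    intro i j
    -- The inner copy of RR' contracts to Ψ(t), sandwiched between bᵢ and aⱼ; centrality lets it
    -- out.
    have h3 : R.b i * (R.drinfeldMap t * R.a j) = R.b i * R.a j * R.drinfeldMap t := by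
      rw [ht, mul_assoc]
    rw [smul_mul_assoc, ← h3, UniversalRMatrix.drinfeldMap, contractWith_apply]
    induction ((R.R : H ⊗[ℂ] H) * (R.R' : H ⊗[ℂ] H)) with
    | zero => simp
    | tmul x y => simp [hT]
    | add x y hx hy => simp only [map_add, add_mul, mul_add, smul_add, hx, hy]
  simp only [map_sum, h2]
  rw [drinfeldMap_eq β, Finset.sum_mul]
  simp only [Finset.sum_mul]

variable (v : RibbonElement R)

/-- As S² is conjugation by g, a shift by g turns cyclicity into twisted cyclicity;
`actH_pivot_inv_mem_SLF` is the way back. -/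
lemma isTwisted_actH_pivot {χ : Module.Dual ℂ H} (hχ : χ ∈ SLF H) (h x : H) :
    χ (h * x * v.pivot) = χ (x * antipode ℂ (antipode ℂ h) * v.pivot) := by
  rw [v.antipode_sq, mul_assoc, hχ]
  simp [mul_assoc]

lemma actH_pivot_inv_mem_SLF {f : Module.Dual ℂ H} (hf : IsTwisted f) :
    actH (↑v.pivot⁻¹ : H) f ∈ SLF H := by
  intro x y
  rw [actH_apply, actH_apply, mul_assoc, hf, v.antipode_sq]
  simp [mul_assoc]

/-- The elements `Ψ(χ(? g))`, with `χ` symmetric, are central. -/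
lemma drinfeldMap_pivot_central {χ : Module.Dual ℂ H} (hχ : χ ∈ SLF H) (x : H) :
    R.drinfeldMap (actH (v.pivot : H) χ) * x = x * R.drinfeldMap (actH (v.pivot : H) χ) := by
  refine central_of_adj (fun h => ?_) x
  -- Centrality of the image is reduced to invariance of the form χ(? g), which follows from its
  -- twisted cyclicity.
  rw [← drinfeldMap_adj, ← map_smul]
  congr 1
  ext y
  have h1 : ∀ Z : H ⊗[ℂ] H, actH (v.pivot : H) χ (legs (LinearMap.mul ℂ H)
      ((LinearMap.mul ℂ H).flip ∘ₗ antipode ℂ) Z y) =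
      χ (y * antipode ℂ (legs (antipode ℂ) LinearMap.id Z) * v.pivot) := by
    intro Z
    induction Z with
    | zero => simp
    | tmul p q =>
      have := isTwisted_actH_pivot v hχ p (y * antipode ℂ q)
      simp only [mul_assoc] at this
      simp [antipode_mul_antidistrib, mul_assoc, this]
    | add Z W hZ hW =>
      simp only [map_add, LinearMap.add_apply, mul_add, add_mul, hZ, hW]
  refine (h1 (comul h)).trans ?_
  rw [legs_antipode_id]
  simp [Algebra.algebraMap_eq_smul_one]

lemma actH_pivot_conv (φ ψ : Module.Dual ℂ H) :
    actH (v.pivot : H) (conv φ ψ) = conv (actH (v.pivot : H) φ) (actH (v.pivot : H) ψ) := by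
  have hg : comul (R := ℂ) (v.pivot : H) = (v.pivot : H) ⊗ₜ[ℂ] (v.pivot : H) := by
    refine left_inv_eq_right_inv (a := comul (R := ℂ) (↑v.pivot⁻¹ : H)) ?_ ?_
    · rw [← Bialgebra.comul_mul, Units.mul_inv, Bialgebra.comul_one]
    · rw [v.comul_pivot_inv]
      simp [Algebra.TensorProduct.one_def]
  ext y
  rw [actH_apply, conv, conv, LinearMap.comp_apply, LinearMap.comp_apply, Bialgebra.comul_mul, hg]
  induction (comul y : H ⊗[ℂ] H) with
  | zero => simp
  | tmul x y => simp
  | add x y hx hy => rw [add_mul, map_add, map_add, hx, hy]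

/-- R is invariant under S² ⊗ S², i.e. commutes with g ⊗ g. -/
lemma sum_b_pivot_inv {M : Type*} [AddCommGroup M] [Module ℂ M] (F : H →ₗ[ℂ] H →ₗ[ℂ] M) :
    ∑ i, F (R.b i * ↑v.pivot⁻¹) (R.a i * ↑v.pivot⁻¹) =
      ∑ i, F (↑v.pivot⁻¹ * R.b i) (↑v.pivot⁻¹ * R.a i) := by
  set F' : H ⊗[ℂ] H →ₗ[ℂ] M := TensorProduct.lift
    (F.compl₁₂ (LinearMap.mulLeft ℂ (↑v.pivot⁻¹ : H)) (LinearMap.mulLeft ℂ (↑v.pivot⁻¹ : H))).flip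
  have h1 := R.sum_map_antipode F'
  have h2 := R.sum_map_antipode (F' ∘ₗ TensorProduct.map (antipode ℂ) (antipode ℂ))
  simp only [LinearMap.comp_apply, TensorProduct.map_tmul] at h2
  rw [h1] at h2
  simp only [F', TensorProduct.lift.tmul, LinearMap.flip_apply, LinearMap.compl₁₂_apply,
    LinearMap.mulLeft_apply, v.antipode_sq] at h2
  simpa [mul_assoc] using h2

/-- The Yang–Baxter equation on legs 1, 3, 2, contracted on the first two legs by χ(x g⁻¹ y g). On
either side one of the three copies of R then closes up to v⁻¹, by aₖg⁻¹bₖ = v⁻¹ or bₖgaₖ = v⁻¹. -/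
lemma sum_yangBaxter_ribbon {χ : Module.Dual ℂ H} (hχ : χ ∈ SLF H) :
    ∑ i, ∑ j, χ (↑v.v⁻¹ * (R.a i * R.b j * v.pivot)) • (R.b i * R.a j) =
      ∑ i, ∑ j, χ (↑v.v⁻¹ * (R.a i * ↑v.pivot⁻¹ * R.b j)) • (R.a j * R.b i) := by
  set i₁ : H →ₐ[ℂ] (H ⊗[ℂ] H) ⊗[ℂ] H := Algebra.TensorProduct.includeLeft.comp
    Algebra.TensorProduct.includeLeft with hi₁
  set i₂ : H →ₐ[ℂ] (H ⊗[ℂ] H) ⊗[ℂ] H := Algebra.TensorProduct.includeLeft.comp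
    Algebra.TensorProduct.includeRight with hi₂
  set i₃ : H →ₐ[ℂ] (H ⊗[ℂ] H) ⊗[ℂ] H := Algebra.TensorProduct.includeRight with hi₃
  have yb := yangBaxter R i₁ i₃ i₂ (fun x y => by simp [i₁, i₃, Commute, SemiconjBy])
    (fun x y => by simp [i₁, i₂, Commute, SemiconjBy])
    (fun x y => by simp [i₃, i₂, Commute, SemiconjBy])
  set G : (H ⊗[ℂ] H) ⊗[ℂ] H →ₗ[ℂ] H := contract
    (χ ∘ₗ legs (LinearMap.mulRight ℂ (↑v.pivot⁻¹ : H)) (LinearMap.mulRight ℂ (v.pivot : H))) with hG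
  have hG' : ∀ x y z, G ((x ⊗ₜ y) ⊗ₜ z) = χ (x * ↑v.pivot⁻¹ * (y * v.pivot)) • z :=
    fun x y z => by simp [hG]
  rw [R.legs_R_eq, R.legs_R_eq, R.legs_R_eq] at yb
  simp only [Finset.sum_mul_sum, AlgHom.toLinearMap_apply] at yb
  have h1 : ∀ i j k, i₁ (R.a i) * i₃ (R.b i) * (i₁ (R.a j) * i₂ (R.b j)) *
      (i₃ (R.a k) * i₂ (R.b k)) =
      ((R.a i * R.a j) ⊗ₜ (R.b j * R.b k)) ⊗ₜ (R.b i * R.a k) := fun i j k => by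
    simp [i₁, i₂, i₃]
  have h2 : ∀ i j k, i₃ (R.a i) * i₂ (R.b i) * (i₁ (R.a j) * i₂ (R.b j)) *
      (i₁ (R.a k) * i₃ (R.b k)) =
      ((R.a j * R.a k) ⊗ₜ (R.b i * R.b j)) ⊗ₜ (R.a i * R.b k) := fun i j k => by
    simp [i₁, i₂, i₃]
  have yb' := congrArg G yb
  simp only [Finset.sum_mul, h1, h2, map_sum, hG'] at yb'
  have e1 : ∀ i j, χ (↑v.v⁻¹ * (R.a i * R.b j * v.pivot)) =
      ∑ k, χ (R.a i * R.a k * ↑v.pivot⁻¹ * (R.b k * R.b j * v.pivot)) := by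
    intro i j
    rw [← mul_assoc, ← mul_assoc, v.inv_central, ← v.sum_a_pivot_inv_b]
    simp only [Finset.mul_sum, Finset.sum_mul, map_sum, mul_assoc]
  have e2 : ∀ i j, χ (↑v.v⁻¹ * (R.a i * ↑v.pivot⁻¹ * R.b j)) =
      ∑ k, χ (R.a k * R.a i * ↑v.pivot⁻¹ * (R.b j * R.b k * v.pivot)) := by
    intro i j
    rw [← v.sum_b_pivot_a]
    simp only [Finset.sum_mul, map_sum]
    refine Finset.sum_congr rfl fun k _ => ?_
    rw [mul_assoc (R.b k * _), hχ]
    simp only [mul_assoc]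
  simp only [e1, e2, Finset.sum_smul]
  rw [yb', Finset.sum_comm]

/-- For symmetric `χ`, `χ(aᵢ g⁻¹ bⱼ) aⱼ bᵢ = Ψ(χ(? g))`. -/
lemma sum_pivot_inv_eq_drinfeldMap {χ : Module.Dual ℂ H} (hχ : χ ∈ SLF H) :
    ∑ i, ∑ j, χ (R.a i * ↑v.pivot⁻¹ * R.b j) • (R.a j * R.b i) =
      R.drinfeldMap (actH (v.pivot : H) χ) := by
  -- Applied to χ(? v), so that the factor v⁻¹ cancels.
  have h := sum_yangBaxter_ribbon v (actH_mem_SLF v.central hχ)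
  have hc : ∀ x : H, ↑v.v⁻¹ * x * v.v = x := fun x => by
    rw [v.inv_central, Units.inv_mul_cancel_right]
  simp only [actH_apply, hc] at h
  rw [← h, drinfeldMap_eq]
  rfl

/-- Passing from R'R to RR' costs only moving g: Ψ(χ(? g)) can also be computed from R'R with the
form χ(g⁻¹ ?). The later computations produce this second form. -/
lemma contract_R'R {χ : Module.Dual ℂ H} (hχ : χ ∈ SLF H) :
    contract (actL (↑v.pivot⁻¹ : H) χ) ((R.R' : H ⊗[ℂ] H) * (R.R : H ⊗[ℂ] H)) =
      R.drinfeldMap (actH (v.pivot : H) χ) := by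
  rw [← sum_pivot_inv_eq_drinfeldMap v hχ, R.R'R_eq, Finset.sum_comm]
  simp only [map_sum, contract_tmul, actL_apply]
  refine Finset.sum_congr rfl fun i _ => Finset.sum_congr rfl fun j _ => ?_
  rw [← mul_assoc, hχ, ← mul_assoc]

/-- The product `ψ ↦ σ ψ` is injective on symmetric forms, where `Ψ(σ(? g)) = v⁻¹`. -/
lemma eq_zero_of_conv_eq_zero (hR : R.IsFactorizable) {σ χ : Module.Dual ℂ H} (hχ : χ ∈ SLF H)
    (hσ : R.drinfeldMap (actH (v.pivot : H) σ) = (↑v.v⁻¹ : H)) (h : conv σ χ = 0) : χ = 0 := by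
  -- Under Ψ and the shift by the group-like g, the product by σ becomes multiplication by the
  -- invertible element v⁻¹.
  have h1 := drinfeldMap_conv (drinfeldMap_pivot_central v hχ) (actH (v.pivot : H) σ)
  rw [← actH_pivot_conv, h, map_zero, map_zero, hσ, eq_comm, Units.mul_right_eq_zero,
    ← map_zero R.drinfeldMap] at h1
  have h2 := congrArg (actH (↑v.pivot⁻¹ : H)) (hR.1 h1)
  rwa [← Module.End.mul_apply, ← map_mul, Units.inv_mul, map_one, Module.End.one_apply,
    map_zero] at h2

end SymmetricFormsOfRibbon
end
end TorusModular

namespace TorusModular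

open scoped TensorProduct
open Coalgebra HopfAlgebra WithConv

noncomputable section

/-! ### Products with the integral and the action of B -/

section OperatorsOnSymmetricForms

set_option linter.unusedSectionVars false

variable {H : Type*} [Ring H] [HopfAlgebra ℂ H] [FiniteDimensional ℂ H]
  {R : UniversalRMatrix H} (v : RibbonElement R)

/-- `φ(? x) ψ(? y)` as a bilinear expression in `x, y`. -/
def shiftConv (φ ψ : Module.Dual ℂ H) : H →ₗ[ℂ] H →ₗ[ℂ] Module.Dual ℂ H :=
  LinearMap.compl₁₂ (actO (H := H)) (dualShift φ) (dualShift ψ)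

@[simp] lemma shiftConv_apply (φ ψ : Module.Dual ℂ H) (x y : H) :
    shiftConv φ ψ x y = conv (dualShift φ x) (dualShift ψ y) := rfl

lemma lift_shiftConv (φ ψ : Module.Dual ℂ H) (X : H ⊗[ℂ] H) (y : H) :
    TensorProduct.lift (shiftConv φ ψ) X y = legs φ ψ (comul y * X) := by
  induction X with
  | zero => simp
  | add a b ha hb => rw [map_add, LinearMap.add_apply, mul_add, map_add, ha, hb]
  | tmul a b =>
    rw [TensorProduct.lift.tmul, shiftConv_apply, conv, LinearMap.comp_apply]
    induction (comul y : H ⊗[ℂ] H) with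
    | zero => simp
    | tmul x y => simp
    | add x y hx hy => rw [add_mul, map_add, map_add, hx, hy]

lemma actH_inv_conv_apply (φ ψ : Module.Dual ℂ H) (y : H) :
    actH (↑v.v⁻¹ : H) (conv φ ψ) y =
      legs (actH (↑v.v⁻¹ : H) φ) (actH (↑v.v⁻¹ : H) ψ)
        (comul y * ((R.R' : H ⊗[ℂ] H) * (R.R : H ⊗[ℂ] H))) := by
  rw [actH_apply, conv, LinearMap.comp_apply, Bialgebra.comul_mul, v.comul_inv, Units.val_mul,
    ← mul_assoc]
  induction (comul y * ((R.R' : H ⊗[ℂ] H) * (R.R : H ⊗[ℂ] H))) with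
  | zero => simp
  | tmul x y => simp
  | add x y hx hy => rw [add_mul, map_add, map_add, hx, hy]

/-- Shifting a product by v⁻¹ shifts both factors and inserts R'R, because Δ(v⁻¹) = R'R(v⁻¹ ⊗ v⁻¹).
-/
lemma actH_inv_conv (φ ψ : Module.Dual ℂ H) :
    actH (↑v.v⁻¹ : H) (conv φ ψ) =
      TensorProduct.lift (shiftConv (actH (↑v.v⁻¹ : H) φ) (actH (↑v.v⁻¹ : H) ψ))
        ((R.R' : H ⊗[ℂ] H) * (R.R : H ⊗[ℂ] H)) := by
  ext y
  rw [actH_inv_conv_apply, lift_shiftConv]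

/-- Since θ is symmetric, y'θ(y''x) = y'θ(xy''); inserting S(x')x'' in front of the first factor
completes the coproduct of the product with y. -/
lemma hit_actH {θ : Module.Dual ℂ H} (hθ : θ ∈ SLF H) (x y : H) :
    hit (actH x θ) y = legs (antipode ℂ) (hit θ ∘ₗ LinearMap.mulRight ℂ y) (comul x) := by
  set i₁ : H →ₐ[ℂ] H ⊗[ℂ] H := Algebra.TensorProduct.includeLeft with hi₁
  set i₂ : H →ₐ[ℂ] H ⊗[ℂ] H := Algebra.TensorProduct.includeRight with hi₂
  have h1 : toConv (convInv i₂) * (toConv i₂.toLinearMap * toConv i₁.toLinearMap) =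
      toConv i₁.toLinearMap := by
    rw [← mul_assoc, convInv_mul_toConv, one_mul]
  have h2 : toConv i₂.toLinearMap * toConv i₁.toLinearMap =
      toConv ((TensorProduct.comm ℂ H H).toLinearMap ∘ₗ comul) := by
    refine convAlg_ext fun z => ?_
    change legs _ _ (comul z) = TensorProduct.comm ℂ H H (comul z)
    induction (comul z : H ⊗[ℂ] H) with
    | zero => simp
    | tmul x y => simp [i₁, i₂]
    | add x y hx hy => rw [map_add, map_add, hx, hy]
  rw [h2] at h1
  have h3 := congrArg (fun F : ConvAlg H (H ⊗[ℂ] H) =>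
    contract θ (F x * TensorProduct.comm ℂ H H (comul y))) h1
  have h4 : ∀ A : H ⊗[ℂ] H, contract θ ((x ⊗ₜ 1) * A) = contract (actH x θ) A := by
    intro A
    induction A with
    | zero => simp
    | tmul a b => simp [hθ x a]
    | add a b ha hb => rw [mul_add, map_add, map_add, ha, hb]
  have h5 : ∀ Z : H ⊗[ℂ] H, contract θ (legs (convInv i₂)
      ((TensorProduct.comm ℂ H H).toLinearMap ∘ₗ comul) Z * TensorProduct.comm ℂ H H (comul y)) =
      legs (antipode ℂ) (hit θ ∘ₗ LinearMap.mulRight ℂ y) Z := by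
    intro Z
    induction Z with
    | zero => simp
    | add a b ha hb => rw [map_add, map_add, add_mul, map_add, ha, hb]
    | tmul a b =>
      have h6 : ∀ (s : H) (A : H ⊗[ℂ] H), contract θ ((1 ⊗ₜ s) * A) = s * contract θ A := by
        intro s A
        induction A with
        | zero => simp
        | tmul a b => simp
        | add a b ha hb => rw [mul_add, map_add, map_add, ha, hb, mul_add]
      have h7 : TensorProduct.comm ℂ H H (comul (R := ℂ) (b * y)) =
          TensorProduct.comm ℂ H H (comul b) * TensorProduct.comm ℂ H H (comul y) := by
        rw [Bialgebra.comul_mul]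
        exact map_mul (Algebra.TensorProduct.comm ℂ H H) _ _
      rw [legs_tmul, legs_tmul, LinearMap.comp_apply, LinearMap.comp_apply,
        LinearMap.mulRight_apply, hit_apply, h7, ← h6, mul_assoc]
      rfl
  rw [hit_apply, ← h4]
  exact h3.symm.trans (h5 _)

/-- The shift of θ by g is the integral of `integral`, and g is group-like; undoing the shift
replaces 1 by g. -/
lemma hit_actH_inv (hR : R.IsFactorizable) {σ : Module.Dual ℂ H}
    (hσ : R.drinfeldMap (actH (v.pivot : H) σ) = (↑v.v⁻¹ : H)) (y : H) :
    hit (actH (↑v.v⁻¹ : H) σ) y = actH (↑v.v⁻¹ : H) σ y • (v.pivot : H) := by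
  set t := actH (↑v.v⁻¹ : H) (actH (v.pivot : H) σ) with ht
  have hθ : actH (↑v.v⁻¹ : H) σ = actH (↑v.pivot⁻¹ : H) t := by
    ext x
    simp only [ht, actH_apply]
    rw [mul_assoc (x * _), v.inv_central, mul_assoc x, Units.inv_mul_cancel_left]
  have h1 := integral v hR hσ (y * ↑v.pivot⁻¹)
  have h2 : hit t (y * ↑v.pivot⁻¹) = hit (actH (↑v.pivot⁻¹ : H) t) y * ↑v.pivot⁻¹ := by
    rw [hit_apply, hit_apply, ← contract_mul_tmul, Bialgebra.comul_mul, v.comul_pivot_inv]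
    congr 1
    exact map_mul (Algebra.TensorProduct.comm ℂ H H) _ _
  rw [← ht, h2, ← hθ] at h1
  have h3 := congrArg (· * (v.pivot : H)) h1
  simp only [Units.inv_mul_cancel_right, smul_mul_assoc, one_mul] at h3
  rw [h3, hθ]
  rfl

/-- `ρ θ(? x) = ρ(S(x') g) θ(? x'')` for the integral `θ`. -/
lemma conv_actH_inv (hR : R.IsFactorizable) {σ : Module.Dual ℂ H} (hs : σ ∈ SLF H)
    (hσ : R.drinfeldMap (actH (v.pivot : H) σ) = (↑v.v⁻¹ : H)) (ρ : Module.Dual ℂ H) (x : H) :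
    conv ρ (dualShift (actH (↑v.v⁻¹ : H) σ) x) = TensorProduct.lift
      ((ρ ∘ₗ LinearMap.mulRight ℂ (v.pivot : H) ∘ₗ antipode ℂ).smulRight
        (dualShift (actH (↑v.v⁻¹ : H) σ))) (comul x) := by
  have hθ := actH_mem_SLF v.inv_central hs
  ext y
  rw [conv_eq_hit]
  refine (congrArg ρ (hit_actH hθ x y)).trans ?_
  induction (comul x : H ⊗[ℂ] H) with
  | zero => simp
  | add a b ha hb => rw [map_add, map_add, map_add, LinearMap.add_apply, ha, hb]
  | tmul a b =>
    rw [legs_tmul, LinearMap.comp_apply, hit_actH_inv v hR hσ, LinearMap.mulRight_apply, hθ]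
    simp [mul_comm]

/-- For symmetric `σ`, the image of `σ(? g)` in the copy `B` acts by `ψ ↦ (σ ψ(? v))(? v⁻¹)`. -/
lemma actB_eq {σ : Module.Dual ℂ H} (hs : σ ∈ SLF H) (ψ : Module.Dual ℂ H) :
    actB R (actH (v.pivot : H) σ) ψ = actH (↑v.v⁻¹ : H) (conv σ (actH (v.v : H) ψ)) := by
  set φ := actH (v.pivot : H) σ with hφ
  have h1 : actB R φ = ∑ i, ∑ j, actH (R.b i) *
      actO (φ ∘ₗ LinearMap.mulLeft ℂ (R.a i) ∘ₗ LinearMap.mulRight ℂ (R.b j)) * actH (R.a j) := by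
    have h2 : ∀ (a b x y : H) (T : H ⊗[ℂ] Module.End ℂ (Module.Dual ℂ H)),
        contract φ (a ⊗ₜ actH x * T * b ⊗ₜ actH y) = actH x *
          contract (φ ∘ₗ LinearMap.mulLeft ℂ a ∘ₗ LinearMap.mulRight ℂ b) T * actH y := by
      intro a b x y T
      induction T with
      | zero => simp
      | tmul p q => simp [mul_assoc]
      | add p q hp hq => simp only [mul_add, add_mul, map_add, hp, hq]
    rw [actB, contractWith_apply, R.R_eq, R.R'_eq]
    have h3 : ∀ a x : H, inE (a ⊗ₜ x) = a ⊗ₜ actH x := fun a x => rfl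
    simp only [map_sum, h3, Finset.sum_mul, Finset.mul_sum, h2]
    rw [Finset.sum_comm]
    simp only [← contractWith_apply, contractWith_canT]
  ext y
  -- The sum defining the action is rewritten so that it depends on R only through aᵢ ⊗ Δ(bᵢ), apart
  -- from a fixed R'. The formula for (id ⊗ Δ)(R) then applies.
  set G : H ⊗[ℂ] (H ⊗[ℂ] H) →ₗ[ℂ] ℂ := TensorProduct.lift (LinearMap.mk₂ ℂ
    (fun a (Z : H ⊗[ℂ] H) => legs φ ψ ((a ⊗ₜ 1) * (comul y * (R.R' : H ⊗[ℂ] H) *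
      TensorProduct.comm ℂ H H Z)))
    (fun p q Z => by simp only [TensorProduct.add_tmul, add_mul, map_add])
    (fun c p Z => by simp only [← TensorProduct.smul_tmul', smul_mul_assoc, map_smul])
    (fun p Y Z => by simp only [map_add, mul_add])
    (fun c p Z => by simp only [map_smul, mul_smul_comm])) with hG
  have hG' : ∀ a Z, G (a ⊗ₜ Z) = legs φ ψ ((a ⊗ₜ 1) * (comul y * (R.R' : H ⊗[ℂ] H) *
      TensorProduct.comm ℂ H H Z)) := fun a Z => rfl
  have h4 : actB R φ ψ y = ∑ i, G (R.a i ⊗ₜ comul (R.b i)) := by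
    rw [h1]
    simp only [LinearMap.sum_apply]
    refine Finset.sum_congr rfl fun i _ => ?_
    rw [hG', mul_assoc (comul y)]
    -- The flip of Δᵒᵖ(b)R = RΔ(b), which moves R' to the left of the coproduct of bᵢ.
    have h5 : (R.R' : H ⊗[ℂ] H) * TensorProduct.comm ℂ H H (comul (R.b i)) =
        comul (R.b i) * (R.R' : H ⊗[ℂ] H) := by
      have h6 := congrArg (Algebra.TensorProduct.comm ℂ H H) (R.comul_op (R.b i))
      rw [map_mul, map_mul, comm_R] at h6
      rw [← comm_R] at h6 ⊢
      refine Eq.trans ?_ (h6.symm.trans ?_)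
      · rfl
      · congr 1
        exact (TensorProduct.comm ℂ H H).symm_apply_apply _
    rw [h5, R.R'_eq, ← mul_assoc (comul y), ← Bialgebra.comul_mul, Finset.mul_sum, Finset.mul_sum,
      map_sum]
    refine Finset.sum_congr rfl fun j _ => ?_
    simp only [Module.End.mul_apply, actO_apply, actH_apply]
    rw [conv, LinearMap.comp_apply]
    induction (comul (y * R.b i) : H ⊗[ℂ] H) with
    | zero => simp
    | tmul p q => simp
    | add p q hp hq => rw [add_mul, mul_add, map_add, map_add, hp, hq]
  have hvw : actH (↑v.v⁻¹ : H) (actH (v.v : H) ψ) = ψ := by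
    rw [← Module.End.mul_apply, ← map_mul, Units.inv_mul, map_one, Module.End.one_apply]
  rw [h4, ← map_sum, R.sum_comul_b, actH_inv_conv_apply, hvw, ← mul_assoc]
  simp only [map_sum, hG', TensorProduct.comm_tmul]
  rw [R.R_eq, Finset.mul_sum, map_sum, Finset.sum_comm]
  refine Finset.sum_congr rfl fun l _ => ?_
  induction (comul y * (R.R' : H ⊗[ℂ] H)) with
  | zero => simp
  | tmul p q =>
    -- Symmetry of σ rotates aₖ to the end, forming bₖ g aₖ = v⁻¹. The remaining copy of R completes
    -- R'R, the double braiding in Δ(v⁻¹).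
    have h7 : ∀ k, σ (R.a k * R.a l * (p * R.b k) * v.pivot) =
        σ (R.a l * p * (R.b k * v.pivot * R.a k)) := fun k => by
      rw [mul_assoc, mul_assoc, hs]
      simp only [mul_assoc]
    simp only [Algebra.TensorProduct.tmul_mul_tmul, legs_tmul, hφ, actH_apply, h7, one_mul]
    rw [← Finset.sum_mul, ← map_sum, ← Finset.mul_sum, v.sum_b_pivot_a, mul_assoc, hs,
      mul_assoc, mul_assoc, v.inv_central]
  | add p q hp hq =>
    simp only [add_mul, mul_add, map_add, Finset.sum_add_distrib, hp, hq]

end OperatorsOnSymmetricForms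
end
end TorusModular

namespace TorusModular

open scoped TensorProduct
open Coalgebra HopfAlgebra WithConv

noncomputable section

/-! ### Braid relation and Fourier transform -/

section Relations

set_option linter.unusedSectionVars false

variable {H : Type*} [Ring H] [HopfAlgebra ℂ H] [FiniteDimensional ℂ H]
  {R : UniversalRMatrix H} (v : RibbonElement R)

lemma lift_R'R {M : Type*} [AddCommGroup M] [Module ℂ M] (B : H →ₗ[ℂ] H →ₗ[ℂ] M) :
    TensorProduct.lift B ((R.R' : H ⊗[ℂ] H) * (R.R : H ⊗[ℂ] H)) =
      TensorProduct.lift B.flip ((R.R : H ⊗[ℂ] H) * (R.R' : H ⊗[ℂ] H)) := by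
  rw [R.R'R_eq, R.RR'_eq]
  simp

lemma lift_smulRight {M : Type*} [AddCommGroup M] [Module ℂ M] (q : Module.Dual ℂ H)
    (p : H →ₗ[ℂ] M) (X : H ⊗[ℂ] H) :
    TensorProduct.lift (q.smulRight p) X = p (contract q X) := by
  induction X with
  | zero => simp
  | tmul x y => simp
  | add x y hx hy => simp only [map_add, hx, hy]

/-- If `B(x, y)` is the value of `T(?, ?, y)` on `Δ(x)`, then `B` is the value of `T` on
`(Δ ⊗ id)(X)`. -/
lemma lift_eq_lift_rTensor {M : Type*} [AddCommGroup M] [Module ℂ M]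
    (B : H →ₗ[ℂ] H →ₗ[ℂ] M) (T : H →ₗ[ℂ] H →ₗ[ℂ] H →ₗ[ℂ] M)
    (h : ∀ x y, B x y = TensorProduct.lift T (comul x) y) (X : H ⊗[ℂ] H) :
    TensorProduct.lift B X =
      TensorProduct.lift (TensorProduct.lift T) (LinearMap.rTensor H comul X) := by
  induction X with
  | zero => simp
  | tmul x y => simpa using h x y
  | add x y hx hy => simp only [map_add, hx, hy]

lemma lift_trilin {M : Type*} [AddCommGroup M] [Module ℂ M] (f : H →ₗ[ℂ] H →ₗ[ℂ] ℂ)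
    (p : H →ₗ[ℂ] M) (y : H) (q : Module.Dual ℂ H) (hq : ∀ x, f x y = q x) (X : H ⊗[ℂ] H) :
    TensorProduct.lift (trilin f p) X y = TensorProduct.lift (q.smulRight p) X := by
  induction X with
  | zero => simp
  | tmul x y => simp [hq]
  | add x y hx hy => simp only [map_add, LinearMap.add_apply, hx, hy]

variable {σ : Module.Dual ℂ H}

/-- The operator `ψ ↦ (σ ψ(? v⁻¹))(? v⁻¹)` on symmetric forms is
`ψ ↦ θ(? Ψ(ψ(? g)))`, with `θ = σ(? v⁻¹)`. -/
lemma actH_inv_conv_actH_inv (hR : R.IsFactorizable) (hs : σ ∈ SLF H)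
    (hσ : R.drinfeldMap (actH (v.pivot : H) σ) = (↑v.v⁻¹ : H)) {ψ : Module.Dual ℂ H}
    (hψ : ψ ∈ SLF H) :
    actH (↑v.v⁻¹ : H) (conv σ (actH (↑v.v⁻¹ : H) ψ)) =
      dualShift (actH (↑v.v⁻¹ : H) σ) (R.drinfeldMap (actH (v.pivot : H) ψ)) := by
  set θ := actH (↑v.v⁻¹ : H) σ with hθ
  -- One v⁻¹ is the explicit shift of ψ; the other comes from shifting the product.
  set ψ' := actH (↑v.v⁻¹ : H) (actH (↑v.v⁻¹ : H) ψ) with hψ'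
  -- The product is commuted to put θ on the right, where `conv_actH_inv` applies, and the legs are
  -- exchanged so that Δ falls on the leg shifting θ.
  rw [conv_comm_of_mem_SLF R hs (actH_mem_SLF v.inv_central hψ), actH_inv_conv, lift_R'R]
  set f : H →ₗ[ℂ] H →ₗ[ℂ] ℂ := ((LinearMap.mul ℂ H).compl₁₂
    (LinearMap.mulRight ℂ (v.pivot : H) ∘ₗ antipode ℂ) LinearMap.id).compr₂ ψ' with hf
  have h1 := lift_eq_lift_rTensor (shiftConv ψ' θ).flip (trilin f (dualShift θ)) (fun x y => by
    rw [LinearMap.flip_apply, shiftConv_apply, conv_actH_inv v hR hs hσ,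
      lift_trilin f (dualShift θ) y]
    intro x
    simp [hf]) ((R.R : H ⊗[ℂ] H) * (R.R' : H ⊗[ℂ] H))
  rw [← hψ', ← hθ, h1, lift_rTensor_comul_RR' _
    ((actL (↑v.pivot⁻¹ : H) ψ).smulRight (dualShift θ)).flip, ← lift_R'R, lift_smulRight,
    contract_R'R v hψ]
  intro x y
  simp only [trilin_apply, LinearMap.flip_apply, LinearMap.smulRight_apply, ← Finset.sum_smul]
  congr 1
  have h2 : ∀ i j, f (R.a i * R.b j) (R.b i * (y * R.a j)) =
      ψ (R.a j * antipode ℂ (R.b j) * (antipode ℂ (R.a i) * v.pivot * R.b i) *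
        (y * ↑v.v⁻¹ * ↑v.v⁻¹)) := by
    intro i j
    simp only [hf, hψ', LinearMap.compr₂_apply, LinearMap.compl₁₂_apply, LinearMap.comp_apply,
      LinearMap.mulRight_apply, LinearMap.mul_apply', LinearMap.id_apply, actH_apply,
      antipode_mul_antidistrib]
    have h3 : ∀ z : H, z * R.a j * ↑v.v⁻¹ * ↑v.v⁻¹ = z * ↑v.v⁻¹ * ↑v.v⁻¹ * R.a j := fun z => by
      rw [mul_assoc z, ← v.inv_central (R.a j), ← mul_assoc, mul_assoc (z * _),
        ← v.inv_central (R.a j), ← mul_assoc]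
    rw [← mul_assoc (R.b i), ← mul_assoc, h3, hψ]
    simp only [mul_assoc]
  simp only [h2]
  rw [Finset.sum_comm]
  simp only [← map_sum, ← Finset.sum_mul, ← Finset.mul_sum]
  -- The two sums are g⁻¹v and v; their factors v cancel the v⁻² carried by ψ', and ψ(g⁻¹ ?)
  -- remains.
  rw [v.sum_a_antipode_b, v.sum_antipode_a_pivot_b, actL_apply]
  rw [← v.inv_central (y * _), ← v.inv_central y]
  simp [mul_assoc]

/-- After applying S, invariance of R under S ⊗ S clears the antipodes of each copy in turn, giving
Ψ(σ(? g)) = v⁻¹. Injectivity of S concludes. -/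
lemma contract_antipode_R'R
    (hσ : R.drinfeldMap (actH (v.pivot : H) σ) = (↑v.v⁻¹ : H)) :
    contract (σ ∘ₗ LinearMap.mulRight ℂ (v.pivot : H) ∘ₗ antipode ℂ)
      ((R.R' : H ⊗[ℂ] H) * (R.R : H ⊗[ℂ] H)) = ↑v.v⁻¹ := by
  refine v.antipode_injective ?_
  rw [v.antipode_inv, ← hσ, drinfeldMap_eq, R.R'R_eq]
  simp only [map_sum, contract_tmul, map_smul, LinearMap.comp_apply, LinearMap.mulRight_apply,
    antipode_mul_antidistrib, actH_apply]
  have h1 : ∀ j, ∑ i, σ (antipode ℂ (R.a j) * antipode ℂ (R.b i) * v.pivot) •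
        (antipode ℂ (R.b j) * antipode ℂ (R.a i)) =
      ∑ i, σ (antipode ℂ (R.a j) * (R.b i * v.pivot)) • (antipode ℂ (R.b j) * R.a i) := by
    intro j
    have h := R.sum_map_antipode (TensorProduct.lift ((σ ∘ₗ LinearMap.mulLeft ℂ (antipode ℂ (R.a j)) ∘ₗ
      LinearMap.mulRight ℂ (v.pivot : H)).smulRight
      (LinearMap.mulLeft ℂ (antipode ℂ (R.b j)))).flip)
    simpa [mul_assoc] using h
  have h2 : ∀ i, ∑ j, σ (antipode ℂ (R.a j) * (R.b i * v.pivot)) • (antipode ℂ (R.b j) * R.a i) =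
      ∑ j, σ (R.a j * R.b i * v.pivot) • (R.b j * R.a i) := by
    intro i
    have h := R.sum_map_antipode (TensorProduct.lift ((σ ∘ₗ
      LinearMap.mulRight ℂ (R.b i * (v.pivot : H))).smulRight (LinearMap.mulRight ℂ (R.a i))))
    simpa [mul_assoc] using h
  rw [Finset.sum_comm, Finset.sum_congr rfl fun j _ => h1 j, Finset.sum_comm,
    Finset.sum_congr rfl fun i _ => h2 i, Finset.sum_comm]

/-- The braid relation for `ψ ↦ σ ψ` and `ψ ↦ ψ(? v⁻¹)`. -/
lemma conv_actH_inv_conv (hR : R.IsFactorizable) (hs : σ ∈ SLF H)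
    (hσ : R.drinfeldMap (actH (v.pivot : H) σ) = (↑v.v⁻¹ : H)) (ψ : Module.Dual ℂ H) :
    conv σ (actH (↑v.v⁻¹ : H) (conv σ ψ)) =
      actH (↑v.v⁻¹ : H) (conv σ (actH (↑v.v⁻¹ : H) ψ)) := by
  set θ := actH (↑v.v⁻¹ : H) σ with hθ
  set ψ' := actH (↑v.v⁻¹ : H) ψ with hψ'
  set q : Module.Dual ℂ H := σ ∘ₗ LinearMap.mulRight ℂ (v.pivot : H) ∘ₗ antipode ℂ with hq
  have h1 : ∀ X, conv σ (TensorProduct.lift (shiftConv θ ψ') X) =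
      TensorProduct.lift ((shiftConv θ ψ').compr₂ (actO σ)) X := by
    intro X
    induction X with
    | zero => rw [map_zero, map_zero]; exact map_zero (actO σ)
    | tmul x y => rfl
    | add x y hx hy => rw [map_add, map_add, ← hx, ← hy]; exact map_add (actO σ) _ _
  -- By associativity the outer σ meets the shifted θ, and the integral property replaces it by the
  -- scalar q(x') and a coproduct. This coproduct is the one that `lift_rTensor_comul_R'R` unfolds.
  have h2 := lift_eq_lift_rTensor ((shiftConv θ ψ').compr₂ (actO σ))
    (q.smulRight (shiftConv θ ψ')) (fun x y => by
      have h3 : actO σ (conv (dualShift θ x) (dualShift ψ' y)) =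
          conv (conv σ (dualShift θ x)) (dualShift ψ' y) :=
        (congrArg (fun F => F (dualShift ψ' y)) (actO_conv σ (dualShift θ x))).symm
      rw [LinearMap.compr₂_apply, shiftConv_apply, h3, conv_actH_inv v hR hs hσ, ← hθ]
      induction (comul x : H ⊗[ℂ] H) with
      | zero =>
        rw [map_zero, map_zero, LinearMap.zero_apply, ← actO_apply, map_zero, LinearMap.zero_apply]
      | tmul a b =>
        rw [TensorProduct.lift.tmul, ← actO_apply]
        simp [hq]
      | add a b ha hb =>
        rw [map_add, map_add, LinearMap.add_apply, ← ha, ← hb, ← actO_apply, map_add]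
        rfl) ((R.R' : H ⊗[ℂ] H) * (R.R : H ⊗[ℂ] H))
  -- The inner copy R'₁₃R₁₃ contracts against q to the central element v⁻¹, which supplies the extra
  -- shift of ψ' needed on the other side. The outer copy is the R'R of the shifted product.
  rw [actH_inv_conv, ← hθ, ← hψ', h1, h2, lift_rTensor_comul_R'R _ (q.smulRight (∑ i, ∑ j,
    shiftConv θ ψ' (R.b i * R.a j) ∘ₗ LinearMap.mulLeft ℂ (R.a i) ∘ₗ LinearMap.mulRight ℂ (R.b j))),
    lift_smulRight, contract_antipode_R'R v hσ, actH_inv_conv, R.R'R_eq]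
  · simp only [map_sum, LinearMap.sum_apply, TensorProduct.lift.tmul, shiftConv_apply]
    refine Finset.sum_congr rfl fun i _ => Finset.sum_congr rfl fun j _ => ?_
    simp only [LinearMap.comp_apply, LinearMap.mulLeft_apply, LinearMap.mulRight_apply,
      shiftConv_apply]
    congr 1
    ext y
    simp only [dualShift_apply, actH_apply, v.inv_central, mul_assoc]
  · intro x y
    simp [Finset.smul_sum]

/-- `χ(S ?) θ(? Ψ(ψ(? g))) = θ(? Ψ(ψ(? z g)))` for `z = Ψ(χ(? g))`. -/
lemma conv_antipode_dualShift (hR : R.IsFactorizable) (hs : σ ∈ SLF H)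
    (hσ : R.drinfeldMap (actH (v.pivot : H) σ) = (↑v.v⁻¹ : H)) {χ ψ : Module.Dual ℂ H}
    (hχ : χ ∈ SLF H) (hψ : ψ ∈ SLF H) :
    conv (χ ∘ₗ antipode ℂ)
        (dualShift (actH (↑v.v⁻¹ : H) σ) (R.drinfeldMap (actH (v.pivot : H) ψ))) =
      dualShift (actH (↑v.v⁻¹ : H) σ) (R.drinfeldMap (actH (v.pivot : H)
        (actH (R.drinfeldMap (actH (v.pivot : H) χ)) ψ))) := by
  set θ := actH (↑v.v⁻¹ : H) σ with hθ
  set z := R.drinfeldMap (actH (v.pivot : H) χ) with hz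
  have hzc : ∀ x, z * x = x * z := drinfeldMap_pivot_central v hχ
  rw [← contract_R'R v hψ, ← contract_R'R v (actH_mem_SLF hzc hψ)]
  set q := actL (↑v.pivot⁻¹ : H) ψ with hq
  -- In conv_actH_inv the antipode is applied once more; S(S(x)g) = xg⁻¹ explains the plain shift of
  -- χ by g⁻¹.
  set f : H →ₗ[ℂ] H →ₗ[ℂ] ℂ :=
    (χ ∘ₗ LinearMap.mulRight ℂ (↑v.pivot⁻¹ : H)).smulRight q with hf
  have h1 : conv (χ ∘ₗ antipode ℂ) (dualShift θ (contract q
      ((R.R' : H ⊗[ℂ] H) * (R.R : H ⊗[ℂ] H)))) = TensorProduct.lift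
      (q.smulRight (actO (χ ∘ₗ antipode ℂ) ∘ₗ dualShift θ)).flip
      ((R.R : H ⊗[ℂ] H) * (R.R' : H ⊗[ℂ] H)) := by
    rw [← lift_R'R, lift_smulRight]
    rfl
  have h2 := lift_eq_lift_rTensor (q.smulRight (actO (χ ∘ₗ antipode ℂ) ∘ₗ dualShift θ)).flip
    (trilin f (dualShift θ)) (fun x y => by
      rw [LinearMap.flip_apply, LinearMap.smulRight_apply, LinearMap.smul_apply,
        LinearMap.comp_apply, actO_apply, conv_actH_inv v hR hs hσ, ← hθ,
        lift_trilin f (dualShift θ) y (q y • ((χ ∘ₗ antipode ℂ) ∘ₗ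
          LinearMap.mulRight ℂ (v.pivot : H) ∘ₗ antipode ℂ))]
      · induction (comul x : H ⊗[ℂ] H) with
        | zero => simp
        | tmul a b => simp [mul_smul]
        | add a b ha hb => simp only [map_add, smul_add, ha, hb]
      · intro x
        simp [hf, antipode_mul_antidistrib, v.antipode_pivot, v.antipode_sq, mul_assoc, mul_comm])
    ((R.R : H ⊗[ℂ] H) * (R.R' : H ⊗[ℂ] H))
  rw [h1, h2, lift_rTensor_comul_RR' _ ((actL (↑v.pivot⁻¹ : H)
    (actH z ψ)).smulRight (dualShift θ)).flip, ← lift_R'R, lift_smulRight]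
  intro x y
  simp only [trilin_apply, LinearMap.flip_apply, LinearMap.smulRight_apply, ← Finset.sum_smul]
  congr 1
  -- The factor g⁻¹ is carried across R by its invariance under g ⊗ g; what is left is the second
  -- expression for Ψ(χ(? g)) in `sum_pivot_inv_eq_drinfeldMap`.
  have h3 : ∑ i, ∑ j, χ (R.a i * (R.b j * ↑v.pivot⁻¹)) • (R.a j * ↑v.pivot⁻¹ * R.b i) =
      ↑v.pivot⁻¹ * z := by
    rw [hz, ← sum_pivot_inv_eq_drinfeldMap v hχ, Finset.mul_sum]
    refine Finset.sum_congr rfl fun i _ => ?_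
    have h4 := sum_b_pivot_inv v ((χ ∘ₗ LinearMap.mulLeft ℂ (R.a i)).smulRight
      (LinearMap.mulRight ℂ (R.b i)))
    simpa [mul_assoc, Finset.mul_sum] using h4
  have h5 : ∀ i j, f (R.a i * R.b j) (R.b i * (y * R.a j)) =
      ψ (χ (R.a i * (R.b j * ↑v.pivot⁻¹)) • (R.a j * ↑v.pivot⁻¹ * R.b i) * y) := by
    intro i j
    rw [smul_mul_assoc, map_smul]
    simp only [hf, hq, LinearMap.smulRight_apply, LinearMap.smul_apply, LinearMap.comp_apply,
      LinearMap.mulRight_apply, actL_apply]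
    rw [mul_assoc (R.a i)]
    congr 1
    rw [← mul_assoc (R.b i), ← mul_assoc, hψ]
    simp only [mul_assoc]
  simp only [h5]
  simp only [← map_sum, ← Finset.sum_mul, h3]
  rw [actL_apply, actH_apply, mul_assoc, hzc, ← mul_assoc]

lemma conv_counit (χ : Module.Dual ℂ H) : conv χ (counit : H →ₗ[ℂ] ℂ) = χ :=
  congrArg WithConv.ofConv (mul_one (toConv (χ : H →ₗ[ℂ] ℂ)))

/-- `θ(? Λ) = θ(Λ) ε` for `Λ = Ψ(θ(? g))`. -/
lemma dualShift_integral (hR : R.IsFactorizable) (hs : σ ∈ SLF H)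
    (hσ : R.drinfeldMap (actH (v.pivot : H) σ) = (↑v.v⁻¹ : H)) :
    ∃ c : ℂ, dualShift (actH (↑v.v⁻¹ : H) σ)
      (R.drinfeldMap (actH (v.pivot : H) (actH (↑v.v⁻¹ : H) σ))) = c • (counit : H →ₗ[ℂ] ℂ) := by
  set θ := actH (↑v.v⁻¹ : H) σ with hθ
  set t := actH (v.pivot : H) θ with ht
  refine ⟨θ (R.drinfeldMap t), ?_⟩
  have hc := drinfeldMap_pivot_central v (actH_mem_SLF v.inv_central hs)
  have ht' : t = actH (↑v.v⁻¹ : H) (actH (v.pivot : H) σ) := by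
    ext x
    simp only [ht, hθ, actH_apply, mul_assoc, v.inv_central]
  ext y
  -- Every element is some Ψ(β), and Ψ(β)Ψ(t) = Ψ(βt) = β(1)Ψ(t) with β(1) = ε(Ψ(β)). So Ψ sends the
  -- integral t of H* to an element Λ with yΛ = ε(y)Λ.
  obtain ⟨β, rfl⟩ := hR.2 y
  have h1 : conv β t = β 1 • t := by
    ext x
    rw [conv_eq_hit, ht', integral v hR hσ, map_smul]
    simp [mul_comm]
  have h2 := drinfeldMap_conv hc β
  rw [← hθ, ← ht, h1, map_smul] at h2
  rw [dualShift_apply, ← h2, map_smul, LinearMap.smul_apply, counit_drinfeldMap]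
  simp [mul_comm]

/-- The square of the operator `ψ ↦ (σ ψ(? v⁻¹))(? v⁻¹)` is proportional to `ψ ↦ ψ ∘ S`. -/
lemma sq_actH_inv_conv_actH_inv (hR : R.IsFactorizable) (hs : σ ∈ SLF H)
    (hσ : R.drinfeldMap (actH (v.pivot : H) σ) = (↑v.v⁻¹ : H)) :
    ∃ c : ℂ, ∀ χ ∈ SLF H, actH (↑v.v⁻¹ : H) (conv σ (actH (↑v.v⁻¹ : H)
      (actH (↑v.v⁻¹ : H) (conv σ (actH (↑v.v⁻¹ : H) χ))))) = c • (χ ∘ₗ antipode ℂ) := by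
  obtain ⟨c, hc⟩ := dualShift_integral v hR hs hσ
  refine ⟨c, fun χ hχ => ?_⟩
  have hθ := actH_mem_SLF v.inv_central hs
  have h1 : ∀ z, dualShift (actH (↑v.v⁻¹ : H) σ) z = actH z (actH (↑v.v⁻¹ : H) σ) := fun z => rfl
  have hz := drinfeldMap_pivot_central v hχ
  -- The first transform of χ is θ shifted by the central element z = Ψ(χ(? g)). Transforming again,
  -- the shift by z becomes a factor χ ∘ S, and the transform of θ itself is c·ε, the unit of H* up
  -- to a scalar.
  rw [actH_inv_conv_actH_inv v hR hs hσ hχ, h1,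
    actH_inv_conv_actH_inv v hR hs hσ (actH_mem_SLF hz hθ),
    ← conv_antipode_dualShift v hR hs hσ hχ hθ, hc, ← actO_apply, map_smul, actO_apply,
    conv_counit]

end Relations
end
end TorusModular

namespace TorusModular

open scoped TensorProduct
open Coalgebra HopfAlgebra WithConv

noncomputable section

/-! ### The Dehn twist operators on SLF(H) -/

section ModularRepresentation

set_option linter.unusedSectionVars false

/-- The scalar need not be known to be nonzero: an invertible operator on a nonzero space is not
zero. This spares any evaluation of the constant c of the squared Fourier transform. -/
lemma PGL.mk_eq_one {V : Type*} [AddCommGroup V] [Module ℂ V] [Nontrivial V]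
    {x : (Module.End ℂ V)ˣ} {c : ℂ} (h : (x : Module.End ℂ V) = c • 1) : PGL.mk V x = 1 := by
  refine (QuotientGroup.eq_one_iff x).2 ?_
  have hc : c ≠ 0 := by
    rintro rfl
    rw [zero_smul] at h
    exact x.ne_zero h
  refine ⟨Units.mk0 c hc, Units.ext ?_⟩
  rw [h]
  change algebraMap ℂ (Module.End ℂ V) c = _
  rw [Algebra.algebraMap_eq_smul_one]

variable {H : Type*} [Ring H] [HopfAlgebra ℂ H] [FiniteDimensional ℂ H]
  {R : UniversalRMatrix H}

instance : Nontrivial (SLF H) := by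
  refine ⟨⟨⟨(counit : H →ₗ[ℂ] ℂ), fun x y => ?_⟩, 0, fun h => ?_⟩⟩
  · rw [Bialgebra.counit_mul, Bialgebra.counit_mul, mul_comm]
  · have := congrArg (fun F : SLF H => (F : Module.Dual ℂ H) 1) h
    simp at this

/-- The operator `ψ ↦ ψ ∘ S` on symmetric forms. -/
def slfAntipode (H : Type*) [Ring H] [HopfAlgebra ℂ H] : Module.End ℂ (SLF H) :=
  (LinearMap.lcomp ℂ ℂ (antipode ℂ : H →ₗ[ℂ] H)).restrict fun ψ hψ x y => by
    simp only [LinearMap.lcomp_apply, antipode_mul_antidistrib]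
    exact hψ _ _

@[simp] lemma slfAntipode_apply (ψ : SLF H) :
    (slfAntipode H ψ : Module.Dual ℂ H) = (ψ : Module.Dual ℂ H) ∘ₗ antipode ℂ := rfl

/-- S² is conjugation by g, which symmetric forms do not see. -/
lemma slfAntipode_sq (v : RibbonElement R) : slfAntipode H * slfAntipode H = 1 := by
  ext ψ x
  have h := ψ.2 (v.pivot * x) ↑v.pivot⁻¹
  rw [Units.inv_mul_cancel_left] at h
  simp only [Module.End.mul_apply, slfAntipode_apply, LinearMap.comp_apply, v.antipode_sq, h]
  rfl

variable (hR : R.IsFactorizable) (v : RibbonElement R)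

lemma rhoSLF_ribbonA_apply (ψ : SLF H) :
    (rhoSLF R (ribbonA hR v) ψ : Module.Dual ℂ H) = actH (↑v.v⁻¹ : H) ψ := by
  rw [rhoSLF_apply]
  change handleRep R (jA R (loopM R _)) _ = _
  rw [jA, loopLift_loopM, handleRep, handleLift_handleA, actA_eq, LinearMap.comp_apply]
  exact congrArg (fun z => actH z (ψ : Module.Dual ℂ H))
    ((LinearEquiv.ofBijective R.drinfeldMap hR).apply_symm_apply _)

/-- The operators of the Dehn twists on `SLF(H)`: they satisfy the braid relation, and `(ab)³` is
proportional to the action of the antipode. -/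
lemma exists_dehnTwist_units : ∃ tA tB : (Module.End ℂ (SLF H))ˣ,
    (tA : Module.End ℂ (SLF H)) = rhoSLF R (ribbonA hR v) ∧
    (tB : Module.End ℂ (SLF H)) = rhoSLF R (ribbonB hR v) ∧
    tA * tB * tA = tB * tA * tB ∧
    ∃ c : ℂ, (((tA * tB) ^ 3 : (Module.End ℂ (SLF H))ˣ) : Module.End ℂ (SLF H)) =
      c • slfAntipode H := by
  set φ := (LinearEquiv.ofBijective R.drinfeldMap hR).symm (↑v.v⁻¹ : H) with hφ
  have hΨ : R.drinfeldMap φ = (↑v.v⁻¹ : H) :=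
    (LinearEquiv.ofBijective R.drinfeldMap hR).apply_symm_apply _
  set σ := actH (↑v.pivot⁻¹ : H) φ with hσd
  -- v⁻¹ is central, so φ is twisted, and its shift by g⁻¹ is symmetric.
  have hs : σ ∈ SLF H := actH_pivot_inv_mem_SLF v
    (isTwisted_of_central hR fun x => by rw [hΨ, v.inv_central])
  have hφσ : actH (v.pivot : H) σ = φ := by
    rw [hσd, ← Module.End.mul_apply, ← map_mul, Units.mul_inv, map_one, Module.End.one_apply]
  have hσ : R.drinfeldMap (actH (v.pivot : H) σ) = (↑v.v⁻¹ : H) := by rw [hφσ, hΨ]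
  set A := rhoSLF R (ribbonA hR v) with hA
  have hA' := rhoSLF_ribbonA_apply hR v
  rw [← hA] at hA'
  set D : Module.End ℂ (SLF H) :=
    (actH (v.v : H)).restrict fun _ hψ => actH_mem_SLF v.central hψ with hD
  have hD' : ∀ ψ : SLF H, (D ψ : Module.Dual ℂ H) = actH (v.v : H) ψ := fun ψ => rfl
  set N : Module.End ℂ (SLF H) := (actO σ).restrict fun _ hψ => conv_mem_SLF hs hψ with hN
  have hN' : ∀ ψ : SLF H, (N ψ : Module.Dual ℂ H) = conv σ ψ := fun ψ => rfl
  have hAD : A * D = 1 := by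
    ext1 ψ
    refine Subtype.ext ?_
    rw [Module.End.mul_apply, hA', hD', ← Module.End.mul_apply, ← map_mul, Units.inv_mul, map_one]
    rfl
  have hDA : D * A = 1 := by
    ext1 ψ
    refine Subtype.ext ?_
    rw [Module.End.mul_apply, hD', hA', ← Module.End.mul_apply, ← map_mul, Units.mul_inv, map_one]
    rfl
  -- Injectivity suffices for invertibility since SLF(H) is finite-dimensional.
  have hNinj : Function.Injective N := by
    rw [← LinearMap.ker_eq_bot, LinearMap.ker_eq_bot']
    intro ψ hψ
    refine Subtype.ext (eq_zero_of_conv_eq_zero v hR ψ.2 hσ ?_)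
    rw [← hN', hψ]
    rfl
  obtain ⟨n, hn⟩ := (LinearMap.isUnit_iff_ker_eq_bot N).2 (LinearMap.ker_eq_bot.2 hNinj)
  set a : (Module.End ℂ (SLF H))ˣ := ⟨A, D, hAD, hDA⟩ with ha
  have hbraid : n * a * n = a * n * a := by
    refine Units.ext ?_
    simp only [Units.val_mul, hn, ha]
    ext1 ψ
    refine Subtype.ext ?_
    simp only [Module.End.mul_apply, hN', hA']
    exact conv_actH_inv_conv v hR hs hσ ψ
  obtain ⟨c, hc⟩ := sq_actH_inv_conv_actH_inv v hR hs hσ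
  have hsq : A * N * A * (A * N * A) = c • slfAntipode H := by
    ext1 ψ
    refine Subtype.ext ?_
    simp only [Module.End.mul_apply, hN', hA']
    exact hc ψ ψ.2
  have hAS : A * slfAntipode H = slfAntipode H * A := by
    ext ψ x
    simp only [Module.End.mul_apply, hA', slfAntipode_apply, LinearMap.comp_apply, actH_apply,
      antipode_mul_antidistrib, v.antipode_inv, v.inv_central]
  -- By `actB_eq`, v_B⁻¹ acts by ψ ↦ (σψ(? v))(? v⁻¹), i.e. by a n a⁻¹.
  refine ⟨a, a * n * a⁻¹, rfl, ?_, ?_, c, ?_⟩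
  · change A * (n : Module.End ℂ (SLF H)) * D = _
    rw [hn]
    ext1 ψ
    refine Subtype.ext ?_
    have h1 : (rhoSLF R (ribbonB hR v) ψ : Module.Dual ℂ H) = actB R φ ψ := by
      rw [rhoSLF_apply]
      change handleRep R (jB R (loopM R _)) _ = _
      rw [jB, loopLift_loopM, handleRep, handleLift_handleB]
    rw [h1, ← hφσ, actB_eq v hs]
    simp only [Module.End.mul_apply, hN', hA', hD']
  · calc a * (a * n * a⁻¹) * a = a * (a * n * a) * a⁻¹ := by group
      _ = a * n * a⁻¹ * a * (a * n * a⁻¹) := by rw [← hbraid]; group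
  -- The cube is a conjugate of (ana)(nan), which the braid relation turns into (ana)². The
  -- conjugation is harmless because a commutes with the antipode operator, as S(v⁻¹) = v⁻¹ is
  -- central.
  · have h1 : (a * (a * n * a⁻¹)) ^ 3 = a * (a * n * a * (n * a * n)) * a⁻¹ := by
      rw [pow_three]; group
    have h2 : ((a * (a * n * a * (n * a * n)) * a⁻¹ : (Module.End ℂ (SLF H))ˣ) :
        Module.End ℂ (SLF H)) = A * (A * N * A * (A * N * A)) * D := by
      rw [hbraid]
      simp only [Units.val_mul, hn]
      rfl
    rw [h1, h2, hsq, mul_smul_comm, smul_mul_assoc, hAS, mul_assoc, hAD, mul_one]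

end ModularRepresentation
end
end TorusModular

/-! ### The projective representations -/

open scoped MatrixGroups in
open TorusModular in
theorem theorem5p6 {H : Type*} [Ring H] [HopfAlgebra ℂ H] [FiniteDimensional ℂ H]
    (R : UniversalRMatrix H) (hR : R.IsFactorizable) (v : RibbonElement R) :
    ∃ tA tB : (Module.End ℂ (SLF H))ˣ,
      (tA : Module.End ℂ (SLF H)) = rhoSLF R (ribbonA hR v) ∧
      (tB : Module.End ℂ (SLF H)) = rhoSLF R (ribbonB hR v) ∧
      (∃! θ : SL(2, ℤ) →* PGL (SLF H),
        θ tauA = PGL.mk (SLF H) tA ∧ θ tauB = PGL.mk (SLF H) tB) ∧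
      ((∀ ψ ∈ SLF H, ψ ∘ₗ HopfAlgebra.antipode ℂ = ψ) →
        ∃! θ : Matrix.ProjectiveSpecialLinearGroup (Fin 2) ℤ →* PGL (SLF H),
          θ (QuotientGroup.mk tauA) = PGL.mk (SLF H) tA ∧
          θ (QuotientGroup.mk tauB) = PGL.mk (SLF H) tB) := by
  obtain ⟨tA, tB, hA, hB, hab, c, h3⟩ := exists_dehnTwist_units hR v
  have hab' : PGL.mk (SLF H) tA * PGL.mk (SLF H) tB * PGL.mk (SLF H) tA =
      PGL.mk (SLF H) tB * PGL.mk (SLF H) tA * PGL.mk (SLF H) tB := by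
    simp only [← map_mul, hab]
  refine ⟨tA, tB, hA, hB, ?_, fun hS => ?_⟩
  · have h6 : (PGL.mk (SLF H) tA * PGL.mk (SLF H) tB) ^ 6 = 1 := by
      rw [← map_mul, ← map_pow]
      -- (ab)⁶ is the square of c times the antipode operator, itself an involution.
      refine PGL.mk_eq_one (c := c * c) ?_
      rw [show 6 = 3 + 3 from rfl, pow_add, Units.val_mul, h3, smul_mul_smul_comm,
        slfAntipode_sq v]
    obtain ⟨θ, h⟩ := exists_hom_SL2Z _ _ hab' h6
    exact ⟨θ, h, fun θ' h' => hom_SL2Z_ext (h'.1.trans h.1.symm) (h'.2.trans h.2.symm)⟩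
  · have hone : slfAntipode H = 1 := by
      ext1 ψ
      exact Subtype.ext (hS ψ ψ.2)
    have h3' : (PGL.mk (SLF H) tA * PGL.mk (SLF H) tB) ^ 3 = 1 := by
      rw [← map_mul, ← map_pow]
      exact PGL.mk_eq_one (h3.trans (by rw [hone]))
    obtain ⟨θ, h⟩ := exists_hom_PSL2Z _ _ hab' h3'
    exact ⟨θ, h, fun θ' h' => hom_PSL2Z_ext (h'.1.trans h.1.symm) (h'.2.trans h.2.symm)⟩
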